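/- **Lemma 2.3 (Khasminskii-type estimate for the Euler–Maruyama scheme).** Let $d,m\ge 1$, let $(W_t)_{t\ge0}$ be an $m$-dimensional Brownian motion on a filtered probability space $(\Omega,\mathscr F,(\mathscr F_t)_{t\ge0},\mathbb P)$, and let $b:\mathbb R^d\to\mathbb R^d$ (Borel) and $\sigma:\mathbb R^d\to\mathbb R^d\otimes\mathbb R^m$ satisfy: * (A1) $\|b\|_\infty:=\sup_{x\in\mathbb R^d}|b(x)|<\infty$, and $|b|^2\in L^{r}(\mathbb R^d)$ for some $r>d/2$; * (A3) there are constants $\breve\lambda_0,\hat\lambda_0,L_0>0$ such that $\breve\lambda_0|\xi|^2\le\langle(\sigma\sigma^*)(x)\xi,\xi\rangle\le\hat\lambda_0|\xi|^2$ and $\|\sigma(x)-\sigma(y)\|_{\rm HS}\le L_0|x-y|$ for all $x,y,\xi\in\mathbb R^d$, where $\|\cdot\|_{\rm HS}$ is the Hilbert–Schmidt norm. For $\delta\in(0,1)$ and $x\in\mathbb R^d$ let $X^{(\delta)}$ be the continuous-time Euler–Maruyama scheme $$dX^{(\delta)}_t=b(X^{(\delta)}_{t_\delta})\,dt+\sigma(X^{(\delta)}_{t_\delta})\,dW_t,\quad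 t\ge0,\qquad X^{(\delta)}_0=x,\qquad t_\delta:=\lfloor t/\delta\rfloor\delta .$$ Let $T\ge0$ and $p,q\in(1,\infty)$ with $\frac dp+\frac2q<2$, and let $f$ be a Borel measurable function on $[0,T]\times\mathbb R^d$ with values in a Euclidean space $\mathbb R^n$ such that $$\|f\|_{L^p_q(T)}:=\Big(\int_0^T\Big(\int_{\mathbb R^d}|f_t(x)|^p\,dx\Big)^{q/p}dt\Big)^{1/q}<\infty .$$ Then $\int_0^T|f_t(X^{(\delta)}_t)|\,dt<\infty$ almost surely and, for every $\lambda>0$, $$\mathbb E\exp\Big(\lambda\int_0^T|f_t(X^{(\delta)}_t)|\,dt\Big)\le 2^{\,1+T(2\lambda\alpha_0\|f\|_{L^p_q(T)})^{\gamma_0}},\qquad \gamma_0:=\frac1{1-\frac1q-\frac d{2p}},$$ where the constant $\alpha_0$ does not depend on $\delta$, $x$, $f$, $\lambda$ and is given by $$\alpha_0:=\frac{(1-\frac1p)^{\frac d2(1-\frac1p)}}{(\breve\lambda_0(2\pi)^{1/p})^{d/2}}\Big\{\hat\lambda_0^{\frac d2(1-\frac1p)}+\Lambda_3\big(\gamma_0(1-\tfrac1q)\big)^{\frac{q-1}q}\Big(\frac{\kappa_0}2\Big)^{\frac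 d2(1-\frac1p)}\Big\},$$ $$\kappa_0:=4(1+24d)\hat\lambda_0,\qquad \Lambda_3:=\Lambda_2\,e^{\frac{\|b\|_\infty^2}{2\hat\lambda_0}}\Big(\frac{\kappa_0}{2\breve\lambda_0}\Big)^{d/2},\qquad \Lambda_2:=e^{\frac{\|b\|_\infty T}{2\hat\lambda_0}}\sum_{i=0}^\infty\frac{\big(\Lambda_1\sqrt{\pi T}\,((1+24d)\hat\lambda_0/\breve\lambda_0)^d\big)^i}{\Gamma(1+\frac i2)},$$ and $\Lambda_1:=\max\{\Lambda_1',\Lambda_1''\}$ with $$\Lambda_1':=2\Big\{\frac{\|b\|_\infty}{\sqrt{\breve\lambda_0}}+2\sqrt d\,L_0\Big(\frac{\hat\lambda_0}{\breve\lambda_0}\Big)^2+d^{\frac d2+1}d!\Big(\frac{\hat\lambda_0}{\breve\lambda_0}\Big)^dL_0\Big\}e^{\frac{\|b\|_\infty^2T}{\hat\lambda_0}},$$ $$\begin{aligned}\Lambda_1'':=\Big\{&2\sqrt{\hat\lambda_0}\,\|b\|_\infty+(\|b\|_\infty^2+2\hat\lambda_0L_0\sqrt d)(\sqrt d+2)\\&+2^{m+11}\breve\lambda_0^{-1}(L_0+2\|b\|_\infty)\Big((\|b\|_\infty^3+(d\hat\lambda_0)^{3/2})+\breve\lambda_0^{1/2}(\|b\|_\infty^2+d\hat\lambda_0)\Big)\Big\}\frac{2^{\frac{d+1}2}}{\breve\lambda_0}\,e^{\frac{(\|b\|_\infty+\|b\|_\infty^2)T}{\hat\lambda_0}}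 .\end{aligned}$$ -/

import Mathlib

open MeasureTheory ProbabilityTheory
open scoped NNReal ENNReal Matrix

noncomputable section

namespace EMScheme

/-- Euclidean space `ℝ^d` with the Euclidean norm and Lebesgue measure. -/
abbrev E (d : ℕ) : Type := EuclideanSpace ℝ (Fin d)

/-- The action of a `d × m` matrix on a vector of `ℝ^m`. -/
def act {d m : ℕ} (A : Matrix (Fin d) (Fin m) ℝ) (v : E m) : E d :=
  WithLp.toLp 2 (A *ᵥ v.ofLp)

/-- The Hilbert-Schmidt norm of a matrix. -/
def hsNorm {d m : ℕ} (A : Matrix (Fin d) (Fin m) ℝ) : ℝ :=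
  Real.sqrt (∑ i, ∑ j, A i j ^ 2)

/-- The supremum norm `‖b‖_∞ = sup_x |b x|` (used only for bounded `b`). -/
def supNorm {d : ℕ} (b : E d → E d) : ℝ := ⨆ x, ‖b x‖

/-- Assumption on the drift: `b` is (Borel and) bounded, and `|b|²` lies in some `L^r`, `r > d/2`. -/
structure DriftAssumption {d : ℕ} (b : E d → E d) : Prop where
  measurable : Measurable b
  bounded : BddAbove (Set.range fun x => ‖b x‖)
  memLp : ∃ r : ℝ, (d : ℝ) / 2 < r ∧
    MemLp (fun x => ‖b x‖ ^ 2) (ENNReal.ofReal r) volume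

/-- Assumption on the diffusion coefficient with the constants `lo, hi, L₀ > 0`: uniform ellipticity and boundedness of
`σ σ*`, and Lipschitz continuity of `σ` in the Hilbert-Schmidt norm. -/
structure DiffusionAssumption {d m : ℕ} (σ : E d → Matrix (Fin d) (Fin m) ℝ) (lo hi L₀ : ℝ) :
    Prop where
  lo_pos : 0 < lo
  hi_pos : 0 < hi
  L_pos : 0 < L₀
  lower : ∀ x ξ : E d, lo * ‖ξ‖ ^ 2 ≤ inner ℝ (act (σ x * (σ x)ᵀ) ξ) ξ
  upper : ∀ x ξ : E d, inner ℝ (act (σ x * (σ x)ᵀ) ξ) ξ ≤ hi * ‖ξ‖ ^ 2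
  lipschitz : ∀ x y : E d, hsNorm (σ x - σ y) ≤ L₀ * ‖x - y‖

/-- `W` is an `m`-dimensional Brownian motion with respect to the filtration `𝓕`: adapted, started
at `0`, with continuous paths, and with increments `W_t - W_s` that are independent of `𝓕_s` and
have the centred Gaussian law with covariance `(t - s) I`. -/
structure IsBrownian {Ω : Type*} {mΩ : MeasurableSpace Ω} {m : ℕ} (W : ℝ≥0 → Ω → E m)
    (𝓕 : Filtration ℝ≥0 mΩ) (P : Measure Ω) : Prop where
  adapted : ∀ t, Measurable[𝓕 t] (W t)
  zero : ∀ᵐ ω ∂P, W 0 ω = 0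
  continuous : ∀ᵐ ω ∂P, Continuous fun t => W t ω
  law : ∀ s t, s ≤ t → P.map (fun ω => W t ω - W s ω) =
    (stdGaussian (E m)).map fun z => Real.sqrt ((t : ℝ) - s) • z
  indep : ∀ s t, s ≤ t →
    Indep (MeasurableSpace.comap (fun ω => W t ω - W s ω) inferInstance) (𝓕 s) P

/-- The Euler-Maruyama scheme at the grid points: the value at time `k δ`, started at `x` and
driven by the path `w`. -/
def emGrid {d m : ℕ} (b : E d → E d) (σ : E d → Matrix (Fin d) (Fin m) ℝ) (x : E d) (δ : ℝ≥0)
    (w : ℝ≥0 → E m) : ℕ → E d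
  | 0 => x
  | k + 1 =>
    let y := emGrid b σ x δ w k
    y + (δ : ℝ) • b y + act (σ y) (w ((k + 1 : ℕ) * δ) - w ((k : ℕ) * δ))

/-- The continuous-time Euler-Maruyama scheme at time `t`. The coefficients of
`dX_t = b(X_{t_δ}) dt + σ(X_{t_δ}) dW_t`, `t_δ = ⌊t/δ⌋ δ`, `X_0 = x`, are constant in time on each
`[k δ, (k+1) δ)`, so that, for `k = ⌊t/δ⌋`, the equation reads
`X_t = X_{kδ} + b(X_{kδ}) (t - kδ) + σ(X_{kδ}) (W_t - W_{kδ})`. -/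
def emPath {d m : ℕ} (b : E d → E d) (σ : E d → Matrix (Fin d) (Fin m) ℝ) (x : E d) (δ : ℝ≥0)
    (w : ℝ≥0 → E m) (t : ℝ≥0) : E d :=
  let k := ⌊t / δ⌋₊
  let y := emGrid b σ x δ w k
  y + ((t : ℝ) - (k : ℝ) * δ) • b y + act (σ y) (w t - w ((k : ℕ) * δ))

/-- The (possibly infinite) norm of `f` in `L^p_q(T)`:
`(∫_0^T (∫ |f_t(x)|^p dx)^{q/p} dt)^{1/q}`. -/
def eNormLpq {d n : ℕ} (f : ℝ → E d → E n) (p q T : ℝ) : ℝ≥0∞ :=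
  (∫⁻ t in Set.Icc 0 T, (∫⁻ x, ‖f t x‖ₑ ^ p) ^ (q / p)) ^ (1 / q)

/-- `f ∈ L^p_q(T)`: Borel measurable with finite norm. Only the values at times in `[0, T]`
enter the norm. -/
def MemLpq {d n : ℕ} (f : ℝ → E d → E n) (p q T : ℝ) : Prop :=
  Measurable (Function.uncurry f) ∧ eNormLpq f p q T < ∞

/-- The norm of `f ∈ L^p_q(T)` as a real number. -/
def normLpq {d n : ℕ} (f : ℝ → E d → E n) (p q T : ℝ) : ℝ := (eNormLpq f p q T).toReal

/-! The explicit constants. Throughout, `B` stands for `‖b‖_∞`. -/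

/-- `Λ₁`. -/
def Lambda1 (d m : ℕ) (T B L₀ lo hi : ℝ) : ℝ :=
  max
    (2 * (B / Real.sqrt lo + 2 * Real.sqrt d * L₀ * (hi / lo) ^ 2
        + (d : ℝ) ^ ((d : ℝ) / 2 + 1) * (d.factorial : ℝ) * (hi / lo) ^ d * L₀)
      * Real.exp (B ^ 2 * T / hi))
    ((2 * Real.sqrt hi * B + (B ^ 2 + 2 * hi * L₀ * Real.sqrt d) * (Real.sqrt d + 2)
        + 2 ^ (m + 11) * lo⁻¹ * (L₀ + 2 * B)
          * ((B ^ 3 + ((d : ℝ) * hi) ^ ((3 : ℝ) / 2))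
              + lo ^ ((1 : ℝ) / 2) * (B ^ 2 + (d : ℝ) * hi)))
      * ((2 : ℝ) ^ (((d : ℝ) + 1) / 2) / lo)
      * Real.exp ((B + B ^ 2) * T / hi))

/-- `Λ₂`. -/
def Lambda2 (d m : ℕ) (T B L₀ lo hi : ℝ) : ℝ :=
  Real.exp (B * T / (2 * hi)) *
    ∑' i : ℕ, (Lambda1 d m T B L₀ lo hi * Real.sqrt (Real.pi * T)
        * ((1 + 24 * (d : ℝ)) * hi / lo) ^ d) ^ i / Real.Gamma (1 + (i : ℝ) / 2)

/-- `κ₀`. -/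
def kappa0 (d : ℕ) (hi : ℝ) : ℝ := 4 * (1 + 24 * (d : ℝ)) * hi

/-- `Λ₃`. -/
def Lambda3 (d m : ℕ) (T B L₀ lo hi : ℝ) : ℝ :=
  Lambda2 d m T B L₀ lo hi * Real.exp (B ^ 2 / (2 * hi))
    * (kappa0 d hi / (2 * lo)) ^ ((d : ℝ) / 2)

/-- `γ₀ = 1 / (1 - 1/q - d/(2p))`. -/
def gamma0 (d : ℕ) (p q : ℝ) : ℝ := 1 / (1 - 1 / q - (d : ℝ) / (2 * p))

/-- `α₀`. -/
def alpha0 (d m : ℕ) (T B L₀ lo hi p q : ℝ) : ℝ :=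
  (1 - 1 / p) ^ ((d : ℝ) / 2 * (1 - 1 / p)) / (lo * (2 * Real.pi) ^ (1 / p)) ^ ((d : ℝ) / 2)
    * (hi ^ ((d : ℝ) / 2 * (1 - 1 / p))
      + Lambda3 d m T B L₀ lo hi * (gamma0 d p q * (1 - 1 / q)) ^ ((q - 1) / q)
        * (kappa0 d hi / 2) ^ ((d : ℝ) / 2 * (1 - 1 / p)))

end EMScheme

end

noncomputable section

namespace EMScheme

/-! ### Matrices acting on Euclidean space and elliptic quadratic forms. -/

section LinearAlgebra

variable {d m k : ℕ}

/-! Khasminskii's argument reduces the exponential bound to a Krylov estimate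
(`lintegral_lintegral_emPath_le`): for every `𝓕 s`-measurable weight `H ≥ 0`, E[H ∫_s^t |f_u(X_u)|
du] ≤ α₀ ‖f‖ (t - s)^{1/γ₀} E[H]. Cut `[0, T]` into N = ⌊T (2λα₀‖f‖)^{γ₀}⌋ + 1 equal intervals. On
each of them λ times the right side is at most E[H]/2, so each interval costs a factor 2, and 2^N is
within the claimed bound. Weights `H` take the place of conditional expectations throughout.

The Krylov estimate rests on Gaussian domination (`lintegral_emPath_le`): given the past up to `s`,
the law of X_u is at most a constant, free of δ and x, times the heat kernel of variance `kap * (u -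
s)`. Hölder's inequality in space leaves the singularity (u - s)^{-d/(2p)}, and d/p + 2/q < 2 says
that it lies in L^{q'} in time, with 1/q + 1/q' = 1.

Domination is a discrete parametrix argument (`lintegral_chain_le`). Fix the end point y and compare
the scheme with the Gaussian whose covariance is frozen at y. Replacing the coefficients at z by
those at y over one step of length η, when time t remains from the start of that step, costs at most
C η t^{-1/2} times a wider heat kernel (`gaussDens_step_le`): the relative change of the covariance
is of order η|y - z|/t, the drift contributes a shift of order η, and |y - z| is worth √t under the
Gaussian. The errors telescope along the chain. Bounding each one by the induction hypothesis and
Chapman-Kolmogorov gives a fractional Gronwall recursion with kernel (t - s)^{-1/2}, solved by the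
Mittag-Leffler series of Λ₂ (`one_add_sum_mlSeries_le`). The grid sums are left Riemann sums of
increasing functions, hence below the corresponding beta integrals whatever the mesh is. As all
densities are nonnegative, one-sided comparisons suffice. -/

lemma act_add (A : Matrix (Fin d) (Fin m) ℝ) (v w : E m) : act A (v + w) = act A v + act A w := by
  simp [act, Matrix.mulVec_add]

lemma act_sub (A : Matrix (Fin d) (Fin m) ℝ) (v w : E m) : act A (v - w) = act A v - act A w := by
  simp [act, Matrix.mulVec_sub]

lemma act_smul (A : Matrix (Fin d) (Fin m) ℝ) (c : ℝ) (v : E m) : act A (c • v) = c • act A v := by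
  simp [act, Matrix.mulVec_smul]

lemma add_act (A B : Matrix (Fin d) (Fin m) ℝ) (v : E m) : act (A + B) v = act A v + act B v := by
  simp [act, Matrix.add_mulVec]

lemma sub_act (A B : Matrix (Fin d) (Fin m) ℝ) (v : E m) : act (A - B) v = act A v - act B v := by
  simp [act, Matrix.sub_mulVec]

lemma smul_act (c : ℝ) (A : Matrix (Fin d) (Fin m) ℝ) (v : E m) : act (c • A) v = c • act A v := by
  simp [act, Matrix.smul_mulVec]

lemma one_act (v : E d) : act (1 : Matrix (Fin d) (Fin d) ℝ) v = v := by
  simp [act]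

lemma mul_act (A : Matrix (Fin d) (Fin m) ℝ) (B : Matrix (Fin m) (Fin k) ℝ) (v : E k) :
    act (A * B) v = act A (act B v) := by
  simp [act, Matrix.mulVec_mulVec]

lemma inner_eq_dotProduct (v w : E d) : inner ℝ v w = v.ofLp ⬝ᵥ w.ofLp := by
  simp [PiLp.inner_apply, dotProduct, mul_comm]

lemma inner_act_left (A : Matrix (Fin d) (Fin m) ℝ) (v : E m) (w : E d) :
    inner ℝ (act A v) w = inner ℝ v (act Aᵀ w) := by
  rw [inner_eq_dotProduct, inner_eq_dotProduct]
  simp only [act]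
  rw [Matrix.mulVec_transpose, dotProduct_comm, Matrix.dotProduct_mulVec, dotProduct_comm]

lemma hsNorm_transpose (A : Matrix (Fin d) (Fin m) ℝ) : hsNorm Aᵀ = hsNorm A := by
  simp only [hsNorm, Matrix.transpose_apply]
  rw [Finset.sum_comm]

lemma norm_act_le_hsNorm (A : Matrix (Fin d) (Fin m) ℝ) (v : E m) :
    ‖act A v‖ ≤ hsNorm A * ‖v‖ := by
  rw [EuclideanSpace.norm_eq, EuclideanSpace.norm_eq, hsNorm, ← Real.sqrt_mul (by positivity)]
  refine Real.sqrt_le_sqrt ?_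
  rw [Finset.sum_mul]
  refine Finset.sum_le_sum fun i _ => ?_
  simp only [Real.norm_eq_abs, sq_abs, act]
  exact Finset.sum_mul_sq_le_sq_mul_sq Finset.univ (A i) v.ofLp

@[fun_prop]
lemma continuous_act (A : Matrix (Fin d) (Fin m) ℝ) : Continuous (act A) := by
  unfold act
  fun_prop

/-- `S` is symmetric with `l |v|² ≤ ⟨S v, v⟩ ≤ h |v|²`. -/
structure Elliptic (S : Matrix (Fin d) (Fin d) ℝ) (l h : ℝ) : Prop where
  symm : S.IsSymm
  lower : ∀ v, l * ‖v‖ ^ 2 ≤ inner ℝ (act S v) v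
  upper : ∀ v, inner ℝ (act S v) v ≤ h * ‖v‖ ^ 2

namespace Elliptic

variable {S S₀ S₁ : Matrix (Fin d) (Fin d) ℝ} {l h l' h' : ℝ}

lemma inner_symm (hS : Elliptic S l h) (v w : E d) :
    inner ℝ (act S v) w = inner ℝ v (act S w) := by
  rw [inner_act_left, hS.symm]

lemma smul (hS : Elliptic S l h) {c : ℝ} (hc : 0 ≤ c) : Elliptic (c • S) (c * l) (c * h) := by
  refine ⟨?_, fun v => ?_, fun v => ?_⟩
  · rw [Matrix.IsSymm, Matrix.transpose_smul, hS.symm]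
  · rw [smul_act, real_inner_smul_left, mul_assoc]
    exact mul_le_mul_of_nonneg_left (hS.lower v) hc
  · rw [smul_act, real_inner_smul_left, mul_assoc]
    exact mul_le_mul_of_nonneg_left (hS.upper v) hc

lemma add (h₀ : Elliptic S₀ l h) (h₁ : Elliptic S₁ l' h') :
    Elliptic (S₀ + S₁) (l + l') (h + h') := by
  refine ⟨?_, fun v => ?_, fun v => ?_⟩
  · rw [Matrix.IsSymm, Matrix.transpose_add, h₀.symm, h₁.symm]
  · rw [add_act, inner_add_left]
    linarith [h₀.lower v, h₁.lower v]
  · rw [add_act, inner_add_left]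
    linarith [h₀.upper v, h₁.upper v]

lemma isHermitian (hS : Elliptic S l h) : S.IsHermitian := by
  rw [Matrix.IsHermitian, Matrix.conjTranspose_eq_transpose_of_trivial, hS.symm]

lemma posDef (hS : Elliptic S l h) (hl : 0 < l) : S.PosDef := by
  refine Matrix.PosDef.of_dotProduct_mulVec_pos hS.isHermitian fun x hx => ?_
  have h1 := hS.lower (WithLp.toLp 2 x)
  rw [inner_eq_dotProduct] at h1
  have h2 : 0 < ‖(WithLp.toLp 2 x : E d)‖ := by
    rw [norm_pos_iff]
    intro h0
    exact hx (by simpa using congrArg WithLp.ofLp h0)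
  have h3 : (act S (WithLp.toLp 2 x)).ofLp ⬝ᵥ x = star x ⬝ᵥ S *ᵥ x := by
    simp [act, dotProduct_comm]
  rw [← h3]
  exact lt_of_lt_of_le (by positivity) h1

lemma det_pos (hS : Elliptic S l h) (hl : 0 < l) : 0 < S.det := (hS.posDef hl).det_pos

lemma isUnit_det (hS : Elliptic S l h) (hl : 0 < l) : IsUnit S.det :=
  (hS.det_pos hl).ne'.isUnit

lemma act_inv (hS : Elliptic S l h) (hl : 0 < l) (v : E d) : act S (act S⁻¹ v) = v := by
  rw [← mul_act, Matrix.mul_nonsing_inv _ (hS.isUnit_det hl), one_act]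

lemma inv_act (hS : Elliptic S l h) (hl : 0 < l) (v : E d) : act S⁻¹ (act S v) = v := by
  rw [← mul_act, Matrix.nonsing_inv_mul _ (hS.isUnit_det hl), one_act]

/-- Testing the form on unit eigenvectors shows that every eigenvalue is at least `l`, and the
determinant is their product. -/
lemma pow_le_det (hS : Elliptic S l h) (hl : 0 ≤ l) : l ^ d ≤ S.det := by
  rw [hS.isHermitian.det_eq_prod_eigenvalues]
  have hcard : l ^ d = ∏ _i : Fin d, l := by simp
  rw [hcard]
  refine Finset.prod_le_prod (fun _ _ => hl) fun i _ => ?_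
  have h1 := hS.lower (hS.isHermitian.eigenvectorBasis i)
  rw [(hS.isHermitian.eigenvectorBasis).orthonormal.1 i] at h1
  have h2 : act S (hS.isHermitian.eigenvectorBasis i) =
      hS.isHermitian.eigenvalues i • hS.isHermitian.eigenvectorBasis i := by
    simp only [act]
    rw [hS.isHermitian.mulVec_eigenvectorBasis]
    rfl
  rw [h2, real_inner_smul_left, real_inner_self_eq_norm_sq,
    (hS.isHermitian.eigenvectorBasis).orthonormal.1 i] at h1
  simpa using h1

lemma norm_inv_le (hS : Elliptic S l h) (hl : 0 < l) (w : E d) : ‖act S⁻¹ w‖ ≤ ‖w‖ / l := by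
  have h1 := hS.lower (act S⁻¹ w)
  rw [hS.act_inv hl] at h1
  have h2 := real_inner_le_norm w (act S⁻¹ w)
  rw [le_div_iff₀ hl]
  rcases (norm_nonneg (act S⁻¹ w)).eq_or_lt with h0 | h0
  · rw [← h0]; simp
  · refine le_of_mul_le_mul_right ?_ h0
    nlinarith

lemma inv_symm (hS : Elliptic S l h) : (S⁻¹).IsSymm := by
  rw [Matrix.IsSymm, Matrix.transpose_nonsing_inv, hS.symm]

lemma inner_inv_symm (hS : Elliptic S l h) (v w : E d) :
    inner ℝ (act S⁻¹ v) w = inner ℝ v (act S⁻¹ w) := by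
  rw [inner_act_left, hS.inv_symm]

/-- Cauchy-Schwarz for the bilinear form of `S`. -/
lemma inner_sq_le (hS : Elliptic S l h) (hl : 0 < l) (v w : E d) :
    inner ℝ (act S v) w ^ 2 ≤ inner ℝ (act S v) v * inner ℝ (act S w) w := by
  have key : ∀ x : ℝ, 0 ≤ inner ℝ (act S w) w * (x * x) + (2 * inner ℝ (act S v) w) * x
      + inner ℝ (act S v) v := by
    intro x
    have h1 := hS.lower (v + x • w)
    have h2 : 0 ≤ inner ℝ (act S (v + x • w)) (v + x • w) := le_trans (by positivity) h1
    have h3 : inner ℝ (act S w) v = inner ℝ (act S v) w := by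
      rw [hS.inner_symm, real_inner_comm]
    rw [act_add, act_smul, inner_add_left, inner_add_right, inner_add_right, real_inner_smul_left,
      real_inner_smul_left, real_inner_smul_right, real_inner_smul_right, h3] at h2
    linarith
  have h4 := discrim_le_zero key
  rw [discrim] at h4
  linarith

/-- Cauchy-Schwarz for the form of `S`, applied to `S⁻¹ w` and `w`, gives `‖w‖⁴ ≤ ⟨S⁻¹ w, w⟩ ⟨S w,
w⟩`. -/
lemma le_inner_inv (hS : Elliptic S l h) (hl : 0 < l) (hh : 0 < h) (w : E d) :
    ‖w‖ ^ 2 / h ≤ inner ℝ (act S⁻¹ w) w := by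
  have h1 := hS.inner_sq_le hl (act S⁻¹ w) w
  have h2 := hS.upper w
  rw [hS.act_inv hl, real_inner_self_eq_norm_sq, real_inner_comm] at h1
  have h0 : 0 ≤ inner ℝ (act S⁻¹ w) w := by
    have := hS.lower (act S⁻¹ w)
    rw [hS.act_inv hl, real_inner_comm] at this
    exact le_trans (by positivity) this
  rw [div_le_iff₀ hh]
  rcases (norm_nonneg w).eq_or_lt with h3 | h3
  · rw [← h3]; simpa using mul_nonneg h0 hh.le
  · have h4 : ‖w‖ ^ 2 * ‖w‖ ^ 2 ≤ (inner ℝ (act S⁻¹ w) w * h) * ‖w‖ ^ 2 := by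
      calc ‖w‖ ^ 2 * ‖w‖ ^ 2 = (‖w‖ ^ 2) ^ 2 := by ring
        _ ≤ _ := h1
        _ ≤ inner ℝ (act S⁻¹ w) w * (h * ‖w‖ ^ 2) := mul_le_mul_of_nonneg_left h2 h0
        _ = _ := by ring
    exact le_of_mul_le_mul_right h4 (by positivity)

-- The positive square root works: it is symmetric, and invertible because its square is.
open scoped MatrixOrder Matrix.Norms.L2Operator in
lemma exists_eq_mul_transpose (hS : Elliptic S l h) (hl : 0 < l) :
    ∃ R : Matrix (Fin d) (Fin d) ℝ, IsUnit R.det ∧ S = R * Rᵀ := by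
  have h1 : CFC.sqrt S * CFC.sqrt S = S := CFC.sqrt_mul_sqrt_self _ (hS.posDef hl).posSemidef.nonneg
  have h2 : (CFC.sqrt S)ᵀ = CFC.sqrt S := by
    rw [← Matrix.conjTranspose_eq_transpose_of_trivial]
    exact (CFC.sqrt_nonneg S).isSelfAdjoint
  refine ⟨CFC.sqrt S, ?_, by rw [h2, h1]⟩
  have h3 := hS.isUnit_det hl
  rw [← h1, Matrix.det_mul] at h3
  exact isUnit_of_mul_isUnit_left h3

/-- If `S₀ ≥ c S₁` then `det S₀ ≥ c ^ d det S₁`. -/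
lemma pow_mul_det_le (h₀ : Elliptic S₀ l h) (h₁ : Elliptic S₁ l' h')
    (hl' : 0 < l') {c : ℝ} (hc : 0 ≤ c)
    (hle : ∀ v, c * inner ℝ (act S₁ v) v ≤ inner ℝ (act S₀ v) v) :
    c ^ d * S₁.det ≤ S₀.det := by
  obtain ⟨R, hR, hRS⟩ := h₁.exists_eq_mul_transpose hl'
  have hRT : IsUnit (Rᵀ).det := by rwa [Matrix.det_transpose]
  -- Congruence by `R⁻¹` turns `S₁ = R Rᵀ` into the identity and `S₀` into a matrix bounded below by
  -- `c`, to which `pow_le_det` applies. The upper constant only fills the structure.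
  have hM : Elliptic (R⁻¹ * S₀ * (R⁻¹)ᵀ) c
      (max h 0 * hsNorm (R⁻¹)ᵀ ^ 2) := by
    have hform : ∀ v, inner ℝ (act (R⁻¹ * S₀ * (R⁻¹)ᵀ) v) v =
        inner ℝ (act S₀ (act (R⁻¹)ᵀ v)) (act (R⁻¹)ᵀ v) := by
      intro v
      rw [mul_act, mul_act, inner_act_left]
    refine ⟨?_, fun v => ?_, fun v => ?_⟩
    · simp [Matrix.IsSymm, Matrix.transpose_mul, h₀.symm.eq, mul_assoc]
    · rw [hform]
      refine le_trans ?_ (hle _)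
      refine mul_le_mul_of_nonneg_left ?_ hc
      rw [hRS, mul_act, inner_act_left, ← mul_act, Matrix.transpose_nonsing_inv,
        Matrix.mul_nonsing_inv _ hRT, one_act, real_inner_self_eq_norm_sq]
    · rw [hform]
      refine (h₀.upper _).trans ?_
      rw [mul_assoc, ← mul_pow]
      gcongr
      · exact le_max_left _ _
      · exact norm_act_le_hsNorm _ _
  have h5 := hM.pow_le_det hc
  rw [Matrix.det_mul, Matrix.det_mul, Matrix.det_transpose, Matrix.det_nonsing_inv] at h5
  rw [hRS, Matrix.det_mul, Matrix.det_transpose]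
  have h6 : R.det ≠ 0 := hR.ne_zero
  rw [Ring.inverse_eq_inv'] at h5
  calc c ^ d * (R.det * R.det) ≤ (R.det⁻¹ * S₀.det * R.det⁻¹) * (R.det * R.det) :=
        mul_le_mul_of_nonneg_right h5 (mul_self_nonneg _)
    _ = S₀.det := by field_simp

end Elliptic

end LinearAlgebra

/-! ### Gaussian densities and their one-sided comparison. -/

section GaussianDensity

variable {d m : ℕ}

/-- The density of the centred Gaussian law with covariance matrix `S`. -/
def gaussDens (S : Matrix (Fin d) (Fin d) ℝ) (w : E d) : ℝ :=
  (Real.sqrt ((2 * Real.pi) ^ d * S.det))⁻¹ * Real.exp (-(inner ℝ (act S⁻¹ w) w / 2))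

/-- The density of the centred Gaussian law with covariance matrix `v I`. -/
def isoDens (v : ℝ) (w : E d) : ℝ :=
  (Real.sqrt ((2 * Real.pi * v) ^ d))⁻¹ * Real.exp (-(‖w‖ ^ 2 / (2 * v)))

lemma gaussDens_nonneg (S : Matrix (Fin d) (Fin d) ℝ) (w : E d) : 0 ≤ gaussDens S w := by
  unfold gaussDens; positivity

lemma isoDens_nonneg (v : ℝ) (w : E d) : 0 ≤ isoDens v w := by
  unfold isoDens; positivity

@[fun_prop]
lemma continuous_gaussDens (S : Matrix (Fin d) (Fin d) ℝ) : Continuous (gaussDens S) := by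
  unfold gaussDens; fun_prop

@[fun_prop]
lemma continuous_isoDens (v : ℝ) : Continuous (isoDens (d := d) v) := by
  unfold isoDens; fun_prop

lemma elliptic_smul_one {v : ℝ} : Elliptic (v • (1 : Matrix (Fin d) (Fin d) ℝ)) v v := by
  refine ⟨by simp [Matrix.IsSymm], fun w => ?_, fun w => ?_⟩ <;>
  rw [smul_act, one_act, real_inner_smul_left, real_inner_self_eq_norm_sq]

lemma isoDens_eq_gaussDens {v : ℝ} (hv : 0 < v) (w : E d) :
    isoDens v w = gaussDens (v • (1 : Matrix (Fin d) (Fin d) ℝ)) w := by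
  have h1 : act (v • (1 : Matrix (Fin d) (Fin d) ℝ))⁻¹ w = v⁻¹ • w := by
    have h := elliptic_smul_one.inv_act hv (v⁻¹ • w)
    rwa [smul_act, one_act, smul_smul, mul_inv_cancel₀ hv.ne', one_smul] at h
  rw [isoDens, gaussDens, h1, real_inner_smul_left, real_inner_self_eq_norm_sq, Matrix.det_smul,
    Matrix.det_one, mul_pow, Fintype.card_fin, mul_one]
  congr 3
  field_simp

namespace Elliptic

variable {S S₀ S₁ : Matrix (Fin d) (Fin d) ℝ} {l h l' h' : ℝ}

lemma inv (hS : Elliptic S l h) (hl : 0 < l) (hh : 0 < h) : Elliptic S⁻¹ h⁻¹ l⁻¹ := by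
  refine ⟨hS.inv_symm, fun v => ?_, fun v => ?_⟩
  · have := hS.le_inner_inv hl hh v
    rwa [div_eq_inv_mul] at this
  · refine (real_inner_le_norm _ _).trans ?_
    calc ‖act S⁻¹ v‖ * ‖v‖ ≤ ‖v‖ / l * ‖v‖ :=
          mul_le_mul_of_nonneg_right (hS.norm_inv_le hl v) (norm_nonneg _)
      _ = l⁻¹ * ‖v‖ ^ 2 := by field_simp

lemma inv_sqrt_det_le (hS : Elliptic S l h) (hl : 0 < l) :
    (Real.sqrt ((2 * Real.pi) ^ d * S.det))⁻¹ ≤ (Real.sqrt ((2 * Real.pi * l) ^ d))⁻¹ := by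
  have := Real.pi_pos
  refine inv_anti₀ (Real.sqrt_pos.2 (by positivity)) (Real.sqrt_le_sqrt ?_)
  rw [mul_pow _ l]
  exact mul_le_mul_of_nonneg_left (hS.pow_le_det hl.le) (by positivity)

lemma gaussDens_le (hS : Elliptic S l h) (hl : 0 < l) (hh : 0 < h) (w : E d) :
    gaussDens S w ≤ (Real.sqrt ((2 * Real.pi * l) ^ d))⁻¹ * Real.exp (-(‖w‖ ^ 2 / (2 * h))) := by
  unfold gaussDens
  refine mul_le_mul (hS.inv_sqrt_det_le hl) (Real.exp_le_exp.2 ?_) (by positivity) (by positivity)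
  have h1 := hS.le_inner_inv hl hh w
  rw [neg_le_neg_iff, mul_comm 2 h, ← div_div]
  linarith

/-- One-sided comparison of two Gaussian densities at different points. -/
lemma gaussDens_le_add (h₀ : Elliptic S₀ l h) (h₁ : Elliptic S₁ l h) (hl : 0 < l) (hh : 0 < h)
    {D : ℝ} (hD : 0 ≤ D) (hS : ∀ v w : E d, |inner ℝ (act (S₀ - S₁) v) w| ≤ D * ‖v‖ * ‖w‖)
    (w w' : E d) :
    gaussDens S₀ w' ≤ gaussDens S₁ w + (Real.sqrt ((2 * Real.pi * l) ^ d))⁻¹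
      * Real.exp (-(‖w'‖ ^ 2 / (2 * h)))
      * (d * D / l + ‖w‖ * ‖w - w'‖ / l + D * ‖w'‖ ^ 2 / (2 * l ^ 2)) := by
  have hpi := Real.pi_pos
  set α₀ := (Real.sqrt ((2 * Real.pi) ^ d * S₀.det))⁻¹ with hα₀
  set α₁ := (Real.sqrt ((2 * Real.pi) ^ d * S₁.det))⁻¹ with hα₁
  set q₀ := inner ℝ (act S₀⁻¹ w') w' / 2 with hq₀
  set q₁ := inner ℝ (act S₁⁻¹ w) w / 2 with hq₁
  set K := (Real.sqrt ((2 * Real.pi * l) ^ d))⁻¹ with hK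
  have hα₀K : α₀ ≤ K := h₀.inv_sqrt_det_le hl
  have hα₁K : α₁ ≤ K := h₁.inv_sqrt_det_le hl
  have hα₁0 : 0 ≤ α₁ := by positivity
  have hα₀0 : 0 ≤ α₀ := by positivity
  have hK0 : 0 ≤ K := by positivity
  -- Move the point first, with `S₁` fixed: the quadratic remainder `e2` has a favourable sign. Then
  -- change the matrix at `w'` by the resolvent identity `S₁⁻¹ - S₀⁻¹ = S₁⁻¹ (S₀ - S₁) S₀⁻¹`.
  have hq : q₁ - q₀ ≤ ‖w‖ * ‖w - w'‖ / l + D * ‖w'‖ ^ 2 / (2 * l ^ 2) := by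
    have e1 : inner ℝ (act S₁⁻¹ w) w - inner ℝ (act S₁⁻¹ w') w' =
        2 * inner ℝ (act S₁⁻¹ w) (w - w') - inner ℝ (act S₁⁻¹ (w - w')) (w - w') := by
      rw [act_sub, inner_sub_left, inner_sub_right, inner_sub_right,
        h₁.inner_inv_symm w' w, real_inner_comm (act S₁⁻¹ w) w']
      ring
    have e2 : 0 ≤ inner ℝ (act S₁⁻¹ (w - w')) (w - w') :=
      le_trans (by positivity) (h₁.le_inner_inv hl hh (w - w'))
    have e3 : inner ℝ (act S₁⁻¹ w) (w - w') ≤ ‖w‖ * ‖w - w'‖ / l := by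
      refine (real_inner_le_norm _ _).trans ?_
      rw [mul_div_right_comm]
      exact mul_le_mul_of_nonneg_right (h₁.norm_inv_le hl w) (norm_nonneg _)
    have e4 : inner ℝ (act S₁⁻¹ w') w' - inner ℝ (act S₀⁻¹ w') w' =
        inner ℝ (act (S₀ - S₁) (act S₀⁻¹ w')) (act S₁⁻¹ w') := by
      rw [sub_act, inner_sub_left, h₀.act_inv hl, h₁.inner_symm, h₁.act_inv hl,
        real_inner_comm]
    have e5 : inner ℝ (act (S₀ - S₁) (act S₀⁻¹ w')) (act S₁⁻¹ w') ≤ D * ‖w'‖ ^ 2 / l ^ 2 := by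
      refine (le_abs_self _).trans ((hS _ _).trans ?_)
      calc D * ‖act S₀⁻¹ w'‖ * ‖act S₁⁻¹ w'‖ ≤ D * (‖w'‖ / l) * (‖w'‖ / l) := by
            gcongr
            · exact h₀.norm_inv_le hl w'
            · exact h₁.norm_inv_le hl w'
        _ = _ := by field_simp
    have e6 : D * ‖w'‖ ^ 2 / (2 * l ^ 2) = D * ‖w'‖ ^ 2 / l ^ 2 / 2 := by field_simp
    rw [e6, hq₀, hq₁]
    linarith
  have hdet : α₀ - α₁ ≤ α₀ * (d * D / l) := by
    have hdet0 := h₀.det_pos hl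
    have hdet1 := h₁.det_pos hl
    have hratio : α₁ = α₀ * Real.sqrt (S₀.det / S₁.det) := by
      rw [hα₀, hα₁, ← Real.sqrt_inv, ← Real.sqrt_inv, ← Real.sqrt_mul (by positivity)]
      congr 1
      field_simp
    -- For `D < l` one has `S₀ ≥ (1 - D / l) S₁`, so the determinant comparison and Bernoulli's
    -- inequality bound the ratio below by `1 - d D / l`. The square root inherits the bound because
    -- `√x ≥ min x 1`. For `D ≥ l` and `d ≥ 1` the left side is nonpositive.
    have hs : 1 - d * D / l ≤ Real.sqrt (S₀.det / S₁.det) := by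
      rcases le_or_gt 1 (D / l) with h1 | h1
      · rcases Nat.eq_zero_or_pos d with h2 | h2
        · subst h2
          simp
        · refine le_trans ?_ (Real.sqrt_nonneg _)
          have : (1 : ℝ) ≤ d := by exact_mod_cast h2
          rw [mul_div_assoc]
          nlinarith
      · have hc : 0 ≤ 1 - D / l := by linarith
        have hle := h₀.pow_mul_det_le h₁ hl hc fun v => by
          have g1 := hS v v
          rw [sub_act, inner_sub_left] at g1
          have g2 := (abs_le.1 g1).1
          have g3 := mul_le_mul_of_nonneg_left (h₁.lower v) (div_nonneg hD hl.le)
          have g4 : D / l * (l * ‖v‖ ^ 2) = D * ‖v‖ * ‖v‖ := by field_simp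
          linarith
        have g5 : (1 - D / l) ^ d ≤ S₀.det / S₁.det := by rwa [le_div_iff₀ hdet1]
        have g6 : 1 - d * D / l ≤ (1 - D / l) ^ d := by
          have := one_add_mul_le_pow (a := -(D / l)) (by linarith) d
          calc 1 - d * D / l = 1 + d * -(D / l) := by ring
            _ ≤ (1 + -(D / l)) ^ d := this
            _ = _ := by ring
        rcases le_or_gt (S₀.det / S₁.det) 1 with g7 | g7
        · refine (g6.trans g5).trans ?_
          refine Real.le_sqrt_of_sq_le ?_
          have : 0 ≤ S₀.det / S₁.det := by positivity
          nlinarith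
        · refine le_trans ?_ (Real.one_le_sqrt.2 g7.le)
          have : 0 ≤ d * D / l := by positivity
          linarith
    rw [hratio]
    nlinarith
  have hexp : Real.exp (-q₀) - Real.exp (-q₁) ≤ Real.exp (-q₀) * (q₁ - q₀) := by
    have h1 := Real.add_one_le_exp (q₀ - q₁)
    have h2 : Real.exp (-q₁) = Real.exp (-q₀) * Real.exp (q₀ - q₁) := by
      rw [← Real.exp_add]; congr 1; ring
    rw [h2]
    nlinarith [Real.exp_pos (-q₀)]
  have hq₀' : Real.exp (-q₀) ≤ Real.exp (-(‖w'‖ ^ 2 / (2 * h))) := by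
    refine Real.exp_le_exp.2 ?_
    have h1 := h₀.le_inner_inv hl hh w'
    rw [neg_le_neg_iff, mul_comm 2 h, ← div_div]
    linarith
  set X := ‖w‖ * ‖w - w'‖ / l + D * ‖w'‖ ^ 2 / (2 * l ^ 2) with hX
  have hX0 : 0 ≤ X := by positivity
  have hY0 : 0 ≤ d * D / l := by positivity
  have he0 := Real.exp_pos (-q₀)
  change α₀ * Real.exp (-q₀) ≤ α₁ * Real.exp (-q₁) + _
  calc α₀ * Real.exp (-q₀)
      = α₁ * Real.exp (-q₁) + ((α₀ - α₁) * Real.exp (-q₀)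
        + α₁ * (Real.exp (-q₀) - Real.exp (-q₁))) := by ring
    _ ≤ α₁ * Real.exp (-q₁) + (α₀ * (d * D / l) * Real.exp (-q₀)
        + α₁ * (Real.exp (-q₀) * X)) := by
      gcongr
      exact hexp.trans (mul_le_mul_of_nonneg_left hq he0.le)
    _ ≤ α₁ * Real.exp (-q₁) + (K * (d * D / l) * Real.exp (-q₀)
        + K * (Real.exp (-q₀) * X)) := by gcongr
    _ = α₁ * Real.exp (-q₁) + K * Real.exp (-q₀) * (d * D / l + X) := by ring
    _ ≤ α₁ * Real.exp (-q₁) + K * Real.exp (-(‖w'‖ ^ 2 / (2 * h))) * (d * D / l + X) := by gcongr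
    _ = _ := by rw [hX]; ring

end Elliptic

end GaussianDensity

/-! ### Laws of linear images of Gaussians, and convolution. -/

section GaussianIntegrals

variable {d m : ℕ}

/-- Taking `t = 0` gives the total mass; general `t` identifies the standard Gaussian law through
its characteristic function. -/
lemma integral_isoDens_one_mul_cexp (t : E d) :
    ∫ x : E d, (isoDens 1 x : ℂ) * Complex.exp (inner ℝ x t * Complex.I) =
      Complex.exp (-‖t‖ ^ 2 / 2) := by
  have h := GaussianFourier.integral_cexp_neg_mul_sq_norm_add (V := E d) (b := 1 / 2)
    (by norm_num) Complex.I t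
  have hpi := Real.pi_pos
  have hc : ((Real.sqrt ((2 * Real.pi * 1) ^ d) : ℝ) : ℂ) =
      (Real.pi / (1 / 2) : ℂ) ^ (Module.finrank ℝ (E d) / 2 : ℂ) := by
    rw [finrank_euclideanSpace, Fintype.card_fin, Real.sqrt_eq_rpow, ← Real.rpow_natCast,
      ← Real.rpow_mul (by positivity), Complex.ofReal_cpow (by positivity)]
    push_cast
    congr 1 <;> ring
  have hc0 : ((Real.sqrt ((2 * Real.pi * 1) ^ d) : ℝ) : ℂ) ≠ 0 := by
    rw [Complex.ofReal_ne_zero]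
    positivity
  calc ∫ x : E d, (isoDens 1 x : ℂ) * Complex.exp (inner ℝ x t * Complex.I)
      = ∫ x : E d, ((Real.sqrt ((2 * Real.pi * 1) ^ d) : ℝ) : ℂ)⁻¹ *
          Complex.exp (-(1 / 2) * ‖x‖ ^ 2 + Complex.I * inner ℝ t x) := by
        congr 1 with x
        rw [isoDens, Complex.exp_add, real_inner_comm t x]
        push_cast
        rw [mul_assoc]
        congr 3 <;> ring_nf
    _ = _ := by
        rw [integral_const_mul, h, ← hc, ← mul_assoc, inv_mul_cancel₀ hc0, one_mul]
        congr 1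
        rw [Complex.I_sq]
        ring

lemma integrable_isoDens_one : Integrable (isoDens (d := d) 1) := by
  have h := GaussianFourier.integrable_cexp_neg_mul_sq_norm_add (V := E d) (b := 1 / 2)
    (by norm_num) 0 0
  have h2 := (h.norm).const_mul (Real.sqrt ((2 * Real.pi * 1) ^ d))⁻¹
  refine h2.congr (ae_of_all _ fun x => ?_)
  simp only [isoDens, Complex.norm_exp]
  congr 2
  simp
  norm_cast
  ring

lemma lintegral_isoDens_one : ∫⁻ x : E d, ENNReal.ofReal (isoDens 1 x) = 1 := by
  rw [← ofReal_integral_eq_lintegral_ofReal integrable_isoDens_one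
    (ae_of_all _ fun x => isoDens_nonneg _ _)]
  have h := integral_isoDens_one_mul_cexp (d := d) 0
  simp only [inner_zero_right, Complex.ofReal_zero, zero_mul, Complex.exp_zero, mul_one,
    integral_complex_ofReal, norm_zero] at h
  norm_num at h
  norm_cast at h
  rw [h, ENNReal.ofReal_one]

lemma stdGaussian_eq_withDensity :
    stdGaussian (E d) = volume.withDensity fun x => ENNReal.ofReal (isoDens 1 x) := by
  have : IsFiniteMeasure (volume.withDensity fun x : E d => ENNReal.ofReal (isoDens 1 x)) := by
    refine ⟨?_⟩
    rw [withDensity_apply _ MeasurableSet.univ, Measure.restrict_univ, lintegral_isoDens_one]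
    exact ENNReal.one_lt_top
  refine Measure.ext_of_charFun ?_
  ext t
  rw [charFun_stdGaussian, charFun_apply, integral_withDensity_eq_integral_toReal_smul
    (by fun_prop) (ae_of_all _ fun _ => ENNReal.ofReal_lt_top), ← integral_isoDens_one_mul_cexp t]
  congr 1 with x
  rw [ENNReal.toReal_ofReal (isoDens_nonneg _ _), Complex.real_smul]

lemma norm_act_transpose_sq (A : Matrix (Fin d) (Fin m) ℝ) (t : E d) :
    ‖act Aᵀ t‖ ^ 2 = inner ℝ (act (A * Aᵀ) t) t := by
  rw [mul_act, inner_act_left, real_inner_self_eq_norm_sq]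

lemma charFun_map_act_stdGaussian (A : Matrix (Fin d) (Fin m) ℝ) (t : E d) :
    charFun ((stdGaussian (E m)).map (act A)) t =
      Complex.exp (-((inner ℝ (act (A * Aᵀ) t) t : ℝ) : ℂ) / 2) := by
  rw [charFun_apply, integral_map (by fun_prop) (by fun_prop)]
  rw [← norm_act_transpose_sq]
  simp_rw [inner_act_left]
  rw [← charFun_apply, charFun_stdGaussian]
  push_cast
  rfl

/-- The characteristic function of a linear image sees the matrix only through the covariance. Thus
a rectangular `σ` may be replaced by a square invertible root of `σ σᵀ`, for which a linear change
of variables is available. -/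
lemma map_act_stdGaussian_eq {k : ℕ} {A : Matrix (Fin d) (Fin m) ℝ} {R : Matrix (Fin d) (Fin k) ℝ}
    (h : A * Aᵀ = R * Rᵀ) : (stdGaussian (E m)).map (act A) = (stdGaussian (E k)).map (act R) := by
  have h1 : IsProbabilityMeasure ((stdGaussian (E m)).map (act A)) :=
    Measure.isProbabilityMeasure_map (by fun_prop)
  have h2 : IsProbabilityMeasure ((stdGaussian (E k)).map (act R)) :=
    Measure.isProbabilityMeasure_map (by fun_prop)
  refine Measure.ext_of_charFun ?_
  ext t
  rw [charFun_map_act_stdGaussian, charFun_map_act_stdGaussian, h]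

lemma gaussDens_act {R : Matrix (Fin d) (Fin d) ℝ} (hR : IsUnit R.det) (z : E d) :
    gaussDens (R * Rᵀ) (act R z) = |R.det|⁻¹ * isoDens 1 z := by
  have hRT : IsUnit (Rᵀ).det := by rwa [Matrix.det_transpose]
  rw [gaussDens, isoDens, Matrix.mul_inv_rev, ← mul_act, Matrix.mul_assoc,
    Matrix.nonsing_inv_mul _ hR, Matrix.mul_one, real_inner_comm, inner_act_left, ← mul_act,
    Matrix.mul_nonsing_inv _ hRT, one_act, real_inner_self_eq_norm_sq, Matrix.det_mul,
    Matrix.det_transpose, Real.sqrt_mul (by positivity), Real.sqrt_mul_self_eq_abs, mul_inv]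
  simp only [mul_one]
  ring

/-- The law of `c + A Z` for a standard Gaussian `Z` has density `gaussDens (A * Aᵀ) (· - c)`. -/
lemma lintegral_stdGaussian_act {A : Matrix (Fin d) (Fin m) ℝ} {l h : ℝ}
    (hA : Elliptic (A * Aᵀ) l h) (hl : 0 < l) (c : E d) {ψ : E d → ℝ≥0∞} (hψ : Measurable ψ) :
    ∫⁻ z, ψ (c + act A z) ∂(stdGaussian (E m)) =
      ∫⁻ y, ψ y * ENNReal.ofReal (gaussDens (A * Aᵀ) (y - c)) := by
  obtain ⟨R, hR, hAR⟩ := hA.exists_eq_mul_transpose hl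
  have hm : Measurable fun y => ψ (c + y) := hψ.comp (measurable_const_add c)
  rw [← lintegral_map (f := fun y => ψ (c + y)) hm (by fun_prop), map_act_stdGaussian_eq hAR,
    lintegral_map hm (by fun_prop), stdGaussian_eq_withDensity,
    lintegral_withDensity_eq_lintegral_mul _ (by fun_prop)
      (show Measurable fun z => ψ (c + act R z) from hm.comp (by fun_prop))]
  have hR0 : R.det ≠ 0 := hR.ne_zero
  have hlin : (fun z : E d => act R z) = Matrix.toLpLin 2 2 R := by
    ext z
    simp [act, Matrix.toLpLin_apply]
  have hdet : LinearMap.det (Matrix.toLpLin 2 2 R : E d →ₗ[ℝ] E d) = R.det := by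
    rw [Matrix.toLpLin_eq_toLin, LinearMap.det_toLin]
  have hmap := Measure.map_linearMap_addHaar_eq_smul_addHaar (volume : Measure (E d))
    (f := (Matrix.toLpLin 2 2 R : E d →ₗ[ℝ] E d)) (by rwa [hdet])
  rw [← hlin, hdet] at hmap
  set g : E d → ℝ≥0∞ := fun y => ψ (c + y) * ENNReal.ofReal (gaussDens (A * Aᵀ) y) with hg
  have hgm : Measurable g := hm.mul (by fun_prop)
  have h1 : ∫⁻ z, g (act R z) = ENNReal.ofReal |R.det⁻¹| * ∫⁻ y, g y := by
    rw [← lintegral_map hgm (by fun_prop), hmap, lintegral_smul_measure, smul_eq_mul]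
  have h2 : ∫⁻ y, ψ y * ENNReal.ofReal (gaussDens (A * Aᵀ) (y - c)) = ∫⁻ y, g y := by
    rw [← lintegral_add_left_eq_self _ c]
    simp [hg]
  have h3 : ∀ z, g (act R z) = ENNReal.ofReal |R.det⁻¹| *
      (ENNReal.ofReal (isoDens 1 z) * ψ (c + act R z)) := by
    intro z
    rw [hg]
    simp only
    rw [hAR, gaussDens_act hR, abs_inv, ENNReal.ofReal_mul (by positivity)]
    ring
  simp_rw [h3] at h1
  rw [lintegral_const_mul' _ _ ENNReal.ofReal_ne_top] at h1
  rw [h2]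
  refine (ENNReal.mul_right_inj ?_ ENNReal.ofReal_ne_top).1 h1
  simpa using hR0

lemma lintegral_gaussDens_sub {S : Matrix (Fin d) (Fin d) ℝ} {l h : ℝ} (hS : Elliptic S l h)
    (hl : 0 < l) (c : E d) : ∫⁻ y, ENNReal.ofReal (gaussDens S (y - c)) = 1 := by
  obtain ⟨R, hR, rfl⟩ := hS.exists_eq_mul_transpose hl
  have := lintegral_stdGaussian_act hS hl c (ψ := fun _ => 1) measurable_const
  simpa using this.symm

/-- Completing the square in `w`. The inverse covariances add, and the normalising constants match
because `(S₁⁻¹ + S₂⁻¹)⁻¹ = S₁ (S₁ + S₂)⁻¹ S₂`, whence its determinant is `det S₁ det S₂ / det (S₁ +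
S₂)`. -/
lemma gaussDens_mul_gaussDens {S₁ S₂ : Matrix (Fin d) (Fin d) ℝ} {l₁ h₁ l₂ h₂ : ℝ}
    (hS₁ : Elliptic S₁ l₁ h₁) (hS₂ : Elliptic S₂ l₂ h₂) (hl₁ : 0 < l₁) (hl₂ : 0 < l₂)
    (c w : E d) :
    gaussDens S₁ (c - w) * gaussDens S₂ w = gaussDens (S₁ + S₂) c *
      gaussDens (S₁⁻¹ + S₂⁻¹)⁻¹ (w - act S₂ (act (S₁ + S₂)⁻¹ c)) := by
  have hS := hS₁.add hS₂
  have hl : 0 < l₁ + l₂ := by positivity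
  have hu1 := hS₁.isUnit_det hl₁
  have hu2 := hS₂.isUnit_det hl₂
  have hu := hS.isUnit_det hl
  have hP : (S₁⁻¹ + S₂⁻¹) * (S₁ * (S₁ + S₂)⁻¹ * S₂) = 1 := by
    rw [← Matrix.mul_assoc, ← Matrix.mul_assoc, Matrix.add_mul, Matrix.nonsing_inv_mul _ hu1]
    have : 1 + S₂⁻¹ * S₁ = S₂⁻¹ * (S₁ + S₂) := by
      rw [Matrix.mul_add, Matrix.nonsing_inv_mul _ hu2, add_comm]
    rw [this, Matrix.mul_assoc S₂⁻¹, Matrix.mul_nonsing_inv _ hu, Matrix.mul_one,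
      Matrix.nonsing_inv_mul _ hu2]
  have hQ : (S₁⁻¹ + S₂⁻¹)⁻¹ = S₁ * (S₁ + S₂)⁻¹ * S₂ := Matrix.inv_eq_right_inv hP
  have hPu : IsUnit (S₁⁻¹ + S₂⁻¹).det := by
    refine IsUnit.of_mul_eq_one (S₁ * (S₁ + S₂)⁻¹ * S₂).det ?_
    rw [← Matrix.det_mul, hP, Matrix.det_one]
  have hQinv : ((S₁⁻¹ + S₂⁻¹)⁻¹)⁻¹ = S₁⁻¹ + S₂⁻¹ := Matrix.nonsing_inv_nonsing_inv _ hPu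
  have hdetQ : (S₁ + S₂).det * ((S₁⁻¹ + S₂⁻¹)⁻¹).det = S₁.det * S₂.det := by
    rw [hQ, Matrix.det_mul, Matrix.det_mul, Matrix.det_nonsing_inv, Ring.inverse_eq_inv']
    have := hu.ne_zero
    field_simp
  have hd0 := hS₁.det_pos hl₁
  have hd1 := hS.det_pos hl
  have hpi := Real.pi_pos
  set e := act (S₁ + S₂)⁻¹ c with he
  have hc : act S₁ e + act S₂ e = c := by rw [← add_act, hS.act_inv hl]
  unfold gaussDens
  rw [hQinv]
  have hconst : (Real.sqrt ((2 * Real.pi) ^ d * S₁.det))⁻¹ * (Real.sqrt ((2 * Real.pi) ^ d * S₂.det))⁻¹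
      = (Real.sqrt ((2 * Real.pi) ^ d * (S₁ + S₂).det))⁻¹ *
        (Real.sqrt ((2 * Real.pi) ^ d * ((S₁⁻¹ + S₂⁻¹)⁻¹).det))⁻¹ := by
    rw [← mul_inv, ← mul_inv, ← Real.sqrt_mul (by positivity), ← Real.sqrt_mul (by positivity)]
    congr 2
    calc _ = ((2 * Real.pi) ^ d) ^ 2 * (S₁.det * S₂.det) := by ring
      _ = _ := by rw [← hdetQ]; ring
  have hexp : inner ℝ (act S₁⁻¹ (c - w)) (c - w) + inner ℝ (act S₂⁻¹ w) w =
      inner ℝ e c + inner ℝ (act (S₁⁻¹ + S₂⁻¹) (w - act S₂ e)) (w - act S₂ e) := by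
    have h1 : act (S₁⁻¹ + S₂⁻¹) (act S₂ e) = act S₁⁻¹ c := by
      rw [add_act, hS₂.inv_act hl₂]
      nth_rewrite 2 [← hS₁.inv_act hl₁ e]
      rw [← act_add, add_comm, hc]
    have h2 : inner ℝ (act S₁⁻¹ c) (act S₂ e) = inner ℝ (act S₁⁻¹ c) c - inner ℝ c e := by
      have : act S₂ e = c - act S₁ e := by rw [← hc]; abel
      rw [this, inner_sub_right, hS₁.inner_inv_symm c (act S₁ e), hS₁.inv_act hl₁]
    have h3 : inner ℝ (act S₁⁻¹ w) c = inner ℝ (act S₁⁻¹ c) w := by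
      rw [hS₁.inner_inv_symm, real_inner_comm]
    have h4 : inner ℝ (act (S₁⁻¹ + S₂⁻¹) w) (act S₂ e) = inner ℝ (act S₁⁻¹ c) w := by
      rw [← h1, add_act, add_act, inner_add_left, inner_add_left, hS₁.inner_inv_symm w,
        hS₂.inner_inv_symm w, real_inner_comm w, real_inner_comm w]
    rw [act_sub, act_sub, inner_sub_left, inner_sub_left, inner_sub_right, inner_sub_right,
      inner_sub_right, inner_sub_right, h1, h2, h3, h4, add_act, inner_add_left,
      real_inner_comm c e]
    ring
  calc _ = (Real.sqrt ((2 * Real.pi) ^ d * S₁.det))⁻¹ * (Real.sqrt ((2 * Real.pi) ^ d * S₂.det))⁻¹ *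
      Real.exp (-((inner ℝ (act S₁⁻¹ (c - w)) (c - w) + inner ℝ (act S₂⁻¹ w) w) / 2)) := by
        rw [add_div, neg_add, Real.exp_add]; ring
    _ = _ := by
        rw [hconst, hexp, add_div, neg_add, Real.exp_add]; ring

/-- The convolution of two centred Gaussian densities. -/
lemma lintegral_gaussDens_mul_gaussDens {S₁ S₂ : Matrix (Fin d) (Fin d) ℝ} {l₁ h₁ l₂ h₂ : ℝ}
    (hS₁ : Elliptic S₁ l₁ h₁) (hS₂ : Elliptic S₂ l₂ h₂) (hl₁ : 0 < l₁) (hl₂ : 0 < l₂)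
    (hh₁ : 0 < h₁) (hh₂ : 0 < h₂) (c : E d) :
    ∫⁻ w, ENNReal.ofReal (gaussDens S₁ (c - w)) * ENNReal.ofReal (gaussDens S₂ w) =
      ENNReal.ofReal (gaussDens (S₁ + S₂) c) := by
  have hQ := ((hS₁.inv hl₁ hh₁).add (hS₂.inv hl₂ hh₂)).inv (by positivity) (by positivity)
  simp_rw [← ENNReal.ofReal_mul (gaussDens_nonneg _ _),
    gaussDens_mul_gaussDens hS₁ hS₂ hl₁ hl₂, ENNReal.ofReal_mul (gaussDens_nonneg _ _)]
  rw [lintegral_const_mul' _ _ ENNReal.ofReal_ne_top, lintegral_gaussDens_sub hQ (by positivity),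
    mul_one]

/-- The Chapman-Kolmogorov identity of the heat kernel. -/
lemma lintegral_isoDens_mul_isoDens {a b : ℝ} (ha : 0 < a) (hb : 0 < b) (x y : E d) :
    ∫⁻ z, ENNReal.ofReal (isoDens a (z - x)) * ENNReal.ofReal (isoDens b (y - z)) =
      ENNReal.ofReal (isoDens (a + b) (y - x)) := by
  have h := lintegral_gaussDens_mul_gaussDens (d := d) (elliptic_smul_one (v := b))
    (elliptic_smul_one (v := a)) hb ha hb ha (y - x)
  rw [← add_smul, ← isoDens_eq_gaussDens (by positivity), add_comm b a] at h
  rw [← h, ← lintegral_add_left_eq_self _ x]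
  refine lintegral_congr fun z => ?_
  rw [isoDens_eq_gaussDens ha, isoDens_eq_gaussDens hb, mul_comm]
  congr 3 <;> abel_nf

/-- Averaging a Gaussian density over an independent Gaussian increment. -/
lemma lintegral_stdGaussian_gaussDens {A : Matrix (Fin d) (Fin m) ℝ} {S : Matrix (Fin d) (Fin d) ℝ}
    {l h l' h' : ℝ} (hA : Elliptic (A * Aᵀ) l h) (hS : Elliptic S l' h') (hl : 0 < l)
    (hl' : 0 < l') (hh : 0 < h) (hh' : 0 < h') (c y : E d) :
    ∫⁻ z, ENNReal.ofReal (gaussDens S (y - (c + act A z))) ∂(stdGaussian (E m)) =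
      ENNReal.ofReal (gaussDens (S + A * Aᵀ) (y - c)) := by
  rw [lintegral_stdGaussian_act hA hl c (ψ := fun x => ENNReal.ofReal (gaussDens S (y - x)))
      (by fun_prop), ← lintegral_gaussDens_mul_gaussDens hS hA hl' hl hh' hh,
    ← lintegral_add_left_eq_self _ c]
  refine lintegral_congr fun z => ?_
  congr 3 <;> abel_nf

end GaussianIntegrals

/-! ### The one-step parametrix error. -/

section OneStep

variable {d m : ℕ}

lemma DiffusionAssumption.elliptic {σ : E d → Matrix (Fin d) (Fin m) ℝ} {lo hi L₀ : ℝ}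
    (hσ : DiffusionAssumption σ lo hi L₀) (x : E d) : Elliptic (σ x * (σ x)ᵀ) lo hi :=
  ⟨by simp [Matrix.IsSymm, Matrix.transpose_mul], hσ.lower x, hσ.upper x⟩

lemma DiffusionAssumption.norm_act_transpose_le {σ : E d → Matrix (Fin d) (Fin m) ℝ}
    {lo hi L₀ : ℝ} (hσ : DiffusionAssumption σ lo hi L₀) (x v : E d) :
    ‖act (σ x)ᵀ v‖ ≤ Real.sqrt hi * ‖v‖ := by
  rw [← Real.sqrt_sq (norm_nonneg v), ← Real.sqrt_mul hσ.hi_pos.le]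
  refine Real.le_sqrt_of_sq_le ?_
  rw [norm_act_transpose_sq]
  exact hσ.upper x v

lemma DiffusionAssumption.lo_le_hi {σ : E d → Matrix (Fin d) (Fin m) ℝ} {lo hi L₀ : ℝ}
    (hσ : DiffusionAssumption σ lo hi L₀) (hd : 0 < d) : lo ≤ hi := by
  have h1 := hσ.lower 0 (EuclideanSpace.single ⟨0, hd⟩ 1)
  have h2 := hσ.upper 0 (EuclideanSpace.single ⟨0, hd⟩ 1)
  simp only [PiLp.norm_single, norm_one, one_pow, mul_one] at h1 h2
  exact h1.trans h2

/-- Lipschitz continuity of `σ σ*` in operator norm. -/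
lemma DiffusionAssumption.abs_inner_sub_le {σ : E d → Matrix (Fin d) (Fin m) ℝ} {lo hi L₀ : ℝ}
    (hσ : DiffusionAssumption σ lo hi L₀) (x y v w : E d) :
    |inner ℝ (act (σ x * (σ x)ᵀ - σ y * (σ y)ᵀ) v) w| ≤
      2 * Real.sqrt hi * L₀ * ‖x - y‖ * ‖v‖ * ‖w‖ := by
  have hsplit : σ x * (σ x)ᵀ - σ y * (σ y)ᵀ =
      (σ x - σ y) * (σ x)ᵀ + σ y * (σ x - σ y)ᵀ := by
    rw [Matrix.transpose_sub, Matrix.sub_mul, Matrix.mul_sub]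
    abel
  have hdiff : ∀ u : E d, ‖act (σ x - σ y)ᵀ u‖ ≤ L₀ * ‖x - y‖ * ‖u‖ := fun u => by
    refine (norm_act_le_hsNorm _ _).trans ?_
    rw [hsNorm_transpose]
    exact mul_le_mul_of_nonneg_right (hσ.lipschitz x y) (norm_nonneg _)
  have hL := hσ.L_pos
  rw [hsplit, add_act, inner_add_left, mul_act, mul_act, inner_act_left, inner_act_left (σ y)]
  refine (abs_add_le _ _).trans ?_
  have h1 : |inner ℝ (act (σ x)ᵀ v) (act (σ x - σ y)ᵀ w)| ≤
      (Real.sqrt hi * ‖v‖) * (L₀ * ‖x - y‖ * ‖w‖) :=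
    (abs_real_inner_le_norm _ _).trans (mul_le_mul (hσ.norm_act_transpose_le x v) (hdiff w)
      (norm_nonneg _) (by positivity))
  have h2 : |inner ℝ (act (σ x - σ y)ᵀ v) (act (σ y)ᵀ w)| ≤
      (L₀ * ‖x - y‖ * ‖v‖) * (Real.sqrt hi * ‖w‖) :=
    (abs_real_inner_le_norm _ _).trans (mul_le_mul (hdiff v) (hσ.norm_act_transpose_le y w)
      (norm_nonneg _) (by positivity))
  linarith

/-- The variance parameter (per unit time) of the dominating Gaussian kernel. -/
def kap (d : ℕ) (hi : ℝ) : ℝ := (1 + 24 * (d : ℝ)) * hi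

lemma kap_pos (d : ℕ) {hi : ℝ} (hhi : 0 < hi) : 0 < kap d hi := by
  unfold kap; positivity

/-- The ratio between the crude and the dominating Gaussian prefactors. -/
def kapRatio (d : ℕ) (lo hi : ℝ) : ℝ := Real.sqrt ((kap d hi / lo) ^ d)

lemma kapRatio_pos (d : ℕ) {lo hi : ℝ} (hlo : 0 < lo) (hhi : 0 < hi) : 0 < kapRatio d lo hi := by
  have := kap_pos d hhi
  unfold kapRatio; positivity

lemma inv_sqrt_eq_kapRatio_mul {lo hi t : ℝ} (hlo : 0 < lo) (hhi : 0 < hi) (ht : 0 < t) :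
    (Real.sqrt ((2 * Real.pi * (lo * t)) ^ d))⁻¹ =
      kapRatio d lo hi * (Real.sqrt ((2 * Real.pi * (kap d hi * t)) ^ d))⁻¹ := by
  have hk := kap_pos d hhi
  have hpi := Real.pi_pos
  rw [kapRatio, ← Real.sqrt_inv, ← Real.sqrt_inv, ← Real.sqrt_mul (by positivity), ← inv_pow,
    ← inv_pow, ← mul_pow]
  congr 2
  field_simp

/-- For `d ≥ 1`, `kap d hi` is at least `25 * hi`. The estimates below lose a factor 2 or 8 in the
variance, well within this margin. -/
lemma exp_le_exp_kap {hi t : ℝ} (hd : 0 < d) (hhi : 0 < hi) (ht : 0 < t) (w : E d) {c : ℝ}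
    (hc0 : 0 < c) (hc : c ≤ 25) :
    Real.exp (-(‖w‖ ^ 2 / (2 * (c * hi * t)))) ≤ Real.exp (-(‖w‖ ^ 2 / (2 * (kap d hi * t)))) := by
  have hk := kap_pos d hhi
  have hd1 : (1 : ℝ) ≤ d := by exact_mod_cast hd
  refine Real.exp_le_exp.2 (neg_le_neg ?_)
  have : c * hi ≤ kap d hi := by
    unfold kap
    exact mul_le_mul_of_nonneg_right (by linarith) hhi.le
  gcongr

/-- A Gaussian density whose covariance lies between `lo t` and `hi t` is dominated, up to a bounded
shift, by the isotropic one. -/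
lemma Elliptic.gaussDens_sub_le_isoDens {S : Matrix (Fin d) (Fin d) ℝ} {lo hi t B : ℝ}
    (hd : 0 < d) (hlo : 0 < lo) (hhi : 0 < hi) (ht : 0 < t) (hS : Elliptic S (lo * t) (hi * t))
    (w β : E d) (hβ : ‖β‖ ≤ B) :
    gaussDens S (w - t • β) ≤
      Real.exp (B ^ 2 * t / (2 * hi)) * kapRatio d lo hi * isoDens (kap d hi * t) w := by
  refine (hS.gaussDens_le (by positivity) (by positivity) _).trans ?_
  rw [inv_sqrt_eq_kapRatio_mul hlo hhi ht, isoDens]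
  have hr := kapRatio_pos d hlo hhi
  have h1 : Real.exp (-(‖w - t • β‖ ^ 2 / (2 * (hi * t)))) ≤ Real.exp (B ^ 2 * t / (2 * hi)) *
      Real.exp (-(‖w‖ ^ 2 / (2 * (kap d hi * t)))) := by
    -- The drift shift is removed with `(a + b)² ≤ 2a² + 2b²`, which doubles the variance; hence `c
    -- = 2`.
    refine le_trans ?_ (mul_le_mul_of_nonneg_left (exp_le_exp_kap hd hhi ht w (c := 2)
      (by norm_num) (by norm_num)) (Real.exp_pos _).le)
    rw [← Real.exp_add]
    refine Real.exp_le_exp.2 ?_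
    have h2 : ‖w‖ ≤ ‖w - t • β‖ + t * B := by
      calc ‖w‖ = ‖(w - t • β) + t • β‖ := by rw [sub_add_cancel]
        _ ≤ _ := (norm_add_le _ _).trans (by
          rw [norm_smul, Real.norm_of_nonneg ht.le]
          gcongr)
    have h3 : ‖w‖ ^ 2 ≤ 2 * ‖w - t • β‖ ^ 2 + 2 * (t * B) ^ 2 := by
      have h4 := pow_le_pow_left₀ (norm_nonneg w) h2 2
      nlinarith [sq_nonneg (‖w - t • β‖ - t * B)]
    have h5 : B ^ 2 * t / (2 * hi) = 2 * (t * B) ^ 2 / (4 * hi * t) := by field_simp; ring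
    have h6 : ‖w - t • β‖ ^ 2 / (2 * (hi * t)) = 2 * ‖w - t • β‖ ^ 2 / (4 * hi * t) := by
      field_simp; ring
    have h7 : ‖w‖ ^ 2 / (2 * (2 * hi * t)) = ‖w‖ ^ 2 / (4 * hi * t) := by ring_nf
    rw [h5, h6, h7, ← sub_eq_add_neg, ← sub_div, ← neg_div]
    gcongr
    linarith
  calc _ ≤ kapRatio d lo hi * (Real.sqrt ((2 * Real.pi * (kap d hi * t)) ^ d))⁻¹ *
      (Real.exp (B ^ 2 * t / (2 * hi)) * Real.exp (-(‖w‖ ^ 2 / (2 * (kap d hi * t))))) := by gcongr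
    _ = _ := by ring

/-- The constant in the bound for the one-step parametrix kernel. -/
def stepConst (d : ℕ) (T B L₀ lo hi : ℝ) : ℝ :=
  kapRatio d lo hi * Real.exp (B ^ 2 * T / (4 * hi)) *
    (2 * (2 * d * hi * L₀ / lo + B * Real.sqrt hi / lo + 4 * L₀ * hi ^ 2 / lo ^ 2))

lemma stepConst_nonneg (d : ℕ) {T B L₀ lo hi : ℝ} (hB : 0 ≤ B) (hL : 0 ≤ L₀) (hlo : 0 < lo)
    (hhi : 0 < hi) : 0 ≤ stepConst d T B L₀ lo hi := by
  have := kapRatio_pos d hlo hhi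
  unfold stepConst; positivity

/-- The factor `exp (-ρ²/2)` is split into equal halves. One absorbs `ρ²`; the other is traded for
`exp (-r²/8)` at the price `exp (c/4)`, and half of that exponent absorbs `r`. What remains is a
Gaussian of eight times the variance. -/
lemma exp_neg_mul_polynomial_le {r ρ c X Z : ℝ} (hr : 0 ≤ r) (hX : 0 ≤ X) (hZ : 0 ≤ Z)
    (h : r ^ 2 ≤ 2 * ρ ^ 2 + 2 * c) :
    Real.exp (-(ρ ^ 2 / 2)) * (r * (X + Z * ρ ^ 2)) ≤
      Real.exp (c / 4) * (2 * (X + 4 * Z)) * Real.exp (-(r ^ 2 / 16)) := by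
  have hexp1 : Real.exp (-(ρ ^ 2 / 2)) = Real.exp (-(ρ ^ 2 / 4)) * Real.exp (-(ρ ^ 2 / 4)) := by
    rw [← Real.exp_add]
    congr 1
    ring
  have hexp2 : Real.exp (-(ρ ^ 2 / 4)) * ρ ^ 2 ≤ 4 := by
    have h1 := Real.add_one_le_exp (ρ ^ 2 / 4)
    rw [Real.exp_neg, inv_mul_le_iff₀ (Real.exp_pos _)]
    linarith
  have hexp3 : Real.exp (-(ρ ^ 2 / 4)) ≤ 1 := Real.exp_le_one_iff.2 (by nlinarith)
  have hexp4 : Real.exp (-(ρ ^ 2 / 4)) ≤ Real.exp (c / 4) * Real.exp (-(r ^ 2 / 8)) := by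
    rw [← Real.exp_add]
    exact Real.exp_le_exp.2 (by linarith)
  have hexp5 : r * Real.exp (-(r ^ 2 / 8)) ≤ 2 * Real.exp (-(r ^ 2 / 16)) := by
    have h1 : Real.exp (-(r ^ 2 / 8)) = Real.exp (-(r ^ 2 / 16)) * Real.exp (-(r ^ 2 / 16)) := by
      rw [← Real.exp_add]; congr 1; ring
    have h2 : r * Real.exp (-(r ^ 2 / 16)) ≤ 2 := by
      have h3 := Real.add_one_le_exp (r ^ 2 / 16)
      rw [Real.exp_neg, ← div_eq_mul_inv, div_le_iff₀ (Real.exp_pos _)]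
      nlinarith [sq_nonneg (r - 4)]
    rw [h1, ← mul_assoc]
    exact mul_le_mul_of_nonneg_right h2 (Real.exp_pos _).le
  have hmain : Real.exp (-(ρ ^ 2 / 4)) * (X + Z * ρ ^ 2) ≤ X + 4 * Z := by
    have h1 : Real.exp (-(ρ ^ 2 / 4)) * X ≤ X := mul_le_of_le_one_left hX hexp3
    have h2 : Z * (Real.exp (-(ρ ^ 2 / 4)) * ρ ^ 2) ≤ Z * 4 := mul_le_mul_of_nonneg_left hexp2 hZ
    linarith
  calc _ = (r * Real.exp (-(ρ ^ 2 / 4))) * (Real.exp (-(ρ ^ 2 / 4)) * (X + Z * ρ ^ 2)) := by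
        rw [hexp1]; ring
    _ ≤ (r * (Real.exp (c / 4) * Real.exp (-(r ^ 2 / 8)))) * (X + 4 * Z) := by gcongr
    _ = Real.exp (c / 4) * (X + 4 * Z) * (r * Real.exp (-(r ^ 2 / 8))) := by ring
    _ ≤ Real.exp (c / 4) * (X + 4 * Z) * (2 * Real.exp (-(r ^ 2 / 16))) := by gcongr
    _ = _ := by ring

/-- The one-sided bound for the one-step parametrix kernel: replacing, over one step of length `η`,
the coefficients of the scheme by those frozen at the end point costs `O(η t ^ (-1/2))`. -/
lemma gaussDens_step_le {a₀ a₁ : Matrix (Fin d) (Fin d) ℝ} {lo hi L₀ T B s η : ℝ}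
    (hd : 0 < d) (hlo : 0 < lo) (hhi : 0 < hi) (hL : 0 ≤ L₀)
    (h₀ : Elliptic a₀ lo hi) (h₁ : Elliptic a₁ lo hi) (w β : E d) (hβ : ‖β‖ ≤ B)
    (hs : 0 ≤ s) (hη : 0 < η) (hT : s + η ≤ T)
    (hdiff : ∀ u v : E d, |inner ℝ (act (a₀ - a₁) u) v| ≤
      2 * Real.sqrt hi * L₀ * ‖w‖ * ‖u‖ * ‖v‖) :
    gaussDens (s • a₁ + η • a₀) (w - η • β) ≤ gaussDens ((s + η) • a₁) w +
      stepConst d T B L₀ lo hi * (η / Real.sqrt (s + η)) * isoDens (kap d hi * (s + η)) w := by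
  have hB : 0 ≤ B := (norm_nonneg _).trans hβ
  set t := s + η with ht
  have ht0 : 0 < t := by positivity
  have hηt : η ≤ t := by linarith
  have hr := kapRatio_pos d hlo hhi
  have e₀ : Elliptic (s • a₁ + η • a₀) (lo * t) (hi * t) := by
    have := (h₁.smul hs).add (h₀.smul hη.le)
    rwa [← add_mul, ← add_mul, mul_comm, mul_comm _ hi] at this
  have e₁ : Elliptic (t • a₁) (lo * t) (hi * t) := by
    have := h₁.smul ht0.le
    rwa [mul_comm, mul_comm _ hi] at this
  -- The two covariances differ by `η (a₀ - a₁)`, and the Lipschitz bound supplies the factor `‖w‖`,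
  -- which the Gaussian turns into `√t`.
  set D := η * (2 * Real.sqrt hi * L₀ * ‖w‖) with hD
  have hbound := e₀.gaussDens_le_add e₁ (by positivity) (by positivity) (D := D) (by positivity)
    (fun u v => by
      have : s • a₁ + η • a₀ - t • a₁ = η • (a₀ - a₁) := by
        rw [ht, add_smul, smul_sub]; abel
      rw [this, smul_act, real_inner_smul_left, abs_mul, abs_of_pos hη, hD]
      calc _ ≤ η * (2 * Real.sqrt hi * L₀ * ‖w‖ * ‖u‖ * ‖v‖) :=
            mul_le_mul_of_nonneg_left (hdiff u v) hη.le
        _ = _ := by ring) w (w - η • β)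
  refine hbound.trans (add_le_add le_rfl ?_)
  rw [sub_sub_cancel, norm_smul, Real.norm_of_nonneg hη.le, inv_sqrt_eq_kapRatio_mul hlo hhi ht0]
  set w' := w - η • β with hw'
  set G := (Real.sqrt ((2 * Real.pi * (kap d hi * t)) ^ d))⁻¹ with hG
  have hG0 : 0 ≤ G := by positivity
  set sh := Real.sqrt hi with hsh
  set st := Real.sqrt t with hst
  have hsh0 : 0 < sh := Real.sqrt_pos.2 hhi
  have hst0 : 0 < st := Real.sqrt_pos.2 ht0
  have hsh2 : sh ^ 2 = hi := Real.sq_sqrt hhi.le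
  have hst2 : st ^ 2 = t := Real.sq_sqrt ht0.le
  -- In units of `√(hi t)` every error term is `η / √t` times a polynomial in `r` and `ρ`.
  set r := ‖w‖ / (sh * st) with hrdef
  set ρ := ‖w'‖ / (sh * st) with hρdef
  have hwr : ‖w‖ = r * (sh * st) := by rw [hrdef]; field_simp
  have hwρ : ‖w'‖ = ρ * (sh * st) := by rw [hρdef]; field_simp
  have hr0 : 0 ≤ r := by positivity
  have hρ0 : 0 ≤ ρ := by positivity
  have hρr : r ^ 2 ≤ 2 * ρ ^ 2 + 2 * (B ^ 2 * T / hi) := by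
    have h2 : ‖w‖ ≤ ‖w'‖ + η * B := by
      calc ‖w‖ = ‖w' + η • β‖ := by rw [hw', sub_add_cancel]
        _ ≤ _ := (norm_add_le _ _).trans (by
          rw [norm_smul, Real.norm_of_nonneg hη.le]
          gcongr)
    have h3 : ‖w‖ ^ 2 ≤ 2 * ‖w'‖ ^ 2 + 2 * (η * B) ^ 2 := by
      have h4 := pow_le_pow_left₀ (norm_nonneg w) h2 2
      nlinarith [sq_nonneg (‖w'‖ - η * B)]
    have h5 : (η * B) ^ 2 ≤ (B ^ 2 * T / hi) * (hi * t) := by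
      have : (B ^ 2 * T / hi) * (hi * t) = B ^ 2 * (T * t) := by field_simp
      rw [this, mul_pow, mul_comm]
      refine mul_le_mul_of_nonneg_left ?_ (sq_nonneg _)
      calc η ^ 2 = η * η := sq η
        _ ≤ T * t := mul_le_mul (hηt.trans hT) hηt hη.le (hη.le.trans (hηt.trans hT))
    have h6 : (sh * st) ^ 2 = hi * t := by rw [mul_pow, hsh2, hst2]
    rw [hwr, hwρ, mul_pow, mul_pow ρ, h6] at h3
    have h7 : 0 < hi * t := by positivity
    refine le_of_mul_le_mul_right ?_ h7
    nlinarith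
  set X := 2 * d * hi * L₀ / lo + B * sh / lo with hX
  set Z := L₀ * hi ^ 2 / lo ^ 2 with hZ
  have hX0 : 0 ≤ X := by positivity
  have hZ0 : 0 ≤ Z := by positivity
  have hexp1 : Real.exp (-(‖w'‖ ^ 2 / (2 * (hi * t)))) = Real.exp (-(ρ ^ 2 / 2)) := by
    congr 2
    rw [hwρ, mul_pow, mul_pow, hsh2, hst2]
    field_simp
  have hexp2 : Real.exp (-(r ^ 2 / 16)) ≤ Real.exp (-(‖w‖ ^ 2 / (2 * (kap d hi * t)))) := by
    refine le_trans (le_of_eq ?_) (exp_le_exp_kap hd hhi ht0 w (c := 8) (by norm_num)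
      (by norm_num))
    congr 2
    rw [hwr, mul_pow, mul_pow, hsh2, hst2]
    field_simp
    ring
  have hbr : d * D / (lo * t) + ‖w‖ * (η * ‖β‖) / (lo * t) + D * ‖w'‖ ^ 2 / (2 * (lo * t) ^ 2) ≤
      η / st * (r * (X + Z * ρ ^ 2)) := by
    have h1 : d * D / (lo * t) = η / st * (r * (2 * d * hi * L₀ / lo)) := by
      rw [hD, hwr, ← hst2, ← hsh2]
      field_simp
    have h2 : ‖w‖ * (η * ‖β‖) / (lo * t) ≤ η / st * (r * (B * sh / lo)) := by
      calc ‖w‖ * (η * ‖β‖) / (lo * t) ≤ ‖w‖ * (η * B) / (lo * t) := by gcongr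
        _ = _ := by
          rw [hwr, ← hst2]
          field_simp
    have h3 : D * ‖w'‖ ^ 2 / (2 * (lo * t) ^ 2) = η / st * (r * (Z * ρ ^ 2)) := by
      rw [hD, hZ, hwr, hwρ, ← hst2, ← hsh2]
      field_simp
    rw [h1, h3]
    refine (add_le_add_left (add_le_add_right h2 _) _).trans (le_of_eq ?_)
    rw [hX]
    ring
  have hsc : stepConst d T B L₀ lo hi =
      kapRatio d lo hi * (Real.exp (B ^ 2 * T / hi / 4) * (2 * (X + 4 * Z))) := by
    have : B ^ 2 * T / (4 * hi) = B ^ 2 * T / hi / 4 := by field_simp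
    rw [stepConst, hX, hZ, this]; ring
  have hmain := exp_neg_mul_polynomial_le hr0 hX0 hZ0 hρr
  have hKG : 0 ≤ kapRatio d lo hi * G * (η / st) := by positivity
  have hxx : 0 ≤ Real.exp (B ^ 2 * T / hi / 4) * (2 * (X + 4 * Z)) := by positivity
  calc _ ≤ kapRatio d lo hi * G * Real.exp (-(ρ ^ 2 / 2)) * (η / st * (r * (X + Z * ρ ^ 2))) := by
        rw [hexp1]
        exact mul_le_mul_of_nonneg_left hbr (by positivity)
    _ = kapRatio d lo hi * G * (η / st) *
        (Real.exp (-(ρ ^ 2 / 2)) * (r * (X + Z * ρ ^ 2))) := by ring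
    _ ≤ kapRatio d lo hi * G * (η / st) * (Real.exp (B ^ 2 * T / hi / 4) * (2 * (X + 4 * Z)) *
        Real.exp (-(‖w‖ ^ 2 / (2 * (kap d hi * t))))) :=
        mul_le_mul_of_nonneg_left (hmain.trans (mul_le_mul_of_nonneg_left hexp2 hxx)) hKG
    _ = _ := by rw [hsc, isoDens, ← hG]; ring

/-- The power on the right is `kapRatio` squared. One factor is already in `stepConst`; the other,
being at least `4 √d √(hi/lo)`, makes up for the difference between its bracket and that of the
first entry of the maximum defining Λ₁. -/
lemma stepConst_le {m : ℕ} {T B L₀ lo hi : ℝ} (hd : 0 < d) (hT : 0 ≤ T) (hB : 0 ≤ B)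
    (hL : 0 ≤ L₀) (hlo : 0 < lo) (hlohi : lo ≤ hi) :
    stepConst d T B L₀ lo hi ≤
      Lambda1 d m T B L₀ lo hi * ((1 + 24 * (d : ℝ)) * hi / lo) ^ d := by
  have hhi : 0 < hi := hlo.trans_le hlohi
  have hd1 : (1 : ℝ) ≤ d := by exact_mod_cast hd
  have hk := kap_pos d hhi
  set q := kap d hi / lo with hq
  have hq' : (1 + 24 * (d : ℝ)) * hi / lo = q := by rw [hq, kap]
  have hq0 : 0 < q := by positivity
  have hr0 := kapRatio_pos d hlo hhi
  have hqd : q ^ d = kapRatio d lo hi * kapRatio d lo hi := by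
    rw [kapRatio, Real.mul_self_sqrt (by positivity)]
  set u := hi / lo with hu
  have hu1 : 1 ≤ u := by rw [hu, one_le_div hlo]; exact hlohi
  have hqu : q = (1 + 24 * d) * u := by rw [hq, hu, kap]; ring
  have hrat : Real.sqrt ((1 + 24 * d) * u) ≤ kapRatio d lo hi := by
    rw [kapRatio, ← hq, ← hqu]
    refine Real.sqrt_le_sqrt ?_
    refine le_self_pow₀ ?_ hd.ne'
    rw [hqu]
    nlinarith
  have hexp : Real.exp (B ^ 2 * T / (4 * hi)) ≤ Real.exp (B ^ 2 * T / hi) := by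
    refine Real.exp_le_exp.2 ?_
    gcongr
    linarith
  have hsd : Real.sqrt d * Real.sqrt d = d := Real.mul_self_sqrt (by positivity)
  have hsd1 : 1 ≤ Real.sqrt d := Real.one_le_sqrt.2 hd1
  have hsu1 : 1 ≤ Real.sqrt u := Real.one_le_sqrt.2 hu1
  have h4 : 4 * Real.sqrt d * Real.sqrt u ≤ kapRatio d lo hi := by
    refine le_trans ?_ hrat
    rw [Real.sqrt_mul (by positivity)]
    refine mul_le_mul_of_nonneg_right ?_ (by positivity)
    refine Real.le_sqrt_of_sq_le ?_
    nlinarith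
  have hBt : B * Real.sqrt hi / lo = B / Real.sqrt lo * Real.sqrt u := by
    rw [hu, Real.sqrt_div' _ hlo.le]
    have : Real.sqrt lo * Real.sqrt lo = lo := Real.mul_self_sqrt hlo.le
    have h0 : 0 < Real.sqrt lo := Real.sqrt_pos.2 hlo
    nth_rewrite 1 [← this]
    field_simp
  have hb0 : 0 ≤ B / Real.sqrt lo := by positivity
  have hin : 2 * d * hi * L₀ / lo + B * Real.sqrt hi / lo + 4 * L₀ * hi ^ 2 / lo ^ 2 ≤
      kapRatio d lo hi * (B / Real.sqrt lo + 2 * Real.sqrt d * L₀ * u ^ 2) := by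
    have e1 : 2 * d * hi * L₀ / lo = 2 * d * L₀ * u := by rw [hu]; ring
    have e2 : 4 * L₀ * hi ^ 2 / lo ^ 2 = 4 * L₀ * u ^ 2 := by rw [hu]; ring
    rw [e1, e2, hBt]
    have e3 : (4 * Real.sqrt d * Real.sqrt u) * (B / Real.sqrt lo + 2 * Real.sqrt d * L₀ * u ^ 2) ≤
        kapRatio d lo hi * (B / Real.sqrt lo + 2 * Real.sqrt d * L₀ * u ^ 2) := by gcongr
    refine le_trans ?_ e3
    have e4 : B / Real.sqrt lo * Real.sqrt u ≤
        (4 * Real.sqrt d * Real.sqrt u) * (B / Real.sqrt lo) := by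
      have : (1 : ℝ) ≤ 4 * Real.sqrt d := by linarith
      calc B / Real.sqrt lo * Real.sqrt u = 1 * (B / Real.sqrt lo * Real.sqrt u) := by ring
        _ ≤ (4 * Real.sqrt d) * (B / Real.sqrt lo * Real.sqrt u) := by gcongr
        _ = _ := by ring
    have e5 : 2 * d * L₀ * u + 4 * L₀ * u ^ 2 ≤ 8 * d * L₀ * u ^ 2 := by
      have f1 : u ≤ u ^ 2 := by nlinarith
      have f2 : 2 * d * L₀ * u ≤ 2 * d * L₀ * u ^ 2 := by gcongr
      have f3 : 4 * 1 * (L₀ * u ^ 2) ≤ 4 * d * (L₀ * u ^ 2) := by gcongr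
      have f4 : 0 ≤ d * L₀ * u ^ 2 := by positivity
      linarith
    have e6 : 8 * d * L₀ * u ^ 2 ≤
        (4 * Real.sqrt d * Real.sqrt u) * (2 * Real.sqrt d * L₀ * u ^ 2) := by
      calc 8 * d * L₀ * u ^ 2 = 8 * d * L₀ * u ^ 2 * 1 := by ring
        _ ≤ 8 * d * L₀ * u ^ 2 * Real.sqrt u := by gcongr
        _ = 8 * (Real.sqrt d * Real.sqrt d) * L₀ * u ^ 2 * Real.sqrt u := by rw [hsd]
        _ = _ := by ring
    linarith
  have hL1 : 2 * (B / Real.sqrt lo + 2 * Real.sqrt d * L₀ * u ^ 2) * Real.exp (B ^ 2 * T / hi) ≤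
      Lambda1 d m T B L₀ lo hi := by
    refine le_trans ?_ (le_max_left _ _)
    rw [← hu]
    have : 0 ≤ (d : ℝ) ^ ((d : ℝ) / 2 + 1) * (d.factorial : ℝ) * u ^ d * L₀ := by positivity
    refine mul_le_mul_of_nonneg_right (mul_le_mul_of_nonneg_left ?_ zero_le_two) (Real.exp_pos _).le
    linarith
  rw [hq', hqd, stepConst]
  calc _ ≤ kapRatio d lo hi * Real.exp (B ^ 2 * T / hi) *
        (2 * (kapRatio d lo hi * (B / Real.sqrt lo + 2 * Real.sqrt d * L₀ * u ^ 2))) := by gcongr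
    _ = (2 * (B / Real.sqrt lo + 2 * Real.sqrt d * L₀ * u ^ 2) * Real.exp (B ^ 2 * T / hi)) *
        (kapRatio d lo hi * kapRatio d lo hi) := by ring
    _ ≤ _ := by gcongr

end OneStep

/-! ### The Mittag-Leffler series and a discrete fractional Gronwall inequality. -/

section MittagLeffler

/-- The Mittag-Leffler series `∑ (c √(π t)) ^ i / Γ (1 + i / 2)`. -/
def mlSeries (c t : ℝ) : ℝ := ∑' i : ℕ, (c * Real.sqrt (Real.pi * t)) ^ i / Real.Gamma (1 + (i : ℝ) / 2)

lemma factorial_le_Gamma {k : ℕ} (hk : 1 ≤ k) {x : ℝ} (hx : (k : ℝ) + 1 ≤ x) :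
    (k.factorial : ℝ) ≤ Real.Gamma x := by
  rw [← Real.Gamma_nat_eq_factorial]
  have h1 : (1 : ℝ) ≤ k := by exact_mod_cast hk
  exact Real.Gamma_strictMonoOn_Ici.monotoneOn (Set.mem_Ici.2 (by linarith))
    (Set.mem_Ici.2 (by linarith)) hx

/-- The even terms form the exponential series of `x²`, and the odd terms are dominated by `x` times
the same series. -/
lemma summable_mlSeries {x : ℝ} (hx : 0 ≤ x) :
    Summable fun i : ℕ => x ^ i / Real.Gamma (1 + (i : ℝ) / 2) := by
  have hG : ∀ i : ℕ, 0 < Real.Gamma (1 + (i : ℝ) / 2) :=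
    fun i => Real.Gamma_pos_of_pos (by positivity)
  have hfac := Real.summable_pow_div_factorial (x ^ 2)
  generalize hf : (fun i : ℕ => x ^ i / Real.Gamma (1 + (i : ℝ) / 2)) = f
  have hfi : ∀ i : ℕ, f i = x ^ i / Real.Gamma (1 + (i : ℝ) / 2) := fun i => by rw [← hf]
  have heven : Summable fun k : ℕ => f (2 * k) := by
    refine hfac.congr fun k => ?_
    rw [hfi]
    have : 1 + ((2 * k : ℕ) : ℝ) / 2 = (k : ℝ) + 1 := by push_cast; ring
    rw [this, Real.Gamma_nat_eq_factorial, pow_mul]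
  have hodd : Summable fun k : ℕ => f (2 * k + 1) := by
    -- The first odd term is set aside because monotonicity of `Γ` is used on `[2, ∞)` only.
    rw [← summable_nat_add_iff 1]
    refine Summable.of_nonneg_of_le (fun k => ?_) (fun k => ?_)
      (((summable_nat_add_iff 1).2 hfac).mul_left x)
    · rw [hfi]
      exact div_nonneg (by positivity) (hG _).le
    rw [hfi]
    have h1 : ((k + 1).factorial : ℝ) ≤ Real.Gamma (1 + ((2 * (k + 1) + 1 : ℕ) : ℝ) / 2) :=
      factorial_le_Gamma (by omega) (by push_cast; linarith)
    rw [pow_succ, pow_mul, mul_comm _ x, mul_div_assoc]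
    have h0 : (0 : ℝ) < ((k + 1).factorial : ℝ) := by positivity
    exact mul_le_mul_of_nonneg_left (div_le_div_of_nonneg_left (by positivity) h0 h1) hx
  exact (HasSum.even_add_odd heven.hasSum hodd.hasSum).summable

variable {c : ℝ}

lemma one_le_mlSeries (hc : 0 ≤ c) (t : ℝ) : 1 ≤ mlSeries c t := by
  have h := (summable_mlSeries (x := c * Real.sqrt (Real.pi * t)) (by positivity)).le_tsum 0
    (fun i _ => div_nonneg (by positivity) (Real.Gamma_pos_of_pos (by positivity)).le)
  simpa [mlSeries] using h

lemma mlSeries_mono {c' s t : ℝ} (hc : 0 ≤ c) (hcc : c ≤ c') (hst : s ≤ t) :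
    mlSeries c s ≤ mlSeries c' t := by
  have hpi := Real.pi_pos
  refine Summable.tsum_le_tsum (fun i => ?_) (summable_mlSeries (by positivity))
    (summable_mlSeries (mul_nonneg (hc.trans hcc) (Real.sqrt_nonneg _)))
  have := Real.Gamma_pos_of_pos (show 0 < 1 + (i : ℝ) / 2 by positivity)
  have hc' : 0 ≤ c' := hc.trans hcc
  gcongr

/-- A beta integral with parameters `1 + i/2` and `1/2`. Its value is the ratio that leads from one
term of the Mittag-Leffler series to the next. -/
lemma lintegral_sqrt_pow_div_sqrt_le (i : ℕ) :
    ∫⁻ x in Set.Ioo (0 : ℝ) 1, ENNReal.ofReal (Real.sqrt x ^ i / Real.sqrt (1 - x)) ≤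
      ENNReal.ofReal (Real.Gamma (1 + (i : ℝ) / 2) * Real.sqrt Real.pi /
        Real.Gamma (1 + ((i + 1 : ℕ) : ℝ) / 2)) := by
  have hα : 0 < 1 + (i : ℝ) / 2 := by positivity
  have hb := beta_pos hα (show (0 : ℝ) < 1 / 2 by norm_num)
  have hbeta : beta (1 + (i : ℝ) / 2) (1 / 2) = Real.Gamma (1 + (i : ℝ) / 2) * Real.sqrt Real.pi /
        Real.Gamma (1 + ((i + 1 : ℕ) : ℝ) / 2) := by
    rw [beta, Real.Gamma_one_half_eq]
    congr 2
    push_cast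
    ring
  rw [← hbeta]
  have h1 : ∀ x ∈ Set.Ioo (0 : ℝ) 1, ENNReal.ofReal (Real.sqrt x ^ i / Real.sqrt (1 - x)) =
      ENNReal.ofReal (beta (1 + (i : ℝ) / 2) (1 / 2)) *
        betaPDF (1 + (i : ℝ) / 2) (1 / 2) x := by
    intro x hx
    rw [betaPDF_of_pos_lt_one hx.1 hx.2, ← ENNReal.ofReal_mul hb.le]
    congr 1
    have e1 : Real.sqrt x ^ i = x ^ (1 + (i : ℝ) / 2 - 1) := by
      rw [Real.sqrt_eq_rpow, ← Real.rpow_natCast, ← Real.rpow_mul hx.1.le]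
      congr 1; ring
    have e2 : Real.sqrt (1 - x) = ((1 - x) ^ ((1 : ℝ) / 2 - 1))⁻¹ := by
      rw [← Real.rpow_neg (by linarith [hx.2]), Real.sqrt_eq_rpow]
      congr 1; ring
    rw [e1, e2, div_inv_eq_mul, mul_assoc, one_div (beta _ _), mul_inv_cancel_left₀ hb.ne']
  rw [setLIntegral_congr_fun measurableSet_Ioo h1, lintegral_const_mul' _ _ ENNReal.ofReal_ne_top]
  calc _ ≤ ENNReal.ofReal (beta (1 + (i : ℝ) / 2) (1 / 2)) *
        ∫⁻ x, betaPDF (1 + (i : ℝ) / 2) (1 / 2) x := by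
        gcongr
        exact Measure.restrict_le_self
    _ = _ := by rw [lintegral_betaPDF_eq_one hα (by norm_num), mul_one]

/-- Left Riemann sums of a function that increases on `[0, 1)` are below its integral. -/
lemma sum_mul_le_lintegral {g : ℝ → ℝ≥0∞} (hg : MonotoneOn g (Set.Ico 0 1)) {x : ℕ → ℝ}
    (hx : StrictMono x) (hx0 : x 0 = 0) {N : ℕ} (hN : x N = 1) :
    ∑ j ∈ Finset.range N, ENNReal.ofReal (x (j + 1) - x j) * g (x j) ≤
      ∫⁻ y in Set.Ioo (0 : ℝ) 1, g y := by
  have key : ∀ n ≤ N, ∑ j ∈ Finset.range n, ENNReal.ofReal (x (j + 1) - x j) * g (x j) ≤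
      ∫⁻ y in Set.Ioo (0 : ℝ) (x n), g y := by
    intro n
    induction n with
    | zero => intro _; simp
    | succ n ih =>
      intro hn
      rw [Finset.sum_range_succ]
      have h0 : 0 ≤ x n := by rw [← hx0]; exact hx.monotone (Nat.zero_le _)
      have h1 : x n < x (n + 1) := hx n.lt_succ_self
      have h2 : x (n + 1) ≤ 1 := by rw [← hN]; exact hx.monotone hn
      have hsub : Set.Ioo (0 : ℝ) (x n) ∪ Set.Ioo (x n) (x (n + 1)) ⊆ Set.Ioo 0 (x (n + 1)) := by
        rintro y (hy | hy)
        · exact ⟨hy.1, hy.2.trans h1⟩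
        · exact ⟨h0.trans_lt hy.1, hy.2⟩
      refine le_trans ?_ (lintegral_mono_set hsub)
      rw [lintegral_union measurableSet_Ioo
        (Set.disjoint_left.2 fun y hy hy' => lt_asymm hy.2 hy'.1)]
      refine add_le_add (ih (by omega)) ?_
      calc ENNReal.ofReal (x (n + 1) - x n) * g (x n)
          = ∫⁻ _ in Set.Ioo (x n) (x (n + 1)), g (x n) := by
            rw [setLIntegral_const, Real.volume_Ioo, mul_comm]
        _ ≤ _ := setLIntegral_mono' measurableSet_Ioo fun y hy =>
            hg ⟨h0, by linarith⟩ ⟨h0.trans hy.1.le, hy.2.trans_le h2⟩ hy.1.le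
  have := key N le_rfl
  rwa [hN] at this

variable {τ : ℕ → ℝ}

/-- After rescaling time by `τ N` the sum is a left Riemann sum of `√y ^ i / √(1 - y)`, which
increases on `[0, 1)`; so the beta integral bounds it for any mesh. -/
lemma sum_div_sqrt_mul_sqrt_pow_le (hτ : StrictMono τ) (hτ0 : τ 0 = 0) {N : ℕ} (hN : 0 < N)
    (i : ℕ) :
    ∑ j ∈ Finset.range N, (τ (j + 1) - τ j) / Real.sqrt (τ N - τ j) * Real.sqrt (τ j) ^ i ≤
      Real.sqrt (τ N) ^ (i + 1) * (Real.Gamma (1 + (i : ℝ) / 2) * Real.sqrt Real.pi /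
        Real.Gamma (1 + ((i + 1 : ℕ) : ℝ) / 2)) := by
  have hT : 0 < τ N := by rw [← hτ0]; exact hτ hN
  set g : ℝ → ℝ := fun y => Real.sqrt y ^ i / Real.sqrt (1 - y) with hg
  have hgm : MonotoneOn (fun y => ENNReal.ofReal (g y)) (Set.Ico 0 1) := by
    intro a ha b hb hab
    refine ENNReal.ofReal_le_ofReal ?_
    have h1 : 0 < Real.sqrt (1 - b) := Real.sqrt_pos.2 (by linarith [hb.2])
    simp only [hg]
    gcongr
  have hx : StrictMono fun j => τ j / τ N := fun a b hab => by
    have := hτ hab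
    simp only
    gcongr
  have h := sum_mul_le_lintegral hgm hx (by simp [hτ0]) (N := N) (div_self hT.ne')
  have hnn : ∀ j ∈ Finset.range N, 0 ≤ (τ (j + 1) / τ N - τ j / τ N) * g (τ j / τ N) := fun j _ => by
    have : τ j / τ N < τ (j + 1) / τ N := hx j.lt_succ_self
    have : 0 ≤ g (τ j / τ N) := by simp only [hg]; positivity
    exact mul_nonneg (by linarith) this
  have h2 := h.trans (lintegral_sqrt_pow_div_sqrt_le i)
  have h3 : ∑ j ∈ Finset.range N, (τ (j + 1) / τ N - τ j / τ N) * g (τ j / τ N) ≤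
      Real.Gamma (1 + (i : ℝ) / 2) * Real.sqrt Real.pi /
        Real.Gamma (1 + ((i + 1 : ℕ) : ℝ) / 2) := by
    have hG1 := Real.Gamma_pos_of_pos (show 0 < 1 + (i : ℝ) / 2 by positivity)
    have hG2 := Real.Gamma_pos_of_pos (show 0 < 1 + ((i + 1 : ℕ) : ℝ) / 2 by positivity)
    rw [← ENNReal.ofReal_le_ofReal_iff (by positivity), ENNReal.ofReal_sum_of_nonneg hnn]
    refine le_trans (le_of_eq (Finset.sum_congr rfl fun j _ => ?_)) h2
    have : τ j / τ N < τ (j + 1) / τ N := hx j.lt_succ_self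
    rw [ENNReal.ofReal_mul (by linarith)]
  have h4 := mul_le_mul_of_nonneg_left h3 (show 0 ≤ Real.sqrt (τ N) ^ (i + 1) by positivity)
  refine le_trans (le_of_eq ?_) h4
  rw [Finset.mul_sum]
  refine Finset.sum_congr rfl fun j hj => ?_
  have hj' : τ j < τ N := hτ (Finset.mem_range.1 hj)
  have hj0 : 0 ≤ τ j := by rw [← hτ0]; exact hτ.monotone (Nat.zero_le _)
  have e1 : 1 - τ j / τ N = (τ N - τ j) / τ N := by field_simp
  have hs : 0 < Real.sqrt (τ N - τ j) := Real.sqrt_pos.2 (by linarith)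
  have hsN : 0 < Real.sqrt (τ N) := Real.sqrt_pos.2 hT
  simp only [hg]
  have hsq : τ N = Real.sqrt (τ N) * Real.sqrt (τ N) := (Real.mul_self_sqrt hT.le).symm
  rw [e1, Real.sqrt_div hj0, Real.sqrt_div (by linarith), div_pow, ← sub_div]
  generalize Real.sqrt (τ N - τ j) = u at *
  generalize Real.sqrt (τ N) = v at *
  generalize τ (j + 1) - τ j = w at *
  rw [hsq]
  field_simp
  ring

/-- The discrete fractional Gronwall recursion is solved by the Mittag-Leffler series. -/
lemma one_add_sum_mlSeries_le (hc : 0 ≤ c) (hτ : StrictMono τ) (hτ0 : τ 0 = 0) {N : ℕ}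
    (hN : 0 < N) :
    1 + ∑ j ∈ Finset.range N, c * ((τ (j + 1) - τ j) / Real.sqrt (τ N - τ j)) * mlSeries c (τ j) ≤
      mlSeries c (τ N) := by
  have hpi := Real.pi_pos
  have hsum : ∀ t, Summable fun i : ℕ =>
      (c * Real.sqrt (Real.pi * t)) ^ i / Real.Gamma (1 + (i : ℝ) / 2) :=
    fun t => summable_mlSeries (by positivity)
  have hG : ∀ i : ℕ, 0 < Real.Gamma (1 + (i : ℝ) / 2) :=
    fun i => Real.Gamma_pos_of_pos (by positivity)
  rw [mlSeries, (hsum _).tsum_eq_zero_add]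
  simp only [pow_zero, Nat.cast_zero, zero_div, add_zero, Real.Gamma_one, div_one]
  refine add_le_add le_rfl ?_
  have hs2 : ∀ j ∈ Finset.range N, Summable fun i : ℕ =>
      c * ((τ (j + 1) - τ j) / Real.sqrt (τ N - τ j)) *
        ((c * Real.sqrt (Real.pi * τ j)) ^ i / Real.Gamma (1 + (i : ℝ) / 2)) :=
    fun j _ => (hsum _).mul_left _
  simp_rw [mlSeries, ← tsum_mul_left]
  rw [← Summable.tsum_finsetSum hs2]
  -- Termwise comparison: the kernel sum carries the `i`-th term at the times `τ j` below the `(i +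
  -- 1)`-st term at `τ N`.
  refine Summable.tsum_le_tsum (fun i => ?_) (summable_sum hs2)
    ((summable_nat_add_iff 1).2 (hsum _))
  have h := mul_le_mul_of_nonneg_left (sum_div_sqrt_mul_sqrt_pow_le hτ hτ0 hN i)
    (show 0 ≤ c * ((c * Real.sqrt Real.pi) ^ i / Real.Gamma (1 + (i : ℝ) / 2)) from
      mul_nonneg hc (div_nonneg (by positivity) (hG i).le))
  refine le_trans (le_of_eq ?_) (h.trans (le_of_eq ?_))
  · rw [Finset.mul_sum]
    refine Finset.sum_congr rfl fun j _ => ?_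
    rw [Real.sqrt_mul hpi.le, ← mul_assoc c, mul_pow _ (Real.sqrt (τ j))]
    ring
  · have := (hG i).ne'
    rw [Real.sqrt_mul hpi.le, ← mul_assoc c, mul_pow _ (Real.sqrt (τ N)), pow_succ (c * _)]
    field_simp

end MittagLeffler

/-! ### The parametrix along a chain of measures. -/

section Chain

variable {d m : ℕ} {b : E d → E d} {σ : E d → Matrix (Fin d) (Fin m) ℝ} {lo hi L₀ B : ℝ}

/-- The transition operator of one step of length `r` of the scheme. -/
def emStep (b : E d → E d) (σ : E d → Matrix (Fin d) (Fin m) ℝ) (r : ℝ) (ψ : E d → ℝ≥0∞)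
    (z : E d) : ℝ≥0∞ :=
  ∫⁻ ζ, ψ (z + r • b z + act (Real.sqrt r • σ z) ζ) ∂(stdGaussian (E m))

lemma sqrt_smul_mul_transpose (A : Matrix (Fin d) (Fin m) ℝ) {r : ℝ} (hr : 0 ≤ r) :
    (Real.sqrt r • A) * (Real.sqrt r • A)ᵀ = r • (A * Aᵀ) := by
  rw [Matrix.transpose_smul, Matrix.smul_mul, Matrix.mul_smul, smul_smul, Real.mul_self_sqrt hr]

lemma DiffusionAssumption.continuous (hσ : DiffusionAssumption σ lo hi L₀) : Continuous σ := by
  refine continuous_pi fun i => continuous_pi fun j => ?_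
  refine continuous_iff_continuousAt.2 fun x => ?_
  refine tendsto_iff_norm_sub_tendsto_zero.2 ?_
  refine squeeze_zero (fun _ => norm_nonneg _) (g := fun y => L₀ * ‖y - x‖) (fun y => ?_) ?_
  · refine le_trans ?_ (hσ.lipschitz y x)
    rw [hsNorm, Real.norm_eq_abs, ← Real.sqrt_sq_eq_abs]
    refine Real.sqrt_le_sqrt ?_
    have h1 : (σ y i j - σ x i j) ^ 2 ≤ ∑ j', (σ y - σ x) i j' ^ 2 :=
      Finset.single_le_sum (f := fun j' => (σ y - σ x) i j' ^ 2) (fun _ _ => sq_nonneg _)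
        (Finset.mem_univ j)
    exact h1.trans (Finset.single_le_sum (f := fun i' => ∑ j', (σ y - σ x) i' j' ^ 2)
      (fun _ _ => Finset.sum_nonneg fun _ _ => sq_nonneg _) (Finset.mem_univ i))
  · have h : Continuous fun y : E d => L₀ * ‖y - x‖ := by fun_prop
    simpa using h.tendsto x

lemma continuous_gaussDens_uncurry {α : Type*} [TopologicalSpace α]
    {S : α → Matrix (Fin d) (Fin d) ℝ} (hS : Continuous S) (hdet : ∀ a, 0 < (S a).det) :
    Continuous fun p : α × E d => gaussDens (S p.1) p.2 := by
  have hS1 : Continuous fun p : α × E d => S p.1 := hS.comp continuous_fst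
  have hd : Continuous fun p : α × E d => (S p.1).det := hS1.matrix_det
  have hinv : Continuous fun p : α × E d => (S p.1)⁻¹ := by
    simp_rw [Matrix.inv_def, Ring.inverse_eq_inv']
    exact (hd.inv₀ fun p => (hdet p.1).ne').smul hS1.matrix_adjugate
  have hact : Continuous fun p : α × E d => act (S p.1)⁻¹ p.2 := by
    unfold act
    exact (PiLp.continuous_toLp 2 _).comp
      (hinv.matrix_mulVec ((PiLp.continuous_ofLp 2 _).comp continuous_snd))
  unfold gaussDens
  refine Continuous.mul (Continuous.inv₀ (by fun_prop) fun p => ?_) (by fun_prop)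
  have := hdet p.1
  have hpi := Real.pi_pos
  positivity

/-- Joint measurability for Tonelli's theorem. The case `l = 0` is admitted so that `S = 0` covers
the transition density of a bare step. -/
lemma measurable_gaussDens_step (hb : Measurable b) (hσ : DiffusionAssumption σ lo hi L₀)
    {S : Matrix (Fin d) (Fin d) ℝ} {l h r : ℝ} (hS : Elliptic S l h) (hl : 0 ≤ l) (hr : 0 < r) :
    Measurable fun p : E d × E d =>
      gaussDens (S + r • (σ p.1 * (σ p.1)ᵀ)) (p.2 - (p.1 + r • b p.1)) := by
  have hlo := hσ.lo_pos
  have hc := continuous_gaussDens_uncurry (d := d) (S := fun z => S + r • (σ z * (σ z)ᵀ))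
    (continuous_const.add ((hσ.continuous.matrix_mul hσ.continuous.matrix_transpose).const_smul r))
    (fun z => (hS.add ((hσ.elliptic z).smul hr.le)).det_pos (by positivity))
  exact hc.measurable.comp (measurable_fst.prodMk
    (measurable_snd.sub (measurable_fst.add ((hb.comp measurable_fst).const_smul r))))

lemma emStep_eq_lintegral (hσ : DiffusionAssumption σ lo hi L₀) {r : ℝ} (hr : 0 < r)
    {ψ : E d → ℝ≥0∞} (hψ : Measurable ψ) (z : E d) :
    emStep b σ r ψ z = ∫⁻ y, ψ y *
      ENNReal.ofReal (gaussDens (r • (σ z * (σ z)ᵀ)) (y - (z + r • b z))) := by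
  have hlo := hσ.lo_pos
  have h := sqrt_smul_mul_transpose (σ z) hr.le
  have hell := (hσ.elliptic z).smul hr.le
  rw [← h] at hell ⊢
  exact lintegral_stdGaussian_act hell (by positivity) _ hψ

/-- Independent Gaussian increments add their covariances. In the parametrix `S` is frozen at the
end point, so it does not depend on the position that is averaged. -/
lemma emStep_gaussDens (hσ : DiffusionAssumption σ lo hi L₀) {r : ℝ} (hr : 0 < r)
    {S : Matrix (Fin d) (Fin d) ℝ} {l h : ℝ} (hS : Elliptic S l h) (hl : 0 < l) (hh : 0 < h)
    (y z : E d) :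
    emStep b σ r (fun x => ENNReal.ofReal (gaussDens S (y - x))) z =
      ENNReal.ofReal (gaussDens (S + r • (σ z * (σ z)ᵀ)) (y - (z + r • b z))) := by
  have hlo := hσ.lo_pos
  have hhi := hσ.hi_pos
  have h := sqrt_smul_mul_transpose (σ z) hr.le
  have hell := (hσ.elliptic z).smul hr.le
  rw [← h] at hell ⊢
  exact lintegral_stdGaussian_gaussDens hell hS (by positivity) hl (by positivity) hh _ _

lemma one_le_kapRatio (hlo : 0 < lo) (hlohi : lo ≤ hi) : 1 ≤ kapRatio d lo hi := by
  rw [kapRatio, Real.one_le_sqrt]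
  refine one_le_pow₀ ?_
  rw [one_le_div hlo, kap]
  have : (0 : ℝ) ≤ d := by positivity
  nlinarith

variable {μ : ℕ → Measure (E d)} {τ : ℕ → ℝ} {M : ℕ} {T : ℝ}

/-- A chain of measures whose `j`-th step is the scheme over the time `τ (j + 1) - τ j` is dominated
by the heat flow of its initial measure. -/
theorem lintegral_chain_le [∀ j, SFinite (μ j)] (hd : 0 < d) (hb : Measurable b)
    (hbB : ∀ x, ‖b x‖ ≤ B) (hσ : DiffusionAssumption σ lo hi L₀)
    (hτ : StrictMono τ) (hτ0 : τ 0 = 0) (hT : τ M ≤ T)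
    (hstep : ∀ j < M, ∀ ψ : E d → ℝ≥0∞, Measurable ψ →
      ∫⁻ z, ψ z ∂(μ (j + 1)) = ∫⁻ z, emStep b σ (τ (j + 1) - τ j) ψ z ∂(μ j))
    (N : ℕ) (hN : 0 < N) (hNM : N ≤ M) (ψ : E d → ℝ≥0∞) (hψ : Measurable ψ) :
    ∫⁻ z, ψ z ∂(μ N) ≤
      ENNReal.ofReal (kapRatio d lo hi * mlSeries (stepConst d T B L₀ lo hi) (τ N)) *
        ∫⁻ y, ψ y * ∫⁻ x, ENNReal.ofReal (isoDens (kap d hi * τ N) (y - x)) ∂(μ 0) := by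
  have hlo := hσ.lo_pos
  have hhi := hσ.hi_pos
  have hL := hσ.L_pos
  have hk := kap_pos d hhi
  have hB : 0 ≤ B := (norm_nonneg _).trans (hbB 0)
  have hrat := one_le_kapRatio (d := d) hlo (hσ.lo_le_hi hd)
  set c := kapRatio d lo hi with hc
  set c' := stepConst d T B L₀ lo hi with hc'
  have hc'0 : 0 ≤ c' := stepConst_nonneg d hB hL.le hlo hhi
  set a : E d → Matrix (Fin d) (Fin d) ℝ := fun z => σ z * (σ z)ᵀ with ha
  have hell : ∀ z, Elliptic (a z) lo hi := hσ.elliptic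
  induction N using Nat.strong_induction_on generalizing ψ with
  | _ N ih =>
  obtain ⟨n, rfl⟩ : ∃ n, N = n + 1 := ⟨N - 1, by omega⟩
  have hτN : 0 < τ (n + 1) := by rw [← hτ0]; exact hτ n.succ_pos
  set J : E d → ℝ≥0∞ := fun y =>
    ∫⁻ x, ENNReal.ofReal (isoDens (kap d hi * τ (n + 1)) (y - x)) ∂(μ 0) with hJ
  -- `v j` makes one step of the scheme from `z` and uses the covariance frozen at `y` afterwards;
  -- `u j` is frozen from time `τ j` on; `ε j` bounds the excess of `v j` over `u j`.
  set v : ℕ → E d → E d → ℝ := fun j y z =>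
    gaussDens ((τ (n + 1) - τ (j + 1)) • a y + (τ (j + 1) - τ j) • a z)
      (y - (z + (τ (j + 1) - τ j) • b z)) with hv
  set u : ℕ → E d → E d → ℝ := fun j y z => gaussDens ((τ (n + 1) - τ j) • a y) (y - z) with hu
  set ε : ℕ → E d → E d → ℝ≥0∞ := fun j y z =>
    ENNReal.ofReal (c' * ((τ (j + 1) - τ j) / Real.sqrt (τ (n + 1) - τ j))) *
      ENNReal.ofReal (isoDens (kap d hi * (τ (n + 1) - τ j)) (y - z)) with hε
  have hr : ∀ j, 0 < τ (j + 1) - τ j := fun j => sub_pos.2 (hτ j.lt_succ_self)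
  have hle : ∀ j ≤ n, 0 ≤ τ (n + 1) - τ (j + 1) := fun j hj =>
    sub_nonneg.2 (hτ.monotone (by omega))
  have hpos : ∀ j ≤ n, 0 < τ (n + 1) - τ j := fun j hj => sub_pos.2 (hτ (by omega))
  have hτj : ∀ j, 0 ≤ τ j := fun j => by rw [← hτ0]; exact hτ.monotone (Nat.zero_le _)
  have h1 : ∀ j ≤ n, ∀ y z, ENNReal.ofReal (v j y z) ≤ ENNReal.ofReal (u j y z) + ε j y z := by
    intro j hj y z
    have hsum : τ (n + 1) - τ (j + 1) + (τ (j + 1) - τ j) = τ (n + 1) - τ j := by ring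
    have h := gaussDens_step_le (T := T) hd hlo hhi hL.le (hell z) (hell y) (y - z) (b z) (hbB z)
      (hle j hj) (hr j) (by
        rw [hsum]
        have := hτ.monotone hNM
        have := hτj j
        linarith) (fun p q => by
        rw [norm_sub_rev]
        exact hσ.abs_inner_sub_le z y p q)
    rw [hsum, sub_sub] at h
    refine (ENNReal.ofReal_le_ofReal h).trans ?_
    have hx : 0 ≤ c' * ((τ (j + 1) - τ j) / Real.sqrt (τ (n + 1) - τ j)) :=
      mul_nonneg hc'0 (div_nonneg (hr j).le (Real.sqrt_nonneg _))
    rw [ENNReal.ofReal_add (gaussDens_nonneg _ _) (mul_nonneg hx (isoDens_nonneg _ _)),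
      ENNReal.ofReal_mul hx]
  -- The scheme's own step turns `u (j + 1)` into `v j`; this is what makes the errors telescope.
  have h2 : ∀ j < n, ∀ y, ∫⁻ z, ENNReal.ofReal (v j y z) ∂(μ j) =
      ∫⁻ z, ENNReal.ofReal (u (j + 1) y z) ∂(μ (j + 1)) := by
    intro j hj y
    have hp := hpos (j + 1) hj
    rw [hstep j (by omega) (fun z => ENNReal.ofReal (u (j + 1) y z))
      (by simp only [hu]; fun_prop)]
    refine lintegral_congr fun z => ?_
    exact (emStep_gaussDens hσ (hr j) ((hell y).smul hp.le) (by positivity) (by positivity)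
      y z).symm
  have hεm : ∀ j y, Measurable (ε j y) := fun j y => by simp only [hε]; fun_prop
  have h3 : ∀ y, ∀ k ≤ n, ∫⁻ z, ENNReal.ofReal (v k y z) ∂(μ k) ≤
      ∫⁻ z, ENNReal.ofReal (u 0 y z) ∂(μ 0) +
        ∑ j ∈ Finset.range (k + 1), ∫⁻ z, ε j y z ∂(μ j) := by
    intro y k
    induction k with
    | zero =>
      intro _
      refine (lintegral_mono (h1 0 (Nat.zero_le _) y)).trans ?_
      rw [lintegral_add_right _ (hεm 0 y)]
      simp
    | succ k ihk =>
      intro hk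
      refine (lintegral_mono (h1 (k + 1) hk y)).trans ?_
      rw [lintegral_add_right _ (hεm (k + 1) y), ← h2 k hk y, Finset.sum_range_succ _ (k + 1),
        ← add_assoc]
      exact add_le_add (ihk (by omega)) le_rfl
  have h4 : ∀ y, ∀ j ≤ n, ∫⁻ z, ε j y z ∂(μ j) ≤
      ENNReal.ofReal (c * (c' * ((τ (j + 1) - τ j) / Real.sqrt (τ (n + 1) - τ j)) *
        mlSeries c' (τ j))) * J y := by
    intro y j hj
    have hx : 0 ≤ c' * ((τ (j + 1) - τ j) / Real.sqrt (τ (n + 1) - τ j)) :=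
      mul_nonneg hc'0 (div_nonneg (hr j).le (Real.sqrt_nonneg _))
    have hml : 1 ≤ mlSeries c' (τ j) := one_le_mlSeries hc'0 _
    have hcml : 1 ≤ c * mlSeries c' (τ j) := one_le_mul_of_one_le_of_one_le hrat hml
    have hiso : ∫⁻ z, ENNReal.ofReal (isoDens (kap d hi * (τ (n + 1) - τ j)) (y - z)) ∂(μ j) ≤
        ENNReal.ofReal (c * mlSeries c' (τ j)) * J y := by
      -- At `j = 0` no induction hypothesis is needed: the integral is `J y` itself.
      rcases Nat.eq_zero_or_pos j with rfl | hj0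
      · rw [hτ0, sub_zero]
        refine le_mul_of_one_le_left zero_le ?_
        rw [hτ0] at hcml
        exact ENNReal.one_le_ofReal.2 hcml
      · have hp := hpos j hj
        have hτj0 : 0 < τ j := by rw [← hτ0]; exact hτ hj0
        -- The induction hypothesis is applied with a heat kernel as test function, and
        -- Chapman-Kolmogorov then merges the times `τ j` and `τ (n + 1) - τ j`.
        refine (ih j (by omega) hj0 (by omega) _ (by fun_prop)).trans (le_of_eq ?_)
        congr 1
        have hmeas : Measurable (Function.uncurry fun (z x : E d) =>
            ENNReal.ofReal (isoDens (kap d hi * (τ (n + 1) - τ j)) (y - z)) *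
              ENNReal.ofReal (isoDens (kap d hi * τ j) (z - x))) := by
          simp only [Function.uncurry_def]
          fun_prop
        calc _ = ∫⁻ z, ∫⁻ x, ENNReal.ofReal (isoDens (kap d hi * (τ (n + 1) - τ j)) (y - z)) *
              ENNReal.ofReal (isoDens (kap d hi * τ j) (z - x)) ∂(μ 0) := by
              refine lintegral_congr fun z => ?_
              rw [lintegral_const_mul' _ _ ENNReal.ofReal_ne_top]
          _ = ∫⁻ x, ∫⁻ z, ENNReal.ofReal (isoDens (kap d hi * (τ (n + 1) - τ j)) (y - z)) *
              ENNReal.ofReal (isoDens (kap d hi * τ j) (z - x)) ∂volume ∂(μ 0) :=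
              lintegral_lintegral_swap hmeas.aemeasurable
          _ = J y := by
              refine lintegral_congr fun x => ?_
              simp_rw [mul_comm (ENNReal.ofReal (isoDens (kap d hi * (τ (n + 1) - τ j)) _))]
              rw [lintegral_isoDens_mul_isoDens (by positivity) (by positivity), ← mul_add]
              congr 3
              ring
    simp only [hε]
    rw [lintegral_const_mul' _ _ ENNReal.ofReal_ne_top]
    refine (mul_le_mul_right hiso _).trans (le_of_eq ?_)
    rw [← mul_assoc, ← ENNReal.ofReal_mul hx]
    congr 2
    ring
  have h5 : ∀ y, ∫⁻ z, ENNReal.ofReal (u 0 y z) ∂(μ 0) ≤ ENNReal.ofReal c * J y := by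
    intro y
    rw [hJ, ← lintegral_const_mul' _ _ ENNReal.ofReal_ne_top]
    refine lintegral_mono fun z => ?_
    rw [← ENNReal.ofReal_mul (by positivity)]
    refine ENNReal.ofReal_le_ofReal ?_
    have he : Elliptic ((τ (n + 1)) • a y) (lo * τ (n + 1)) (hi * τ (n + 1)) := by
      have := (hell y).smul hτN.le
      rwa [mul_comm, mul_comm _ hi] at this
    have h := he.gaussDens_sub_le_isoDens hd hlo hhi hτN (y - z) 0 (B := 0) (by simp)
    simpa [hu, hτ0] using h
  have h6 : ∀ y, ∫⁻ z, ENNReal.ofReal (v n y z) ∂(μ n) ≤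
      ENNReal.ofReal (c * mlSeries c' (τ (n + 1))) * J y := by
    intro y
    have hsum0 : ∀ j ∈ Finset.range (n + 1),
        0 ≤ c * (c' * ((τ (j + 1) - τ j) / Real.sqrt (τ (n + 1) - τ j)) * mlSeries c' (τ j)) :=
      fun j _ => by
        have h1 := one_le_mlSeries hc'0 (τ j)
        have h2 := (hr j).le
        positivity
    calc _ ≤ _ := h3 y n le_rfl
      _ ≤ ENNReal.ofReal c * J y + ∑ j ∈ Finset.range (n + 1),
          ENNReal.ofReal (c * (c' * ((τ (j + 1) - τ j) / Real.sqrt (τ (n + 1) - τ j)) *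
            mlSeries c' (τ j))) * J y :=
        add_le_add (h5 y) (Finset.sum_le_sum fun j hj =>
          h4 y j (Nat.lt_succ_iff.1 (Finset.mem_range.1 hj)))
      _ = ENNReal.ofReal (c + ∑ j ∈ Finset.range (n + 1),
          c * (c' * ((τ (j + 1) - τ j) / Real.sqrt (τ (n + 1) - τ j)) * mlSeries c' (τ j))) *
            J y := by
        rw [← Finset.sum_mul, ← add_mul, ← ENNReal.ofReal_sum_of_nonneg hsum0,
          ← ENNReal.ofReal_add (by positivity) (Finset.sum_nonneg hsum0)]
      _ ≤ _ := by
        refine mul_le_mul_left (ENNReal.ofReal_le_ofReal ?_) _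
        have h := mul_le_mul_of_nonneg_left (one_add_sum_mlSeries_le hc'0 hτ hτ0 n.succ_pos)
          (show 0 ≤ c by linarith)
        rw [mul_add, mul_one, Finset.mul_sum] at h
        exact h
  have hvm : Measurable (Function.uncurry fun z y => ψ y * ENNReal.ofReal (v n y z)) := by
    have := measurable_gaussDens_step hb hσ (S := 0) (l := 0) (h := 0)
      ⟨by simp [Matrix.IsSymm], by simp [act], by simp [act]⟩ le_rfl (hr n)
    simp only [zero_add] at this
    simp only [hv, sub_self, zero_smul, zero_add, Function.uncurry_def]
    exact (hψ.comp measurable_snd).mul this.ennreal_ofReal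
  -- In `v n` no frozen part is left: it is the transition density of the last step, so its integral
  -- against `μ n` is the density of `μ (n + 1)`.
  calc ∫⁻ z, ψ z ∂(μ (n + 1)) = ∫⁻ z, ∫⁻ y, ψ y * ENNReal.ofReal (v n y z) ∂volume ∂(μ n) := by
        rw [hstep n (by omega) ψ hψ]
        refine lintegral_congr fun z => ?_
        rw [emStep_eq_lintegral hσ (hr n) hψ]
        simp [hv, ha]
    _ = ∫⁻ y, ∫⁻ z, ψ y * ENNReal.ofReal (v n y z) ∂(μ n) ∂volume :=
        lintegral_lintegral_swap hvm.aemeasurable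
    _ ≤ ∫⁻ y, ENNReal.ofReal (c * mlSeries c' (τ (n + 1))) * (ψ y * J y) := by
        refine lintegral_mono fun y => ?_
        simp only
        rw [lintegral_const_mul _ (by
          have h := measurable_gaussDens_step hb hσ ((hell y).smul (hle n le_rfl))
            (mul_nonneg (hle n le_rfl) hlo.le) (hr n)
          exact (h.comp (measurable_id.prodMk measurable_const)).ennreal_ofReal)]
        calc ψ y * ∫⁻ z, ENNReal.ofReal (v n y z) ∂(μ n)
            ≤ ψ y * (ENNReal.ofReal (c * mlSeries c' (τ (n + 1))) * J y) :=
              mul_le_mul_right (h6 y) _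
          _ = _ := by ring
    _ = _ := lintegral_const_mul' _ _ ENNReal.ofReal_ne_top

end Chain

/-! ### Gaussian domination for the Euler-Maruyama scheme. -/

section Scheme

variable {Ω : Type*} {mΩ : MeasurableSpace Ω} {P : Measure Ω} [IsProbabilityMeasure P]
  {𝓕 : Filtration ℝ≥0 mΩ} {d m : ℕ} {W : ℝ≥0 → Ω → E m}
  {b : E d → E d} {σ : E d → Matrix (Fin d) (Fin m) ℝ} {lo hi L₀ B : ℝ} {x : E d} {δ : ℝ≥0}

/-- Independence makes the joint law of `α` and the increment a product, and Tonelli's theorem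
integrates the increment out. It stands in for conditioning on `𝓕 s`. -/
lemma IsBrownian.lintegral_increment (hW : IsBrownian W 𝓕 P) {s t : ℝ≥0} (hst : s ≤ t)
    {S : Type*} [MeasurableSpace S] {α : Ω → S} (hα : Measurable[𝓕 s] α)
    {Ψ : S × E m → ℝ≥0∞} (hΨ : Measurable Ψ) :
    ∫⁻ ω, Ψ (α ω, W t ω - W s ω) ∂P =
      ∫⁻ ω, ∫⁻ ζ, Ψ (α ω, Real.sqrt ((t : ℝ) - s) • ζ) ∂(stdGaussian (E m)) ∂P := by
  have hWt : Measurable (W t) := (hW.adapted t).mono (𝓕.le t) le_rfl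
  have hWs : Measurable (W s) := (hW.adapted s).mono (𝓕.le s) le_rfl
  have hinc : Measurable fun ω => W t ω - W s ω := hWt.sub hWs
  have hα' : Measurable α := hα.mono (𝓕.le s) le_rfl
  have hind : IndepFun α (fun ω => W t ω - W s ω) P := by
    rw [IndepFun_iff_Indep]
    exact indep_of_indep_of_le_left (hW.indep s t hst).symm hα.comap_le
  have hmap := (indepFun_iff_map_prod_eq_prod_map_map hα'.aemeasurable hinc.aemeasurable).1 hind
  have hsc : Measurable fun z : E m => Real.sqrt ((t : ℝ) - s) • z := measurable_const_smul _
  rw [hW.law s t hst] at hmap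
  have : IsProbabilityMeasure ((stdGaussian (E m)).map fun z => Real.sqrt ((t : ℝ) - s) • z) :=
    Measure.isProbabilityMeasure_map hsc.aemeasurable
  calc ∫⁻ ω, Ψ (α ω, W t ω - W s ω) ∂P
      = ∫⁻ p, Ψ p ∂(P.map fun ω => (α ω, W t ω - W s ω)) :=
        (lintegral_map hΨ (hα'.prodMk hinc)).symm
    _ = ∫⁻ a, ∫⁻ w, Ψ (a, w) ∂((stdGaussian (E m)).map fun z => Real.sqrt ((t : ℝ) - s) • z)
          ∂(P.map α) := by
        rw [hmap, lintegral_prod _ hΨ.aemeasurable]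
    _ = ∫⁻ ω, ∫⁻ w, Ψ (α ω, w) ∂((stdGaussian (E m)).map fun z => Real.sqrt ((t : ℝ) - s) • z)
          ∂P := lintegral_map hΨ.lintegral_prod_right' hα'
    _ = _ := by
        refine lintegral_congr fun ω => ?_
        exact lintegral_map (f := fun w => Ψ (α ω, w)) (hΨ.comp measurable_prodMk_left) hsc

lemma DiffusionAssumption.continuous_act_uncurry (hσ : DiffusionAssumption σ lo hi L₀) :
    Continuous fun p : E d × E m => act (σ p.1) p.2 := by
  unfold act
  exact (PiLp.continuous_toLp 2 _).comp ((hσ.continuous.comp continuous_fst).matrix_mulVec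
    ((PiLp.continuous_ofLp 2 _).comp continuous_snd))

lemma measurable_emGrid (hW : ∀ t, Measurable[𝓕 t] (W t)) (hb : Measurable b)
    (hσ : DiffusionAssumption σ lo hi L₀) (k : ℕ) :
    Measurable[𝓕 ((k : ℕ) * δ)] fun ω => emGrid b σ x δ (fun s => W s ω) k := by
  induction k with
  | zero => exact measurable_const
  | succ k ih =>
    have hle : ((k : ℕ) : ℝ≥0) * δ ≤ ((k + 1 : ℕ) : ℝ≥0) * δ := by
      gcongr
      exact k.le_succ
    have h1 := ih.mono (𝓕.mono hle) le_rfl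
    have h2 := (hW ((k : ℕ) * δ)).mono (𝓕.mono hle) le_rfl
    have h3 := hW ((k + 1 : ℕ) * δ)
    have h4 := hσ.continuous_act_uncurry.measurable.comp (h1.prodMk (h3.sub h2))
    exact (h1.add ((hb.comp h1).const_smul (δ : ℝ))).add h4

lemma emGrid_mul_le {k : ℕ} {t : ℝ≥0} (hδ : 0 < δ) : k ≤ ⌊t / δ⌋₊ ↔ (k : ℝ≥0) * δ ≤ t := by
  rw [Nat.le_floor_iff (zero_le), le_div_iff₀ hδ]

lemma measurable_emPath (hW : ∀ t, Measurable[𝓕 t] (W t)) (hb : Measurable b)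
    (hσ : DiffusionAssumption σ lo hi L₀) (hδ : 0 < δ) (t : ℝ≥0) :
    Measurable[𝓕 t] fun ω => emPath b σ x δ (fun s => W s ω) t := by
  have hle := (emGrid_mul_le (t := t) hδ).1 le_rfl
  have h1 := (measurable_emGrid (x := x) (δ := δ) hW hb hσ ⌊t / δ⌋₊).mono (𝓕.mono hle) le_rfl
  have h2 := (hW ((⌊t / δ⌋₊ : ℕ) * δ)).mono (𝓕.mono hle) le_rfl
  have h4 := hσ.continuous_act_uncurry.measurable.comp (h1.prodMk ((hW t).sub h2))
  exact (h1.add ((hb.comp h1).const_smul ((t : ℝ) - (⌊t / δ⌋₊ : ℝ) * δ))).add h4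

lemma act_zero (A : Matrix (Fin d) (Fin m) ℝ) : act A 0 = 0 := by simp [act]

lemma emPath_mul (hδ : 0 < δ) (w : ℝ≥0 → E m) (k : ℕ) :
    emPath b σ x δ w (k * δ) = emGrid b σ x δ w k := by
  have h : ⌊(k : ℝ≥0) * δ / δ⌋₊ = k := by
    rw [mul_div_cancel_right₀ _ hδ.ne', Nat.floor_natCast]
  simp [emPath, h, act_zero]

/-- The scheme on the closed interval between two grid points. -/
lemma emPath_eq (hδ : 0 < δ) (w : ℝ≥0 → E m) {k : ℕ} {t : ℝ≥0} (h1 : (k : ℝ≥0) * δ ≤ t)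
    (h2 : t ≤ ((k + 1 : ℕ) : ℝ≥0) * δ) :
    emPath b σ x δ w t = emGrid b σ x δ w k + ((t : ℝ) - k * δ) • b (emGrid b σ x δ w k) +
      act (σ (emGrid b σ x δ w k)) (w t - w (k * δ)) := by
  rcases h2.eq_or_lt with rfl | h3
  · rw [emPath_mul hδ, emGrid]
    congr 3
    push_cast
    ring
  · have h : ⌊t / δ⌋₊ = k := by
      refine le_antisymm ?_ ((emGrid_mul_le hδ).2 h1)
      rw [← Nat.lt_succ_iff, Nat.floor_lt (zero_le), div_lt_iff₀ hδ]
      exact h3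
    simp only [emPath, h]

/-- A restart at an off-grid time keeps the coefficients of the last grid point, so the position at
`s` alone does not determine the step. -/
lemma emPath_eq_add (hδ : 0 < δ) (w : ℝ≥0 → E m) {k : ℕ} {s t : ℝ≥0} (h1 : (k : ℝ≥0) * δ ≤ s)
    (hst : s ≤ t) (h2 : t ≤ ((k + 1 : ℕ) : ℝ≥0) * δ) :
    emPath b σ x δ w t = emPath b σ x δ w s + ((t : ℝ) - s) • b (emGrid b σ x δ w k) +
      act (σ (emGrid b σ x δ w k)) (w t - w s) := by
  rw [emPath_eq hδ w h1 (hst.trans h2), emPath_eq hδ w (h1.trans hst) h2]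
  have e1 : w t - w (k * δ) = (w t - w s) + (w s - w (k * δ)) := by abel
  have e2 : (t : ℝ) - k * δ = ((t : ℝ) - s) + (s - k * δ) := by ring
  rw [e1, e2, act_add, add_smul]
  abel

/-- The law of the scheme at time `t` given the past up to time `s`, within one grid interval. -/
lemma lintegral_emPath_step (hW : IsBrownian W 𝓕 P) (hb : Measurable b)
    (hσ : DiffusionAssumption σ lo hi L₀) (hδ : 0 < δ) {k : ℕ} {s t : ℝ≥0}
    (h1 : (k : ℝ≥0) * δ ≤ s) (hst : s ≤ t) (h2 : t ≤ ((k + 1 : ℕ) : ℝ≥0) * δ)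
    {H : Ω → ℝ≥0∞} (hH : Measurable[𝓕 s] H) {ψ : E d → ℝ≥0∞} (hψ : Measurable ψ) :
    ∫⁻ ω, H ω * ψ (emPath b σ x δ (fun r => W r ω) t) ∂P =
      ∫⁻ ω, H ω * ∫⁻ ζ, ψ (emPath b σ x δ (fun r => W r ω) s +
        ((t : ℝ) - s) • b (emGrid b σ x δ (fun r => W r ω) k) +
        act (Real.sqrt ((t : ℝ) - s) • σ (emGrid b σ x δ (fun r => W r ω) k)) ζ)
          ∂(stdGaussian (E m)) ∂P := by
  have hX := measurable_emPath (x := x) hW.adapted hb hσ hδ s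
  have hg := (measurable_emGrid (x := x) (δ := δ) hW.adapted hb hσ k).mono (𝓕.mono h1) le_rfl
  set Ψ : (ℝ≥0∞ × E d × E d) × E m → ℝ≥0∞ := fun p =>
    p.1.1 * ψ (p.1.2.1 + ((t : ℝ) - s) • b p.1.2.2 + act (σ p.1.2.2) p.2) with hΨ
  have hΨm : Measurable Ψ := by
    have m1 : Measurable fun p : (ℝ≥0∞ × E d × E d) × E m => b p.1.2.2 := hb.comp (by fun_prop)
    have m2 : Measurable fun p : (ℝ≥0∞ × E d × E d) × E m => act (σ p.1.2.2) p.2 :=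
      hσ.continuous_act_uncurry.measurable.comp
        (g := fun p : E d × E m => act (σ p.1) p.2)
        (f := fun p : (ℝ≥0∞ × E d × E d) × E m => (p.1.2.2, p.2)) (by fun_prop)
    exact Measurable.mul (by fun_prop) (hψ.comp (by fun_prop))
  have h := hW.lintegral_increment hst (hH.prodMk (hX.prodMk hg)) hΨm
  calc _ = ∫⁻ ω, Ψ ((H ω, emPath b σ x δ (fun r => W r ω) s,
        emGrid b σ x δ (fun r => W r ω) k), W t ω - W s ω) ∂P := by
        refine lintegral_congr fun ω => ?_
        simp only [hΨ]
        rw [emPath_eq_add hδ _ h1 hst h2]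
    _ = _ := h
    _ = _ := by
        refine lintegral_congr fun ω => ?_
        simp only [hΨ]
        rw [lintegral_const_mul]
        · congr 1
          refine lintegral_congr fun ζ => ?_
          rw [act_smul, smul_act]
        · exact hψ.comp (Continuous.measurable (by fun_prop))

lemma measurable_emStep (hb : Measurable b) (hσ : DiffusionAssumption σ lo hi L₀) (r : ℝ)
    {ψ : E d → ℝ≥0∞} (hψ : Measurable ψ) : Measurable (emStep b σ r ψ) := by
  refine Measurable.lintegral_prod_right'
    (f := fun p : E d × E m => ψ (p.1 + r • b p.1 + act (Real.sqrt r • σ p.1) p.2)) ?_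
  have m1 : Measurable fun p : E d × E m => b p.1 := hb.comp measurable_fst
  have m2 : Measurable fun p : E d × E m => act (Real.sqrt r • σ p.1) p.2 := by
    simp_rw [smul_act]
    exact hσ.continuous_act_uncurry.measurable.const_smul (Real.sqrt r)
  exact hψ.comp (by fun_prop)

/-- The density bound of the scheme within one grid interval. -/
lemma lintegral_emPath_le_of_le_grid (hW : IsBrownian W 𝓕 P) (hd : 0 < d) (hb : Measurable b)
    (hbB : ∀ x, ‖b x‖ ≤ B) (hσ : DiffusionAssumption σ lo hi L₀) (hδ : 0 < δ) (hδ1 : δ < 1)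
    {k : ℕ} {s t : ℝ≥0} (h1 : (k : ℝ≥0) * δ ≤ s) (hst : s < t)
    (h2 : t ≤ ((k + 1 : ℕ) : ℝ≥0) * δ)
    {H : Ω → ℝ≥0∞} (hH : Measurable[𝓕 s] H) {ψ : E d → ℝ≥0∞} (hψ : Measurable ψ) :
    ∫⁻ ω, H ω * ψ (emPath b σ x δ (fun r => W r ω) t) ∂P ≤
      ENNReal.ofReal (Real.exp (B ^ 2 / (2 * hi)) * kapRatio d lo hi) *
        ∫⁻ ω, H ω * ∫⁻ y, ψ y * ENNReal.ofReal (isoDens (kap d hi * ((t : ℝ) - s))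
          (y - emPath b σ x δ (fun r => W r ω) s)) ∂volume ∂P := by
  have hlo := hσ.lo_pos
  have hhi := hσ.hi_pos
  have hr : 0 < (t : ℝ) - s := sub_pos.2 hst
  -- Through `δ < 1` the factor `exp (B² r / (2 hi))` is bounded independently of the step size.
  have hr1 : (t : ℝ) - s ≤ 1 := by
    have e1 : (k : ℝ) * δ ≤ s := by exact_mod_cast h1
    have e2 : (t : ℝ) ≤ ((k : ℝ) + 1) * δ := by
      have : (t : ℝ) ≤ ((k + 1 : ℕ) : ℝ) * δ := by exact_mod_cast h2
      simpa using this
    have e3 : (δ : ℝ) < 1 := by exact_mod_cast hδ1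
    linarith
  set r := (t : ℝ) - s with hrdef
  rw [lintegral_emPath_step hW hb hσ hδ h1 hst.le h2 hH hψ,
    ← lintegral_const_mul' _ _ ENNReal.ofReal_ne_top]
  refine lintegral_mono fun ω => ?_
  simp only
  set g := emGrid b σ x δ (fun r => W r ω) k
  set z := emPath b σ x δ (fun r => W r ω) s
  rw [mul_left_comm]
  refine mul_le_mul_right ?_ _
  have h := sqrt_smul_mul_transpose (σ g) hr.le
  have hell := (hσ.elliptic g).smul hr.le
  have hell' : Elliptic (r • (σ g * (σ g)ᵀ)) (lo * r) (hi * r) := by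
    rwa [mul_comm, mul_comm hi]
  have hell2 := hell
  rw [← h] at hell2
  rw [lintegral_stdGaussian_act hell2 (by positivity) _ hψ,
    ← lintegral_const_mul' _ _ ENNReal.ofReal_ne_top]
  refine lintegral_mono fun y => ?_
  simp only
  rw [mul_left_comm, h, ← ENNReal.ofReal_mul (by
    have := kapRatio_pos d hlo hhi
    positivity)]
  refine mul_le_mul_right (ENNReal.ofReal_le_ofReal ?_) _
  have hfin := hell'.gaussDens_sub_le_isoDens hd hlo hhi hr (y - z) (b g) (hbB g)
  rw [sub_sub] at hfin
  refine hfin.trans ?_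
  have := kapRatio_pos d hlo hhi
  have := isoDens_nonneg (kap d hi * r) (y - z)
  gcongr
  exact mul_le_of_le_one_right (sq_nonneg _) hr1

/-- The constant in the Gaussian domination of the law of the scheme. -/
def densConst (d : ℕ) (T B L₀ lo hi : ℝ) : ℝ :=
  Real.exp (B ^ 2 / (2 * hi)) * kapRatio d lo hi *
    (kapRatio d lo hi * mlSeries (stepConst d T B L₀ lo hi) T)

lemma lintegral_isoDens_comp {v v' : ℝ} (hv : 0 < v) (hv' : 0 < v') {ψ : E d → ℝ≥0∞}
    (hψ : Measurable ψ) (x : E d) :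
    ∫⁻ z, (∫⁻ y, ψ y * ENNReal.ofReal (isoDens v' (y - z))) * ENNReal.ofReal (isoDens v (z - x)) =
      ∫⁻ y, ψ y * ENNReal.ofReal (isoDens (v + v') (y - x)) := by
  have hmeas : Measurable (Function.uncurry fun (z y : E d) =>
      ψ y * (ENNReal.ofReal (isoDens v (z - x)) * ENNReal.ofReal (isoDens v' (y - z)))) := by
    simp only [Function.uncurry_def]
    exact (hψ.comp measurable_snd).mul (by fun_prop)
  calc _ = ∫⁻ z, ∫⁻ y, ψ y *
        (ENNReal.ofReal (isoDens v (z - x)) * ENNReal.ofReal (isoDens v' (y - z))) := by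
        refine lintegral_congr fun z => ?_
        rw [← lintegral_mul_const' _ _ ENNReal.ofReal_ne_top]
        refine lintegral_congr fun y => ?_
        ring
    _ = ∫⁻ y, ∫⁻ z, ψ y *
        (ENNReal.ofReal (isoDens v (z - x)) * ENNReal.ofReal (isoDens v' (y - z))) :=
        lintegral_lintegral_swap hmeas.aemeasurable
    _ = _ := by
        refine lintegral_congr fun y => ?_
        rw [lintegral_const_mul _ (by fun_prop), lintegral_isoDens_mul_isoDens hv hv']

/-- Gaussian domination of the law of the scheme at time `u` given the past up to time `s`. -/
theorem lintegral_emPath_le (hW : IsBrownian W 𝓕 P) (hd : 0 < d) (hb : Measurable b)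
    (hbB : ∀ x, ‖b x‖ ≤ B) (hσ : DiffusionAssumption σ lo hi L₀) (hδ : 0 < δ) (hδ1 : δ < 1)
    {T : ℝ} {s u : ℝ≥0} (hsu : s < u) (huT : (u : ℝ) ≤ T)
    {H : Ω → ℝ≥0∞} (hH : Measurable[𝓕 s] H) {ψ : E d → ℝ≥0∞} (hψ : Measurable ψ) :
    ∫⁻ ω, H ω * ψ (emPath b σ x δ (fun r => W r ω) u) ∂P ≤
      ENNReal.ofReal (densConst d T B L₀ lo hi) *
        ∫⁻ ω, H ω * ∫⁻ y, ψ y * ENNReal.ofReal (isoDens (kap d hi * ((u : ℝ) - s))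
          (y - emPath b σ x δ (fun r => W r ω) s)) ∂volume ∂P := by
  have hlo := hσ.lo_pos
  have hhi := hσ.hi_pos
  have hk := kap_pos d hhi
  have hB : 0 ≤ B := (norm_nonneg _).trans (hbB 0)
  have hrat := one_le_kapRatio (d := d) hlo (hσ.lo_le_hi hd)
  have hc'0 : 0 ≤ stepConst d T B L₀ lo hi := stepConst_nonneg d hB hσ.L_pos.le hlo hhi
  have hml := one_le_mlSeries hc'0 T
  obtain ⟨k, hk1, hk2⟩ : ∃ k : ℕ, (k : ℝ≥0) * δ ≤ s ∧ s < ((k + 1 : ℕ) : ℝ≥0) * δ := by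
    refine ⟨⌊s / δ⌋₊, (emGrid_mul_le hδ).1 le_rfl, ?_⟩
    rw [← div_lt_iff₀ hδ]
    exact_mod_cast Nat.lt_floor_add_one (s / δ)
  -- On `[s, t₁]` the coefficients come from a grid time that may precede `s`; the chain, whose
  -- steps see only the current position, can start at `t₁`.
  set t₁ : ℝ≥0 := ((k + 1 : ℕ) : ℝ≥0) * δ with ht₁
  rcases le_or_gt u t₁ with hu | hu
  · refine (lintegral_emPath_le_of_le_grid hW hd hb hbB hσ hδ hδ1 hk1 hsu hu hH hψ).trans ?_
    refine mul_le_mul_left (ENNReal.ofReal_le_ofReal ?_) _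
    rw [densConst]
    refine le_mul_of_one_le_right (by positivity) ?_
    exact one_le_mul_of_one_le_of_one_le hrat hml
  -- `M` full grid steps fit between `t₁` and `u`. The ceiling makes the first inequality strict, so
  -- that the final step up to `u` has positive length.
  obtain ⟨M, hM1, hM2⟩ : ∃ M : ℕ, ((k + 1 + M : ℕ) : ℝ≥0) * δ < u ∧
      u ≤ ((k + 1 + (M + 1) : ℕ) : ℝ≥0) * δ := by
    have hc : k + 1 < ⌈u / δ⌉₊ := by
      rw [Nat.lt_ceil, lt_div_iff₀ hδ]
      exact hu
    refine ⟨⌈u / δ⌉₊ - 1 - (k + 1), ?_, ?_⟩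
    · have : k + 1 + (⌈u / δ⌉₊ - 1 - (k + 1)) = ⌈u / δ⌉₊ - 1 := by omega
      rw [this, ← lt_div_iff₀ hδ, ← Nat.lt_ceil]
      omega
    · have : k + 1 + (⌈u / δ⌉₊ - 1 - (k + 1) + 1) = ⌈u / δ⌉₊ := by omega
      rw [this, ← div_le_iff₀ hδ]
      exact Nat.le_ceil _
  -- Grid times from `t₁` on, followed by `u` at index `M + 1`. Later values only keep `θ` strictly
  -- increasing on all of `ℕ`.
  set θ : ℕ → ℝ≥0 := fun j => if j ≤ M then ((k + 1 + j : ℕ) : ℝ≥0) * δ else u + (j - (M + 1) : ℕ)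
    with hθ
  have hθle : ∀ j ≤ M, θ j = ((k + 1 + j : ℕ) : ℝ≥0) * δ := fun j hj => by simp [hθ, hj]
  have hθM : θ (M + 1) = u := by simp [hθ]
  have hθ0 : θ 0 = t₁ := by simp [hθ, ht₁]
  have hθmono : StrictMono θ := by
    refine strictMono_nat_of_lt_succ fun j => ?_
    rcases lt_trichotomy j M with hj | rfl | hj
    · rw [hθle j hj.le, hθle (j + 1) hj]
      have : ((k + 1 + j : ℕ) : ℝ≥0) < ((k + 1 + (j + 1) : ℕ) : ℝ≥0) := by
        exact_mod_cast (by omega : k + 1 + j < k + 1 + (j + 1))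
      exact mul_lt_mul_of_pos_right this hδ
    · rw [hθle j le_rfl, hθM]
      exact hM1
    · have e1 : θ j = u + (j - (M + 1) : ℕ) := by simp [hθ, not_le.2 hj]
      have e2 : θ (j + 1) = u + (j + 1 - (M + 1) : ℕ) := by
        simp only [hθ, if_neg (not_le.2 (hj.trans j.lt_succ_self))]
      rw [e1, e2]
      have : ((j - (M + 1) : ℕ) : ℝ≥0) < ((j + 1 - (M + 1) : ℕ) : ℝ≥0) := by
        exact_mod_cast (by omega : j - (M + 1) < j + 1 - (M + 1))
      gcongr
  have hθstep : ∀ j < M + 1, θ (j + 1) ≤ ((k + 1 + j + 1 : ℕ) : ℝ≥0) * δ := fun j hj => by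
    rcases (Nat.lt_succ_iff.1 hj).eq_or_lt with rfl | hj'
    · rw [hθM]; exact hM2
    · rw [hθle (j + 1) hj']
      exact le_of_eq rfl
  set X : ℝ≥0 → Ω → E d := fun t ω => emPath b σ x δ (fun r => W r ω) t with hX
  have hXm : ∀ t, Measurable (X t) := fun t =>
    (measurable_emPath (x := x) hW.adapted hb hσ hδ t).mono (𝓕.le t) le_rfl
  have hHm : Measurable H := hH.mono (𝓕.le s) le_rfl
  -- The weight is absorbed into the measure, so the chain bound needs no separate conditional form.
  set μ : ℕ → Measure (E d) := fun j => (P.withDensity H).map (X (θ j)) with hμ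
  have hμint : ∀ j (φ : E d → ℝ≥0∞), Measurable φ →
      ∫⁻ z, φ z ∂(μ j) = ∫⁻ ω, H ω * φ (X (θ j) ω) ∂P := fun j φ hφ => by
    rw [hμ]
    simp only
    rw [lintegral_map hφ (hXm _)]
    exact lintegral_withDensity_eq_lintegral_mul _ hHm (hφ.comp (hXm _))
  set τ : ℕ → ℝ := fun j => (θ j : ℝ) - θ 0 with hτ
  have hτmono : StrictMono τ := fun i j hij => by
    have : (θ i : ℝ) < θ j := by exact_mod_cast hθmono hij
    simp only [hτ]
    linarith
  have hτM : τ (M + 1) = u - t₁ := by simp only [hτ, hθM, hθ0]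
  have hstep : ∀ j < M + 1, ∀ φ : E d → ℝ≥0∞, Measurable φ →
      ∫⁻ z, φ z ∂(μ (j + 1)) = ∫⁻ z, emStep b σ (τ (j + 1) - τ j) φ z ∂(μ j) := by
    intro j hj φ hφ
    have hj' := hθle j (by omega)
    have hHj : Measurable[𝓕 (θ j)] H := hH.mono (𝓕.mono (by
      refine hk2.le.trans ?_
      rw [← hθ0]
      exact hθmono.monotone (Nat.zero_le _))) le_rfl
    have hτj : τ (j + 1) - τ j = (θ (j + 1) : ℝ) - θ j := by simp only [hτ]; ring
    rw [hμint _ _ hφ, hμint _ _ (measurable_emStep hb hσ _ hφ), hτj,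
      lintegral_emPath_step hW hb hσ hδ hj'.ge (hθmono j.lt_succ_self).le (hθstep j hj) hHj hφ]
    refine lintegral_congr fun ω => ?_
    have hXg : emPath b σ x δ (fun r => W r ω) (θ j) =
        emGrid b σ x δ (fun r => W r ω) (k + 1 + j) := by
      rw [hj', emPath_mul hδ]
    simp only [emStep, hX]
    rw [hXg]
  have hchain := lintegral_chain_le (μ := μ) (τ := τ) (M := M + 1) (T := T) hd hb hbB hσ hτmono
    (by simp [hτ]) (by
      rw [hτM]
      have : (0 : ℝ) ≤ t₁ := t₁.2
      linarith) hstep (M + 1) M.succ_pos le_rfl ψ hψ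
  have hτ0 : 0 < τ (M + 1) := by
    rw [hτM]
    exact sub_pos.2 (by exact_mod_cast hu)
  rw [hμint _ _ hψ, hθM] at hchain
  refine hchain.trans ?_
  set v' := kap d hi * τ (M + 1) with hv'
  have hv'0 : 0 < v' := by positivity
  set ψ₁ : E d → ℝ≥0∞ := fun z => ∫⁻ y, ψ y * ENNReal.ofReal (isoDens v' (y - z)) with hψ₁
  have hmeas : Measurable (Function.uncurry fun (z y : E d) =>
      ψ y * ENNReal.ofReal (isoDens v' (y - z))) := by
    simp only [Function.uncurry_def]
    exact (hψ.comp measurable_snd).mul (by fun_prop)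
  have hψ₁m : Measurable ψ₁ := hmeas.lintegral_prod_right'
  have hswap : ∫⁻ y, ψ y * ∫⁻ z, ENNReal.ofReal (isoDens v' (y - z)) ∂(μ 0) =
      ∫⁻ ω, H ω * ψ₁ (X t₁ ω) ∂P := by
    rw [← hθ0, ← hμint 0 ψ₁ hψ₁m, hψ₁, lintegral_lintegral_swap hmeas.aemeasurable]
    refine lintegral_congr fun y => ?_
    rw [lintegral_const_mul _ (by fun_prop)]
  rw [hswap]
  have hfirst := lintegral_emPath_le_of_le_grid (x := x) hW hd hb hbB hσ hδ hδ1 hk1 hk2 le_rfl hH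
    hψ₁m
  have hs1 : 0 < (t₁ : ℝ) - s := sub_pos.2 (by exact_mod_cast hk2)
  refine (mul_le_mul_right hfirst _).trans ?_
  rw [← mul_assoc, ← ENNReal.ofReal_mul (mul_nonneg (by positivity)
    (zero_le_one.trans (one_le_mlSeries hc'0 _)))]
  refine mul_le_mul' (ENNReal.ofReal_le_ofReal ?_) (le_of_eq ?_)
  · rw [densConst, mul_comm]
    have : mlSeries (stepConst d T B L₀ lo hi) (τ (M + 1)) ≤
        mlSeries (stepConst d T B L₀ lo hi) T := by
      refine mlSeries_mono hc'0 le_rfl ?_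
      rw [hτM]
      have : (0 : ℝ) ≤ t₁ := t₁.2
      linarith
    gcongr
  · refine lintegral_congr fun ω => ?_
    congr 1
    rw [hψ₁, lintegral_isoDens_comp (by positivity) hv'0 hψ]
    have : kap d hi * ((t₁ : ℝ) - s) + v' = kap d hi * ((u : ℝ) - s) := by
      rw [hv', hτM]; ring
    rw [this]

end Scheme

/-! ### Hölder estimates and the Krylov bound. -/

section Krylov

variable {d m : ℕ}

/-- A power of a Gaussian density is a multiple of the Gaussian density of variance `v / r`; hence
the Lebesgue norms of the heat kernel are explicit. -/
lemma isoDens_rpow {v r : ℝ} (hv : 0 < v) (hr : 0 < r) (w : E d) :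
    isoDens v w ^ r = (2 * Real.pi * v) ^ (-((d : ℝ) / 2 * r)) *
      (2 * Real.pi * (v / r)) ^ ((d : ℝ) / 2) * isoDens (v / r) w := by
  have hpi := Real.pi_pos
  have hs : ∀ a : ℝ, 0 < a → (Real.sqrt (a ^ d))⁻¹ = a ^ (-((d : ℝ) / 2)) := fun a ha => by
    rw [Real.sqrt_eq_rpow, ← Real.rpow_natCast, ← Real.rpow_mul ha.le, Real.rpow_neg ha.le]
    congr 2
    ring
  have h1 : 0 < 2 * Real.pi * v := by positivity
  have h2 : 0 < 2 * Real.pi * (v / r) := by positivity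
  have h3 : (2 * Real.pi * (v / r)) ^ ((d : ℝ) / 2) * (2 * Real.pi * (v / r)) ^ (-((d : ℝ) / 2)) = 1 := by
    rw [← Real.rpow_add h2, add_neg_cancel, Real.rpow_zero]
  have h4 : -(‖w‖ ^ 2 / (2 * v)) * r = -(‖w‖ ^ 2 / (2 * (v / r))) := by field_simp
  rw [isoDens, isoDens, hs _ h1, hs _ h2, Real.mul_rpow (by positivity) (Real.exp_pos _).le,
    ← Real.rpow_mul h1.le, ← Real.exp_mul, h4, neg_mul, mul_assoc (_ ^ (-((d : ℝ) / 2 * r))),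
    ← mul_assoc (_ ^ ((d : ℝ) / 2)), h3, one_mul]

lemma lintegral_isoDens_rpow {v r : ℝ} (hv : 0 < v) (hr : 0 < r) (x : E d) :
    ∫⁻ y, ENNReal.ofReal (isoDens v (y - x)) ^ r =
      ENNReal.ofReal ((2 * Real.pi * v) ^ (-((d : ℝ) / 2 * r)) *
        (2 * Real.pi * (v / r)) ^ ((d : ℝ) / 2)) := by
  have hpi := Real.pi_pos
  simp_rw [ENNReal.ofReal_rpow_of_nonneg (isoDens_nonneg _ _) hr.le, isoDens_rpow hv hr]
  have hvr : 0 < v / r := by positivity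
  simp_rw [ENNReal.ofReal_mul (p := (2 * Real.pi * v) ^ (-((d : ℝ) / 2 * r)) *
        (2 * Real.pi * (v / r)) ^ ((d : ℝ) / 2)) (by positivity), isoDens_eq_gaussDens hvr]
  rw [lintegral_const_mul' _ _ ENNReal.ofReal_ne_top,
    lintegral_gaussDens_sub elliptic_smul_one hvr, mul_one]

/-- Hölder's inequality against the heat kernel. -/
lemma lintegral_mul_isoDens_le {v p : ℝ} (hv : 0 < v) (hp : 1 < p) {ψ : E d → ℝ≥0∞}
    (hψ : Measurable ψ) (x : E d) :
    ∫⁻ y, ψ y * ENNReal.ofReal (isoDens v (y - x)) ≤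
      ENNReal.ofReal ((2 * Real.pi * v) ^ (-((d : ℝ) / 2 * (1 / p))) *
        (1 - 1 / p) ^ ((d : ℝ) / 2 * (1 - 1 / p))) * (∫⁻ y, ψ y ^ p) ^ (1 / p) := by
  have hpi := Real.pi_pos
  have hconj := Real.HolderConjugate.conjExponent hp
  set p' := p.conjExponent with hp'
  have hp'0 : 0 < p' := hconj.symm.pos
  have hinv : 1 / p' = 1 - 1 / p := by
    have := hconj.inv_add_inv_eq_one
    rw [one_div, one_div]
    linarith
  have hinv0 : 0 < 1 - 1 / p := by rw [← hinv]; positivity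
  have h := ENNReal.lintegral_mul_le_Lp_mul_Lq volume hconj hψ.aemeasurable
    (show AEMeasurable (fun y => ENNReal.ofReal (isoDens v (y - x))) volume by fun_prop)
  refine (show _ ≤ _ from h).trans (le_of_eq ?_)
  rw [lintegral_isoDens_rpow hv hp'0, ENNReal.ofReal_rpow_of_nonneg (by positivity) (by positivity),
    mul_comm]
  congr 2
  have h2 : 0 < 2 * Real.pi * v := by positivity
  have e1 : 2 * Real.pi * (v / p') = (2 * Real.pi * v) * (1 - 1 / p) := by rw [← hinv]; ring
  rw [e1, Real.mul_rpow h2.le hinv0.le, ← mul_assoc, ← Real.rpow_add h2,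
    Real.mul_rpow (by positivity) (by positivity), ← Real.rpow_mul h2.le, ← Real.rpow_mul hinv0.le,
    hinv]
  congr 2
  have : p' * (1 - 1 / p) = 1 := by rw [← hinv]; field_simp
  linear_combination (-(d : ℝ) / 2) * this

lemma gamma0_inv_pos {p q : ℝ} (hpq : (d : ℝ) / p + 2 / q < 2) :
    0 < 1 - 1 / q - (d : ℝ) / (2 * p) := by
  have h1 : (d : ℝ) / (2 * p) = (d : ℝ) / p / 2 := by rw [div_div, mul_comm]
  have h2 : 1 / q = 2 / q / 2 := by ring
  rw [h1, h2]
  linarith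

lemma gamma0_pos {p q : ℝ} (hpq : (d : ℝ) / p + 2 / q < 2) : 0 < gamma0 d p q :=
  one_div_pos.2 (gamma0_inv_pos hpq)

/-- The time singularity of the heat kernel bound is integrable in `L^{q'}`. -/
lemma lintegral_rpow_sub {p q s t : ℝ} (hq : 1 < q)
    (hpq : (d : ℝ) / p + 2 / q < 2) (hst : s ≤ t) :
    (∫⁻ u in Set.Ioc s t, ENNReal.ofReal ((u - s) ^ (-((d : ℝ) / 2 * (1 / p)))) ^
        q.conjExponent) ^ (1 / q.conjExponent) =
      ENNReal.ofReal ((gamma0 d p q * (1 - 1 / q)) ^ ((q - 1) / q) *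
        (t - s) ^ (1 / gamma0 d p q)) := by
  have hconj := Real.HolderConjugate.conjExponent hq
  set q' := q.conjExponent with hq'
  have hq'0 : 0 < q' := hconj.symm.pos
  have hinv : 1 / q' = 1 - 1 / q := by
    have := hconj.inv_add_inv_eq_one
    rw [one_div, one_div]
    linarith
  have hg := gamma0_inv_pos hpq
  have hγ := gamma0_pos hpq
  set a := (d : ℝ) / 2 * (1 / p) with ha
  have hγa : 1 / gamma0 d p q = 1 / q' - a := by
    rw [gamma0, one_div_one_div, hinv, ha]
    ring
  -- So the integrand below is a power with exponent `q' / γ₀ - 1 > -1`; positivity of `1 / γ₀` is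
  -- exactly `d/p + 2/q < 2`.
  have haq : a * q' = 1 - q' * (1 / gamma0 d p q) := by
    rw [hγa]
    field_simp
    ring
  have hb0 : 0 < q' * (1 / gamma0 d p q) := by positivity
  have hint : ∫⁻ u in Set.Ioc s t, ENNReal.ofReal ((u - s) ^ (-a)) ^ q' =
      ENNReal.ofReal ((t - s) ^ (q' * (1 / gamma0 d p q)) / (q' * (1 / gamma0 d p q))) := by
    have e1 : ∀ u ∈ Set.Ioc s t, ENNReal.ofReal ((u - s) ^ (-a)) ^ q' =
        ENNReal.ofReal ((u - s) ^ (q' * (1 / gamma0 d p q) - 1)) := fun u hu => by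
      have h0 : 0 ≤ u - s := by linarith [hu.1]
      rw [ENNReal.ofReal_rpow_of_nonneg (by positivity) hq'0.le, ← Real.rpow_mul h0]
      congr 2
      linarith
    rw [setLIntegral_congr_fun measurableSet_Ioc e1]
    have hr : -1 < q' * (1 / gamma0 d p q) - 1 := by linarith
    have hii : IntervalIntegrable (fun u => (u - s) ^ (q' * (1 / gamma0 d p q) - 1)) volume s t := by
      have := (intervalIntegral.intervalIntegrable_rpow' (a := 0) (b := t - s) hr).comp_sub_right s
      simpa using this
    rw [← ofReal_integral_eq_lintegral_ofReal
      ((intervalIntegrable_iff_integrableOn_Ioc_of_le hst).1 hii)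
      ((ae_restrict_iff' measurableSet_Ioc).2 (ae_of_all _ fun u hu => by
        have : 0 ≤ u - s := by linarith [hu.1]
        positivity)), ← intervalIntegral.integral_of_le hst,
      intervalIntegral.integral_comp_sub_right
        (fun u => u ^ (q' * (1 / gamma0 d p q) - 1)) s, integral_rpow (Or.inl hr)]
    rw [sub_self, sub_add_cancel, Real.zero_rpow hb0.ne', sub_zero]
  have hts : 0 ≤ t - s := by linarith
  rw [hint, ENNReal.ofReal_rpow_of_nonneg (by positivity) (by positivity),
    Real.div_rpow (by positivity) (by positivity), ← Real.rpow_mul hts, div_eq_mul_inv, mul_comm]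
  congr 2
  · rw [← Real.inv_rpow (by positivity)]
    have e1 : (q - 1) / q = 1 / q' := by rw [hinv]; field_simp
    rw [e1, ← hinv]
    congr 1
    field_simp
  · field_simp

/-- The series increases with its constant, and the exponential prefactor of Λ₂ is at least one. -/
lemma mlSeries_le_Lambda2 {T B L₀ lo hi : ℝ} (hd : 0 < d) (hT : 0 ≤ T) (hB : 0 ≤ B) (hL : 0 ≤ L₀)
    (hlo : 0 < lo) (hlohi : lo ≤ hi) :
    mlSeries (stepConst d T B L₀ lo hi) T ≤ Lambda2 d m T B L₀ lo hi := by
  have hhi : 0 < hi := hlo.trans_le hlohi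
  have hc := stepConst_nonneg d (T := T) hB hL hlo hhi
  have h1 := mlSeries_mono hc (stepConst_le (m := m) hd hT hB hL hlo hlohi) (le_refl T)
  have h2 : mlSeries (Lambda1 d m T B L₀ lo hi * ((1 + 24 * (d : ℝ)) * hi / lo) ^ d) T =
      ∑' i : ℕ, (Lambda1 d m T B L₀ lo hi * Real.sqrt (Real.pi * T)
        * ((1 + 24 * (d : ℝ)) * hi / lo) ^ d) ^ i / Real.Gamma (1 + (i : ℝ) / 2) := by
    rw [mlSeries]
    congr 1 with i
    congr 2
    ring
  rw [Lambda2, ← h2]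
  refine h1.trans (le_mul_of_one_le_left (zero_le_one.trans (one_le_mlSeries
    (hc.trans (stepConst_le hd hT hB hL hlo hlohi)) _)) ?_)
  exact Real.one_le_exp (by positivity)

/-- The constants collected by the proof are dominated by `α₀`. -/
lemma densConst_mul_le_alpha0 {T B L₀ lo hi p q : ℝ} (hd : 0 < d) (hT : 0 ≤ T) (hB : 0 ≤ B)
    (hL : 0 ≤ L₀) (hlo : 0 < lo) (hlohi : lo ≤ hi) (hp : 1 < p) (hq : 1 < q)
    (hpq : (d : ℝ) / p + 2 / q < 2) :
    densConst d T B L₀ lo hi * ((2 * Real.pi * kap d hi) ^ (-((d : ℝ) / 2 * (1 / p))) *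
        (1 - 1 / p) ^ ((d : ℝ) / 2 * (1 - 1 / p))) *
      (gamma0 d p q * (1 - 1 / q)) ^ ((q - 1) / q) ≤ alpha0 d m T B L₀ lo hi p q := by
  have hhi : 0 < hi := hlo.trans_le hlohi
  have hk := kap_pos d hhi
  have hpi := Real.pi_pos
  have hγ := gamma0_pos hpq
  have hp1 : 0 < 1 - 1 / p := by
    rw [sub_pos, div_lt_one (by linarith)]; exact hp
  have hq1 : 0 < 1 - 1 / q := by
    rw [sub_pos, div_lt_one (by linarith)]; exact hq
  have hp0 : 0 < p := by linarith
  have hml := mlSeries_le_Lambda2 (m := m) hd hT hB hL hlo hlohi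
  have hml0 : 0 ≤ mlSeries (stepConst d T B L₀ lo hi) T :=
    zero_le_one.trans (one_le_mlSeries (stepConst_nonneg d hB hL hlo hhi) _)
  have hk0 : kappa0 d hi / 2 = 2 * kap d hi := by rw [kappa0, kap]; ring
  have hk1 : kap d hi ≤ kappa0 d hi / 2 := by rw [hk0]; linarith
  have hk2 : kap d hi / lo ≤ kappa0 d hi / (2 * lo) := by
    rw [← div_div]
    exact div_le_div_of_nonneg_right hk1 hlo.le
  set h := (d : ℝ) / 2 with hh
  have hh0 : 0 ≤ h := by positivity
  set ee := Real.exp (B ^ 2 / (2 * hi)) with hee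
  set G := (gamma0 d p q * (1 - 1 / q)) ^ ((q - 1) / q) with hG
  set Q := (1 - 1 / p) ^ (h * (1 - 1 / p)) with hQ
  set ML := mlSeries (stepConst d T B L₀ lo hi) T with hML
  have hee0 : 0 < ee := Real.exp_pos _
  have hG0 : 0 ≤ G := by positivity
  have hQ0 : 0 ≤ Q := by positivity
  -- Of the two factors `(kap / lo) ^ (d/2)`, one goes into Λ₃. The other, combined with `kap ^
  -- (-d/(2p))` from Hölder's inequality, becomes `kap ^ (d/2 (1 - 1/p)) / lo ^ (d/2)`.
  have hrat : kapRatio d lo hi * kapRatio d lo hi = (kap d hi / lo) ^ h * (kap d hi / lo) ^ h := by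
    rw [kapRatio, Real.mul_self_sqrt (by positivity), ← Real.rpow_add (by positivity),
      ← Real.rpow_natCast]
    congr 1
    rw [hh]; ring
  have hΛ3 : ML * ee * (kap d hi / lo) ^ h ≤ Lambda3 d m T B L₀ lo hi := by
    rw [Lambda3]
    have : 0 ≤ Lambda2 d m T B L₀ lo hi := hml0.trans hml
    gcongr
  have hΛ30 : 0 ≤ ML * ee * (kap d hi / lo) ^ h := by positivity
  have hlow : Q / (lo * (2 * Real.pi) ^ (1 / p)) ^ h *
      (ML * ee * (kap d hi / lo) ^ h * G * kap d hi ^ (h * (1 - 1 / p))) ≤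
      alpha0 d m T B L₀ lo hi p q := by
    rw [alpha0]
    refine mul_le_mul_of_nonneg_left ?_ (by positivity)
    have e1 : ML * ee * (kap d hi / lo) ^ h * G * kap d hi ^ (h * (1 - 1 / p)) ≤
        Lambda3 d m T B L₀ lo hi * G * (kappa0 d hi / 2) ^ (h * (1 - 1 / p)) := by
      have : 0 ≤ Lambda3 d m T B L₀ lo hi := hΛ30.trans hΛ3
      gcongr
    have e2 : 0 ≤ hi ^ (h * (1 - 1 / p)) := by positivity
    linarith
  refine le_trans (le_of_eq ?_) hlow
  rw [densConst, Real.mul_rpow hlo.le (by positivity), ← Real.rpow_mul (by positivity),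
    Real.mul_rpow (by positivity) hk.le, mul_sub, mul_one, Real.rpow_sub hk,
    Real.rpow_neg (by positivity), Real.rpow_neg hk.le]
  have e3 : 1 / p * h = h * (1 / p) := mul_comm _ _
  rw [e3]
  calc _ = (kapRatio d lo hi * kapRatio d lo hi) * (ee * ML *
      (((2 * Real.pi) ^ (h * (1 / p)))⁻¹ * (kap d hi ^ (h * (1 / p)))⁻¹ * Q) * G) := by
        rw [hML]; ring
    _ = (kap d hi / lo) ^ h * (kap d hi ^ h / lo ^ h) * (ee * ML *
      (((2 * Real.pi) ^ (h * (1 / p)))⁻¹ * (kap d hi ^ (h * (1 / p)))⁻¹ * Q) * G) := by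
        rw [hrat, Real.div_rpow hk.le hlo.le]
    _ = _ := by
        field_simp

variable {Ω : Type*} {mΩ : MeasurableSpace Ω} {P : Measure Ω} [IsProbabilityMeasure P]
  {𝓕 : Filtration ℝ≥0 mΩ} {W : ℝ≥0 → Ω → E m}
  {b : E d → E d} {σ : E d → Matrix (Fin d) (Fin m) ℝ} {lo hi L₀ B : ℝ} {x : E d} {δ : ℝ≥0}

/-- The Krylov-type estimate for the scheme, conditionally on the past up to time `s`. -/
theorem lintegral_lintegral_emPath_le (hW : IsBrownian W 𝓕 P) (hd : 0 < d) (hb : Measurable b)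
    (hbB : ∀ x, ‖b x‖ ≤ B) (hσ : DiffusionAssumption σ lo hi L₀) (hδ : 0 < δ) (hδ1 : δ < 1)
    {p q : ℝ} (hp : 1 < p) (hq : 1 < q) (hpq : (d : ℝ) / p + 2 / q < 2)
    {s t T : ℝ} (hs : 0 ≤ s) (hst : s ≤ t) (htT : t ≤ T)
    {H : Ω → ℝ≥0∞} (hH : Measurable[𝓕 s.toNNReal] H)
    {φ : ℝ → E d → ℝ≥0∞} (hφ : Measurable (Function.uncurry φ)) :
    ∫⁻ u in Set.Ioc s t, ∫⁻ ω, H ω * φ u (emPath b σ x δ (fun r => W r ω) u.toNNReal) ∂P ≤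
      ENNReal.ofReal (alpha0 d m T B L₀ lo hi p q * (t - s) ^ (1 / gamma0 d p q)) *
        (∫⁻ u in Set.Icc 0 T, (∫⁻ y, φ u y ^ p) ^ (q / p)) ^ (1 / q) * ∫⁻ ω, H ω ∂P := by
  have hlo := hσ.lo_pos
  have hhi := hσ.hi_pos
  have hlohi := hσ.lo_le_hi hd
  have hk := kap_pos d hhi
  have hpi := Real.pi_pos
  have hB : 0 ≤ B := (norm_nonneg _).trans (hbB 0)
  have hT : 0 ≤ T := by linarith
  have hγ := gamma0_pos hpq
  have hp1 : 0 < 1 - 1 / p := by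
    rw [sub_pos, div_lt_one (by linarith)]; exact hp
  have hq1 : 0 < 1 - 1 / q := by
    rw [sub_pos, div_lt_one (by linarith)]; exact hq
  have hq0 : 0 < q := by linarith
  have hp0 : 0 < p := by linarith
  have hD0 : 0 ≤ densConst d T B L₀ lo hi := by
    have h1 := kapRatio_pos d hlo hhi
    have h2 := one_le_mlSeries (stepConst_nonneg d (T := T) hB hσ.L_pos.le hlo hhi) T
    unfold densConst
    positivity
  set C₁ := (2 * Real.pi * kap d hi) ^ (-((d : ℝ) / 2 * (1 / p))) *
    (1 - 1 / p) ^ ((d : ℝ) / 2 * (1 - 1 / p)) with hC₁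
  have hC₁0 : 0 ≤ C₁ := by positivity
  set D := densConst d T B L₀ lo hi with hD
  set N : ℝ → ℝ≥0∞ := fun u => (∫⁻ y, φ u y ^ p) ^ (1 / p) with hN
  have hNm : Measurable N := by
    have h1 : Measurable fun z : ℝ × E d => φ z.1 z.2 ^ p := hφ.pow_const p
    exact (h1.lintegral_prod_right').pow_const _
  have hpt : ∀ u ∈ Set.Ioc s t,
      ∫⁻ ω, H ω * φ u (emPath b σ x δ (fun r => W r ω) u.toNNReal) ∂P ≤
        ENNReal.ofReal (D * C₁) * (∫⁻ ω, H ω ∂P) *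
          (ENNReal.ofReal ((u - s) ^ (-((d : ℝ) / 2 * (1 / p)))) * N u) := by
    intro u hu
    have hu0 : 0 ≤ u := hs.trans hu.1.le
    have hus : 0 < u - s := sub_pos.2 hu.1
    have hφu : Measurable (φ u) := hφ.comp measurable_prodMk_left
    have h1 := lintegral_emPath_le (x := x) (T := T) hW hd hb hbB hσ hδ hδ1
      (s := s.toNNReal) (u := u.toNNReal)
      ((Real.toNNReal_lt_toNNReal_iff (hs.trans_lt hu.1)).2 hu.1)
      (by rw [Real.coe_toNNReal _ hu0]; exact hu.2.trans htT) hH hφu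
    rw [Real.coe_toNNReal _ hu0, Real.coe_toNNReal _ hs] at h1
    refine h1.trans ?_
    have h2 : ∀ ω, H ω * ∫⁻ y, φ u y * ENNReal.ofReal (isoDens (kap d hi * (u - s))
          (y - emPath b σ x δ (fun r => W r ω) s.toNNReal)) ≤
        H ω * (ENNReal.ofReal (C₁ * (u - s) ^ (-((d : ℝ) / 2 * (1 / p)))) * N u) := fun ω => by
      refine mul_le_mul_right ?_ _
      refine (lintegral_mul_isoDens_le (by positivity) hp hφu _).trans (le_of_eq ?_)
      congr 2
      rw [hC₁, ← mul_assoc, Real.mul_rpow (by positivity) hus.le]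
      ring
    refine (mul_le_mul_right (lintegral_mono h2) _).trans (le_of_eq ?_)
    have hHm : Measurable H := hH.mono (𝓕.le _) le_rfl
    rw [lintegral_mul_const _ hHm, ENNReal.ofReal_mul hD0, ENNReal.ofReal_mul hC₁0]
    ring
  have hconj := Real.HolderConjugate.conjExponent hq
  have hhol := ENNReal.lintegral_mul_le_Lp_mul_Lq (volume.restrict (Set.Ioc s t)) hconj.symm
    (f := fun u => ENNReal.ofReal ((u - s) ^ (-((d : ℝ) / 2 * (1 / p))))) (g := N)
    (by fun_prop) hNm.aemeasurable
  rw [lintegral_rpow_sub hq hpq hst] at hhol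
  have hNq : (∫⁻ u in Set.Ioc s t, N u ^ q) ^ (1 / q) ≤
      (∫⁻ u in Set.Icc 0 T, (∫⁻ y, φ u y ^ p) ^ (q / p)) ^ (1 / q) := by
    refine ENNReal.rpow_le_rpow ?_ (by positivity)
    have e : ∀ u, N u ^ q = (∫⁻ y, φ u y ^ p) ^ (q / p) := fun u => by
      rw [hN, ← ENNReal.rpow_mul]
      congr 1
      ring
    simp_rw [e]
    exact lintegral_mono_set fun u hu => ⟨hs.trans hu.1.le, hu.2.trans htT⟩
  have hconst := densConst_mul_le_alpha0 (m := m) hd hT hB hσ.L_pos.le hlo hlohi hp hq hpq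
  rw [← hC₁, ← hD] at hconst
  set G := (gamma0 d p q * (1 - 1 / q)) ^ ((q - 1) / q) with hG
  have hts : 0 ≤ t - s := sub_nonneg.2 hst
  calc _ ≤ ∫⁻ u in Set.Ioc s t, ENNReal.ofReal (D * C₁) * (∫⁻ ω, H ω ∂P) *
          (ENNReal.ofReal ((u - s) ^ (-((d : ℝ) / 2 * (1 / p)))) * N u) :=
        setLIntegral_mono' measurableSet_Ioc hpt
    _ = ENNReal.ofReal (D * C₁) * (∫⁻ ω, H ω ∂P) * ∫⁻ u in Set.Ioc s t,
          (ENNReal.ofReal ((u - s) ^ (-((d : ℝ) / 2 * (1 / p)))) * N u) :=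
        lintegral_const_mul _ (by fun_prop)
    _ ≤ ENNReal.ofReal (D * C₁) * (∫⁻ ω, H ω ∂P) *
        (ENNReal.ofReal (G * (t - s) ^ (1 / gamma0 d p q)) *
          (∫⁻ u in Set.Icc 0 T, (∫⁻ y, φ u y ^ p) ^ (q / p)) ^ (1 / q)) := by
        refine mul_le_mul_right ((show _ ≤ _ from hhol).trans ?_) _
        exact mul_le_mul_right hNq _
    _ = ENNReal.ofReal (D * C₁ * G * (t - s) ^ (1 / gamma0 d p q)) *
          (∫⁻ u in Set.Icc 0 T, (∫⁻ y, φ u y ^ p) ^ (q / p)) ^ (1 / q) * (∫⁻ ω, H ω ∂P) := by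
        rw [mul_assoc (D * C₁), ENNReal.ofReal_mul (p := D * C₁) (by positivity)]
        ring
    _ ≤ _ := by
        refine mul_le_mul_left (mul_le_mul_left (ENNReal.ofReal_le_ofReal ?_) _) _
        exact mul_le_mul_of_nonneg_right hconst (by positivity)

end Krylov

/-! ### Khasminskii's lemma for bounded processes. -/

section Khasminskii

lemma exp_sub_exp_le_mul {a c M : ℝ} (ha : a ≤ M) (hc : c ≤ M) :
    |Real.exp a - Real.exp c| ≤ Real.exp M * |a - c| := by
  wlog h : c ≤ a generalizing a c
  · rw [abs_sub_comm, abs_sub_comm a]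
    exact this hc ha (le_of_not_ge h)
  have h1 := Real.add_one_le_exp (c - a)
  have h2 : Real.exp c = Real.exp a * Real.exp (c - a) := by
    rw [← Real.exp_add]; congr 1; ring
  have h3 : Real.exp a ≤ Real.exp M := Real.exp_le_exp.2 ha
  rw [abs_of_nonneg (sub_nonneg.2 (Real.exp_le_exp.2 h)), abs_of_nonneg (sub_nonneg.2 h)]
  have h4 := Real.exp_pos a
  calc Real.exp a - Real.exp c ≤ Real.exp a * (a - c) := by rw [h2]; nlinarith
    _ ≤ _ := mul_le_mul_of_nonneg_right h3 (sub_nonneg.2 h)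

/-- The evolution of the exponential of the tail integral of a bounded function. -/
lemma exp_tail_integral_eq {y : ℝ → ℝ} (hy : Measurable y) {K : ℝ} (h0 : ∀ u, 0 ≤ y u)
    (hK : ∀ u, y u ≤ K) {s r T : ℝ} (hsr : s ≤ r) (hrT : r ≤ T) :
    Real.exp (∫ v in s..T, y v) = Real.exp (∫ v in r..T, y v) +
      ∫ u in s..r, y u * Real.exp (∫ v in u..T, y v) := by
  have hii : ∀ a c, IntervalIntegrable y volume a c := fun a c => by
    refine (intervalIntegrable_const (c := K)).mono_fun hy.aestronglyMeasurable
      (ae_of_all _ fun u => ?_)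
    show ‖y u‖ ≤ ‖K‖
    rw [Real.norm_of_nonneg (h0 u), Real.norm_of_nonneg ((h0 u).trans (hK u))]
    exact hK u
  have hK0 : 0 ≤ K := (h0 0).trans (hK 0)
  set F : ℝ → ℝ := fun u => ∫ v in u..T, y v with hF
  have hFsub : ∀ u v, F u - F v = ∫ w in u..v, y w := fun u v => by
    simp only [hF]
    rw [sub_eq_iff_eq_add, intervalIntegral.integral_add_adjacent_intervals (hii _ _) (hii _ _)]
  have hFlip : ∀ u v, |F u - F v| ≤ K * |u - v| := fun u v => by
    rw [hFsub, abs_sub_comm u v]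
    exact intervalIntegral.norm_integral_le_of_norm_le_const fun w _ => by
      rw [Real.norm_of_nonneg (h0 w)]; exact hK w
  have hFle : ∀ u ∈ Set.uIcc s r, F u ≤ K * (T - s) := fun u hu => by
    rw [Set.uIcc_of_le hsr] at hu
    have h1 := hFlip u T
    have h2 : F T = 0 := by simp [hF]
    rw [h2, sub_zero, abs_of_nonpos (by linarith [hu.2] : u - T ≤ 0)] at h1
    refine (le_abs_self _).trans (h1.trans ?_)
    exact mul_le_mul_of_nonneg_left (by linarith [hu.1]) hK0
  -- Since `y` is merely measurable, `F` is differentiable only almost everywhere; the Lipschitz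
  -- property gives the absolute continuity required by the fundamental theorem of calculus.
  have hlip : LipschitzOnWith (Real.exp (K * (T - s)) * K).toNNReal (fun u => Real.exp (F u))
      (Set.uIcc s r) := by
    refine LipschitzOnWith.of_dist_le_mul fun u hu v hv => ?_
    rw [Real.coe_toNNReal _ (by positivity), Real.dist_eq, Real.dist_eq, mul_assoc]
    exact (exp_sub_exp_le_mul (hFle u hu) (hFle v hv)).trans
      (mul_le_mul_of_nonneg_left (hFlip u v) (Real.exp_pos _).le)
  have hftc := hlip.absolutelyContinuousOnInterval.integral_deriv_eq_sub
  have hloc : LocallyIntegrable y volume := by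
    refine (locallyIntegrable_const K).mono hy.aestronglyMeasurable (ae_of_all _ fun u => ?_)
    rw [Real.norm_of_nonneg (h0 u), Real.norm_of_nonneg hK0]
    exact hK u
  have hderiv : ∀ᵐ u, deriv (fun u => Real.exp (F u)) u = -(y u * Real.exp (F u)) := by
    filter_upwards [LocallyIntegrable.ae_hasDerivAt_integral hloc] with u hu
    have h1 := (hu T).neg
    have h2 : (fun u => -∫ v in T..u, y v) = F := by
      ext u
      rw [hF, intervalIntegral.integral_symm u T, neg_neg]
    have h3 : HasDerivAt F (-y u) u := by
      rw [← h2]; exact h1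
    rw [h3.exp.deriv]
    ring
  have h4 : ∫ u in s..r, deriv (fun u => Real.exp (F u)) u =
      -∫ u in s..r, y u * Real.exp (F u) := by
    rw [← intervalIntegral.integral_neg]
    exact intervalIntegral.integral_congr_ae (hderiv.mono fun u hu _ => hu)
  rw [h4] at hftc
  simp only [hF] at hftc ⊢
  linarith

variable {Ω : Type*} {mΩ : MeasurableSpace Ω} {P : Measure Ω} [IsProbabilityMeasure P]
  {𝓕 : Filtration ℝ≥0 mΩ} {Y : ℝ → Ω → ℝ} {K T η : ℝ}

/-- Moving the domain of integration into the integrand turns this into a parametric integral over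
the line. -/
lemma measurable_tail_integral (hY : Measurable (Function.uncurry Y)) (T : ℝ) :
    Measurable fun p : ℝ × Ω => ∫ v in Set.Ioc p.1 T, Y v p.2 := by
  have h1 : Measurable fun z : (ℝ × Ω) × ℝ => if z.1.1 < z.2 ∧ z.2 ≤ T then Y z.2 z.1.2 else 0 := by
    refine Measurable.ite ?_ (hY.comp
      (measurable_snd.prodMk (measurable_snd.comp measurable_fst))) measurable_const
    exact (measurableSet_lt (measurable_fst.comp measurable_fst) measurable_snd).inter
      (measurableSet_le measurable_snd measurable_const)
  have h2 := (h1.stronglyMeasurable.integral_prod_right' (ν := (volume : Measure ℝ))).measurable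
  convert h2 using 2 with p
  rw [← integral_indicator measurableSet_Ioc]
  refine integral_congr_ae (ae_of_all _ fun v => ?_)
  simp only [Set.indicator, Set.mem_Ioc]

/-- Khasminskii's lemma without conditional expectations. -/
theorem lintegral_exp_le_two_pow (hY : Measurable (Function.uncurry Y)) (h0 : ∀ u ω, 0 ≤ Y u ω)
    (hK : ∀ u ω, Y u ω ≤ K)
    (had : ∀ u, 0 ≤ u → ∃ Z : Ω → ℝ, Measurable[𝓕 u.toNNReal] Z ∧ Y u =ᵐ[P] Z)
    (hη : ∀ s t, 0 ≤ s → s ≤ t → t ≤ T → t - s ≤ η → ∀ H : Ω → ℝ≥0∞,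
      Measurable[𝓕 s.toNNReal] H →
      ∫⁻ u in Set.Ioc s t, ∫⁻ ω, H ω * ENNReal.ofReal (Y u ω) ∂P ≤
        ENNReal.ofReal (1 / 2) * ∫⁻ ω, H ω ∂P) (N : ℕ) :
    ∀ s, 0 ≤ s → s ≤ T → T - s ≤ N * η → ∀ H : Ω → ℝ≥0∞, Measurable[𝓕 s.toNNReal] H →
      ∫⁻ ω, H ω * ENNReal.ofReal (Real.exp (∫ v in s..T, Y v ω)) ∂P ≤
        ENNReal.ofReal (2 ^ N) * ∫⁻ ω, H ω ∂P := by
  have hYω : ∀ ω, Measurable fun u => Y u ω := fun ω => hY.comp measurable_prodMk_right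
  induction N with
  | zero =>
    intro s _ hsT hs H _
    have : s = T := by
      simp only [Nat.cast_zero, zero_mul] at hs
      linarith
    simp [this]
  | succ N ih =>
    intro s hs hsT hsN H hH
    by_cases hcase : T - s ≤ N * η
    · refine (ih s hs hsT hcase H hH).trans (mul_le_mul_left (ENNReal.ofReal_le_ofReal ?_) _)
      exact pow_le_pow_right₀ one_le_two N.le_succ
    have hcase' : N * η < T - s := not_le.1 hcase
    push_cast at hsN
    -- The tail `[r, T]` belongs to the induction hypothesis, and `[s, r]` has length at most `η`.
    set r := T - N * η with hr
    have hη0 : 0 ≤ η := by linarith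
    have hrT : r ≤ T := by
      have : 0 ≤ (N : ℝ) * η := by positivity
      linarith
    have hsr : s ≤ r := by linarith
    have hK0 : 0 ≤ K := by
      obtain ⟨ω⟩ : Nonempty Ω := nonempty_of_isProbabilityMeasure P
      exact (h0 0 ω).trans (hK 0 ω)
    have hT0 : 0 ≤ T := hs.trans hsT
    -- By the tail identity, a bound with constant `C` for all start times in the last interval
    -- improves to `2 ^ N + C / 2`. Iterating from a crude bound, available as `Y ≤ K`, converges to
    -- the fixed point `2 ^ (N + 1)`.
    have key : ∀ n : ℕ, ∀ s, 0 ≤ s → s ≤ r → r - s ≤ η → ∀ H : Ω → ℝ≥0∞,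
        Measurable[𝓕 s.toNNReal] H →
        ∫⁻ ω, H ω * ENNReal.ofReal (Real.exp (∫ v in s..T, Y v ω)) ∂P ≤
          ENNReal.ofReal (2 ^ (N + 1) + Real.exp (K * T) * (1 / 2) ^ n) * ∫⁻ ω, H ω ∂P := by
      intro n
      induction n with
      | zero =>
        intro s hs hsr _ H hH
        rw [← lintegral_const_mul' _ _ ENNReal.ofReal_ne_top]
        refine lintegral_mono fun ω => ?_
        simp only
        rw [mul_comm]
        refine mul_le_mul_left (ENNReal.ofReal_le_ofReal ?_) _
        have h1 : ∫ v in s..T, Y v ω ≤ K * T := by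
          have h2 : ‖∫ v in s..T, Y v ω‖ ≤ K * |T - s| :=
            intervalIntegral.norm_integral_le_of_norm_le_const fun w _ => by
              rw [Real.norm_of_nonneg (h0 w ω)]; exact hK w ω
          refine (le_abs_self _).trans (h2.trans ?_)
          rw [abs_of_nonneg (by linarith)]
          exact mul_le_mul_of_nonneg_left (by linarith) hK0
        have h2 := Real.exp_le_exp.2 h1
        have h3 : (0 : ℝ) ≤ 2 ^ (N + 1) := by positivity
        rw [pow_zero, mul_one]
        linarith
      | succ n ihn =>
        intro s hs hsr hrs H hH
        have hHm : Measurable H := hH.mono (𝓕.le _) le_rfl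
        set Cn := 2 ^ (N + 1) + Real.exp (K * T) * (1 / 2) ^ n with hCn
        have hCn0 : 0 ≤ Cn := by positivity
        set g : ℝ → Ω → ℝ := fun u ω => Y u ω * Real.exp (∫ v in Set.Ioc u T, Y v ω) with hg
        have hgm : Measurable (Function.uncurry g) :=
          hY.mul (Real.measurable_exp.comp (measurable_tail_integral hY T))
        have hg0 : ∀ u ω, 0 ≤ g u ω := fun u ω => mul_nonneg (h0 u ω) (Real.exp_pos _).le
        have htail : ∀ u ω, u ≤ T → ∫ v in u..T, Y v ω = ∫ v in Set.Ioc u T, Y v ω :=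
          fun u ω hu => intervalIntegral.integral_of_le hu
        have hid : ∀ ω, ENNReal.ofReal (Real.exp (∫ v in s..T, Y v ω)) =
            ENNReal.ofReal (Real.exp (∫ v in r..T, Y v ω)) +
              ∫⁻ u in Set.Ioc s r, ENNReal.ofReal (g u ω) := by
          intro ω
          have h1 := exp_tail_integral_eq (hYω ω) (fun u => h0 u ω) (fun u => hK u ω) hsr hrT
          have h2 : ∫ u in s..r, Y u ω * Real.exp (∫ v in u..T, Y v ω) =
              ∫ u in Set.Ioc s r, g u ω := by
            rw [intervalIntegral.integral_of_le hsr]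
            refine setIntegral_congr_fun measurableSet_Ioc fun u hu => ?_
            simp only [hg]
            rw [htail u ω (hu.2.trans hrT)]
          rw [h1, h2, ENNReal.ofReal_add (Real.exp_pos _).le
            (integral_nonneg fun u => hg0 u ω), ofReal_integral_eq_lintegral_ofReal _
            (ae_of_all _ fun u => hg0 u ω)]
          have hbd : ∀ u ∈ Set.Ioc s r, ‖g u ω‖ ≤ K * Real.exp (K * (T - s)) := by
            intro u hu
            rw [Real.norm_of_nonneg (hg0 u ω)]
            simp only [hg]
            refine mul_le_mul (hK u ω) (Real.exp_le_exp.2 ?_) (Real.exp_pos _).le hK0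
            rw [← htail u ω (hu.2.trans hrT)]
            have h2 : ‖∫ v in u..T, Y v ω‖ ≤ K * |T - u| :=
              intervalIntegral.norm_integral_le_of_norm_le_const fun w _ => by
                rw [Real.norm_of_nonneg (h0 w ω)]; exact hK w ω
            refine (le_abs_self _).trans (h2.trans ?_)
            rw [abs_of_nonneg (by linarith [hu.2])]
            exact mul_le_mul_of_nonneg_left (by linarith [hu.1]) hK0
          exact Measure.integrableOn_of_bounded (by simp)
            (hgm.comp measurable_prodMk_right).aestronglyMeasurable
            ((ae_restrict_iff' measurableSet_Ioc).2 (ae_of_all _ hbd))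
        have hrest : ∀ u ∈ Set.Ioc s r, ∫⁻ ω, H ω * ENNReal.ofReal (g u ω) ∂P ≤
            ENNReal.ofReal Cn * ∫⁻ ω, H ω * ENNReal.ofReal (Y u ω) ∂P := by
          intro u hu
          have hu0 : 0 ≤ u := hs.trans hu.1.le
          obtain ⟨Z, hZ, hYZ⟩ := had u hu0
          have hHu : Measurable[𝓕 u.toNNReal] H :=
            hH.mono (𝓕.mono (Real.toNNReal_le_toNNReal hu.1.le)) le_rfl
          -- `H` times the value of the process at `u` is, up to a null set, again a weight known at
          -- time `u`; this replaces conditioning at `u`.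
          have h1 := ihn u hu0 hu.2 (by linarith [hu.1]) (fun ω => H ω * ENNReal.ofReal (Z ω))
            (hHu.mul hZ.ennreal_ofReal)
          have e1 : ∫⁻ ω, H ω * ENNReal.ofReal (g u ω) ∂P =
              ∫⁻ ω, H ω * ENNReal.ofReal (Z ω) *
                ENNReal.ofReal (Real.exp (∫ v in u..T, Y v ω)) ∂P := by
            refine lintegral_congr_ae (hYZ.mono fun ω hω => ?_)
            simp only [hg]
            rw [htail u ω (hu.2.trans hrT), ENNReal.ofReal_mul (h0 u ω), hω, mul_assoc]
          have e2 : ∫⁻ ω, H ω * ENNReal.ofReal (Y u ω) ∂P =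
              ∫⁻ ω, H ω * ENNReal.ofReal (Z ω) ∂P :=
            lintegral_congr_ae (hYZ.mono fun ω hω => by simp only [hω])
          rw [e1, e2]
          exact h1
        have hjoint : Measurable (Function.uncurry fun ω u => H ω * ENNReal.ofReal (g u ω)) :=
          (hHm.comp measurable_fst).mul (hgm.comp measurable_swap).ennreal_ofReal
        calc ∫⁻ ω, H ω * ENNReal.ofReal (Real.exp (∫ v in s..T, Y v ω)) ∂P
            = ∫⁻ ω, H ω * ENNReal.ofReal (Real.exp (∫ v in r..T, Y v ω)) +
                ∫⁻ u in Set.Ioc s r, H ω * ENNReal.ofReal (g u ω) ∂volume ∂P := by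
              refine lintegral_congr fun ω => ?_
              have hgω : Measurable fun u => ENNReal.ofReal (g u ω) :=
                (hgm.comp measurable_prodMk_right).ennreal_ofReal
              rw [hid, mul_add, lintegral_const_mul _ hgω]
          _ = ∫⁻ ω, H ω * ENNReal.ofReal (Real.exp (∫ v in r..T, Y v ω)) ∂P +
                ∫⁻ u in Set.Ioc s r, ∫⁻ ω, H ω * ENNReal.ofReal (g u ω) ∂P := by
              have hint : Measurable fun ω => ∫⁻ u in Set.Ioc s r, H ω * ENNReal.ofReal (g u ω) :=
                hjoint.lintegral_prod_right'
              rw [lintegral_add_right _ hint,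
                lintegral_lintegral_swap hjoint.aemeasurable]
          _ ≤ ENNReal.ofReal (2 ^ N) * ∫⁻ ω, H ω ∂P +
                ENNReal.ofReal Cn * (ENNReal.ofReal (1 / 2) * ∫⁻ ω, H ω ∂P) := by
              refine add_le_add ?_ ?_
              · refine ih r (hs.trans hsr) hrT (by rw [hr]; linarith) H ?_
                exact hH.mono (𝓕.mono (Real.toNNReal_le_toNNReal hsr)) le_rfl
              · refine (setLIntegral_mono' measurableSet_Ioc hrest).trans ?_
                rw [lintegral_const_mul' _ _ ENNReal.ofReal_ne_top]
                exact mul_le_mul_right (hη s r hs hsr hrT hrs H hH) _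
          _ = ENNReal.ofReal (2 ^ N + Cn * (1 / 2)) * ∫⁻ ω, H ω ∂P := by
              rw [← mul_assoc, ← add_mul, ← ENNReal.ofReal_mul hCn0,
                ← ENNReal.ofReal_add (by positivity) (by positivity)]
          _ = _ := by
              congr 2
              rw [hCn]
              ring
    have hlim : Filter.Tendsto (fun n : ℕ =>
        ENNReal.ofReal (2 ^ (N + 1) + Real.exp (K * T) * (1 / 2) ^ n) * ∫⁻ ω, H ω ∂P)
        Filter.atTop (nhds (ENNReal.ofReal (2 ^ (N + 1)) * ∫⁻ ω, H ω ∂P)) := by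
      refine ENNReal.Tendsto.mul_const (ENNReal.tendsto_ofReal ?_) (Or.inl (by simp))
      have h1 := (tendsto_pow_atTop_nhds_zero_of_lt_one (r := (1 / 2 : ℝ)) (by norm_num)
        (by norm_num)).const_mul (Real.exp (K * T))
      simpa using h1.const_add ((2 : ℝ) ^ (N + 1))
    exact ge_of_tendsto' hlim fun n => key n s hs hsr (by rw [hr]; linarith) H hH

end Khasminskii

/-! ### Unbounded processes and joint measurability. -/

section ExponentialMoment

variable {Ω : Type*} {mΩ : MeasurableSpace Ω} {P : Measure Ω} [IsProbabilityMeasure P]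
  {𝓕 : Filtration ℝ≥0 mΩ} {d m : ℕ}
  {b : E d → E d} {σ : E d → Matrix (Fin d) (Fin m) ℝ} {lo hi L₀ : ℝ} {x : E d} {δ : ℝ≥0}

lemma alpha0_nonneg {T B p q : ℝ} (hd : 0 < d) (hT : 0 ≤ T) (hB : 0 ≤ B)
    (hL : 0 ≤ L₀) (hlo : 0 < lo) (hlohi : lo ≤ hi) (hp : 1 < p) (hq : 1 < q)
    (hpq : (d : ℝ) / p + 2 / q < 2) : 0 ≤ alpha0 d m T B L₀ lo hi p q := by
  have hhi : 0 < hi := hlo.trans_le hlohi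
  have hk := kap_pos d hhi
  have hγ := gamma0_pos hpq
  have hp1 : 0 < 1 - 1 / p := by
    rw [sub_pos, div_lt_one (by linarith)]; exact hp
  have hq1 : 0 < 1 - 1 / q := by
    rw [sub_pos, div_lt_one (by linarith)]; exact hq
  refine le_trans ?_ (densConst_mul_le_alpha0 hd hT hB hL hlo hlohi hp hq hpq)
  have h1 := kapRatio_pos d hlo hhi
  have h2 := one_le_mlSeries (stepConst_nonneg d (T := T) hB hL hlo hhi) T
  unfold densConst
  positivity

/-- Khasminskii's lemma for processes that need not be bounded. -/
theorem lintegral_exp_le_two_pow_of_integrable {Y : ℝ → Ω → ℝ} {T η : ℝ} (hT : 0 ≤ T)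
    (hY : Measurable (Function.uncurry Y)) (h0 : ∀ u ω, 0 ≤ Y u ω)
    (hint : ∀ᵐ ω ∂P, IntegrableOn (fun u => Y u ω) (Set.Ioc 0 T))
    (had : ∀ u, 0 ≤ u → ∃ Z : Ω → ℝ, Measurable[𝓕 u.toNNReal] Z ∧ Y u =ᵐ[P] Z)
    (hη : ∀ s t, 0 ≤ s → s ≤ t → t ≤ T → t - s ≤ η → ∀ H : Ω → ℝ≥0∞,
      Measurable[𝓕 s.toNNReal] H →
      ∫⁻ u in Set.Ioc s t, ∫⁻ ω, H ω * ENNReal.ofReal (Y u ω) ∂P ≤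
        ENNReal.ofReal (1 / 2) * ∫⁻ ω, H ω ∂P) {N : ℕ} (hN : T ≤ N * η) :
    ∫⁻ ω, ENNReal.ofReal (Real.exp (∫ v in Set.Ioc 0 T, Y v ω)) ∂P ≤ ENNReal.ofReal (2 ^ N) := by
  -- Truncation at `k` provides the bound required above. Integrable paths make the truncated
  -- integrals converge, and Fatou's lemma carries the uniform bound to the limit.
  set Yt : ℕ → ℝ → Ω → ℝ := fun k u ω => min (Y u ω) k with hYt
  have hYtm : ∀ k, Measurable (Function.uncurry (Yt k)) := fun k => hY.min measurable_const
  have hbound : ∀ k : ℕ,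
      ∫⁻ ω, ENNReal.ofReal (Real.exp (∫ v in Set.Ioc 0 T, Yt k v ω)) ∂P ≤
        ENNReal.ofReal (2 ^ N) := by
    intro k
    have h := lintegral_exp_le_two_pow (P := P) (𝓕 := 𝓕) (Y := Yt k) (K := k) (T := T) (η := η)
      (hYtm k) (fun u ω => le_min (h0 u ω) k.cast_nonneg) (fun u ω => min_le_right _ _)
      (fun u hu => ?_) (fun s t hs hst htT hη' H hH => ?_) N 0 le_rfl hT (by simpa using hN)
      (fun _ => 1) measurable_const
    · simpa [intervalIntegral.integral_of_le hT] using h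
    · obtain ⟨Z, hZ, hYZ⟩ := had u hu
      refine ⟨fun ω => min (Z ω) k, hZ.min measurable_const, hYZ.mono fun ω hω => ?_⟩
      simp only [hYt, hω]
    · refine le_trans (lintegral_mono fun u => lintegral_mono fun ω => ?_) (hη s t hs hst htT hη' H hH)
      exact mul_le_mul_right (ENNReal.ofReal_le_ofReal (min_le_left _ _)) _
  have hlim : ∀ᵐ ω ∂P, Filter.Tendsto
      (fun k : ℕ => ENNReal.ofReal (Real.exp (∫ v in Set.Ioc 0 T, Yt k v ω))) Filter.atTop
      (nhds (ENNReal.ofReal (Real.exp (∫ v in Set.Ioc 0 T, Y v ω)))) := by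
    filter_upwards [hint] with ω hω
    refine ENNReal.tendsto_ofReal ((Real.continuous_exp.tendsto _).comp ?_)
    refine tendsto_integral_of_dominated_convergence (fun u => Y u ω)
      (fun k => ((hYtm k).comp measurable_prodMk_right).aestronglyMeasurable) hω
      (fun k => ae_of_all _ fun u => ?_) (ae_of_all _ fun u => ?_)
    · rw [Real.norm_of_nonneg (le_min (h0 u ω) k.cast_nonneg)]
      exact min_le_left _ _
    · refine tendsto_const_nhds.congr' ?_
      filter_upwards [Filter.eventually_ge_atTop ⌈Y u ω⌉₊] with k hk
      exact (min_eq_left (Nat.ceil_le.1 hk)).symm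
  calc ∫⁻ ω, ENNReal.ofReal (Real.exp (∫ v in Set.Ioc 0 T, Y v ω)) ∂P
      = ∫⁻ ω, Filter.liminf (fun k : ℕ =>
          ENNReal.ofReal (Real.exp (∫ v in Set.Ioc 0 T, Yt k v ω))) Filter.atTop ∂P :=
        lintegral_congr_ae (hlim.mono fun ω hω => hω.liminf_eq.symm)
    _ ≤ Filter.liminf (fun k : ℕ =>
          ∫⁻ ω, ENNReal.ofReal (Real.exp (∫ v in Set.Ioc 0 T, Yt k v ω)) ∂P) Filter.atTop := by
        refine lintegral_liminf_le fun k => ?_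
        exact (Real.measurable_exp.comp ((measurable_tail_integral (hYtm k) T).comp
          (measurable_const.prodMk measurable_id))).ennreal_ofReal
    _ ≤ ENNReal.ofReal (2 ^ N) := by
        refine Filter.liminf_le_of_frequently_le' (Filter.Frequently.of_forall hbound)

/-- The grid index takes countably many values, so it may be fixed; for a fixed index the claim
follows from joint measurability of a process with continuous paths. -/
lemma measurable_uncurry_emPath {W : ℝ≥0 → Ω → E m} (hW : ∀ t, Measurable (W t))
    (hWc : ∀ ω, Continuous fun t => W t ω) (hb : Measurable b)
    (hσ : DiffusionAssumption σ lo hi L₀) :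
    Measurable fun z : ℝ × Ω => emPath b σ x δ (fun r => W r z.2) z.1.toNNReal := by
  have hWj : Measurable (Function.uncurry W) :=
    measurable_uncurry_of_continuous_of_measurable hWc hW
  have hgrid : ∀ k, Measurable fun ω => emGrid b σ x δ (fun r => W r ω) k := fun k =>
    measurable_emGrid (𝓕 := Filtration.const ℝ≥0 mΩ le_rfl) hW hb hσ k
  set G : ℕ × (ℝ × Ω) → E d := fun z =>
    emGrid b σ x δ (fun r => W r z.2.2) z.1 +
      ((z.2.1.toNNReal : ℝ) - (z.1 : ℝ) * δ) • b (emGrid b σ x δ (fun r => W r z.2.2) z.1) +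
      act (σ (emGrid b σ x δ (fun r => W r z.2.2) z.1))
        (W z.2.1.toNNReal z.2.2 - W ((z.1 : ℕ) * δ) z.2.2) with hG
  have hGm : Measurable G := by
    refine measurable_from_prod_countable_right fun k => ?_
    have h1 : Measurable fun z : ℝ × Ω => emGrid b σ x δ (fun r => W r z.2) k :=
      (hgrid k).comp measurable_snd
    have h2 : Measurable fun z : ℝ × Ω => W z.1.toNNReal z.2 :=
      hWj.comp (measurable_fst.real_toNNReal.prodMk measurable_snd)
    have h3 : Measurable fun z : ℝ × Ω => W ((k : ℕ) * δ) z.2 := (hW _).comp measurable_snd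
    have h4 : Measurable fun z : ℝ × Ω => (z.1.toNNReal : ℝ) - (k : ℝ) * δ :=
      (measurable_fst.real_toNNReal.coe_nnreal_real).sub_const _
    exact (h1.add (h4.smul (hb.comp h1))).add
      (hσ.continuous_act_uncurry.measurable.comp (h1.prodMk (h2.sub h3)))
  have hfl : Measurable fun z : ℝ × Ω => ⌊z.1.toNNReal / δ⌋₊ :=
    Nat.measurable_floor.comp (measurable_fst.real_toNNReal.div_const δ)
  exact hGm.comp (hfl.prodMk measurable_id)

-- The paths are set to zero on a measurable null set containing the discontinuous ones. Adaptedness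
-- may be lost, as this set need not lie in the filtration.
omit [IsProbabilityMeasure P] in
lemma IsBrownian.exists_continuous_version {W : ℝ≥0 → Ω → E m} (hW : IsBrownian W 𝓕 P) :
    ∃ W' : ℝ≥0 → Ω → E m, (∀ t, Measurable (W' t)) ∧ (∀ ω, Continuous fun t => W' t ω) ∧
      ∀ᵐ ω ∂P, (fun t => W' t ω) = fun t => W t ω := by
  classical
  obtain ⟨t, ht, htm, htP⟩ := exists_measurable_superset_of_null (ae_iff.1 hW.continuous)
  refine ⟨fun s => t.piecewise 0 (W s), fun s => ?_, fun ω => ?_, ?_⟩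
  · exact Measurable.piecewise htm measurable_zero ((hW.adapted s).mono (𝓕.le s) le_rfl)
  · by_cases hω : ω ∈ t
    · simpa only [Set.piecewise_eq_of_mem _ _ _ hω] using continuous_const
    · simp only [Set.piecewise_eq_of_notMem _ _ _ hω]
      by_contra h
      exact hω (ht h)
  · filter_upwards [measure_eq_zero_iff_ae_notMem.1 htP] with ω hω
    ext1 s
    exact Set.piecewise_eq_of_notMem _ _ _ hω

end ExponentialMoment

end EMScheme

end

/-! ### Assembly of the main theorem. -/

open EMScheme in
theorem lemma2p3 {Ω : Type*} {mΩ : MeasurableSpace Ω} (P : Measure Ω) [IsProbabilityMeasure P]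
    (𝓕 : Filtration ℝ≥0 mΩ) {d m n : ℕ} (hd : 0 < d)
    (W : ℝ≥0 → Ω → EMScheme.E m) (hW : EMScheme.IsBrownian W 𝓕 P)
    (b : EMScheme.E d → EMScheme.E d) (hb : EMScheme.DriftAssumption b)
    (σ : EMScheme.E d → Matrix (Fin d) (Fin m) ℝ) (lo hi L₀ : ℝ)
    (hσ : EMScheme.DiffusionAssumption σ lo hi L₀)
    (x : EMScheme.E d) (δ : ℝ≥0) (hδ0 : 0 < δ) (hδ1 : δ < 1)
    (T : ℝ) (hT : 0 ≤ T) (p q : ℝ) (hp : 1 < p) (hq : 1 < q) (hpq : (d : ℝ) / p + 2 / q < 2)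
    (f : ℝ → EMScheme.E d → EMScheme.E n) (hf : EMScheme.MemLpq f p q T)
    (lam : ℝ) (hlam : 0 < lam) :
    (∀ᵐ ω ∂P, IntegrableOn
      (fun t : ℝ => ‖f t (EMScheme.emPath b σ x δ (fun s => W s ω) t.toNNReal)‖)
      (Set.Icc 0 T) volume) ∧
    Integrable (fun ω => Real.exp (lam * ∫ t in Set.Icc 0 T,
      ‖f t (EMScheme.emPath b σ x δ (fun s => W s ω) t.toNNReal)‖)) P ∧
    ∫ ω, Real.exp (lam * ∫ t in Set.Icc 0 T,
      ‖f t (EMScheme.emPath b σ x δ (fun s => W s ω) t.toNNReal)‖) ∂P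
      ≤ (2 : ℝ) ^ (1 + T * (2 * lam
          * EMScheme.alpha0 d m T (EMScheme.supNorm b) L₀ lo hi p q
          * EMScheme.normLpq f p q T) ^ EMScheme.gamma0 d p q) := by
  obtain ⟨hfm, hfin⟩ := hf
  set B := supNorm b with hB
  have hbB : ∀ y, ‖b y‖ ≤ B := fun y => le_ciSup hb.bounded y
  have hB0 : 0 ≤ B := (norm_nonneg _).trans (hbB 0)
  set F := normLpq f p q T with hF
  have hF0 : 0 ≤ F := ENNReal.toReal_nonneg
  have hFe : eNormLpq f p q T = ENNReal.ofReal F := (ENNReal.ofReal_toReal hfin.ne).symm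
  have hγ : 0 < gamma0 d p q := gamma0_pos hpq
  set γ := gamma0 d p q with hγd
  set A := alpha0 d m T B L₀ lo hi p q with hA
  obtain ⟨W', hW'm, hW'c, hW'⟩ := hW.exists_continuous_version
  set X : ℝ → Ω → E d := fun u ω => emPath b σ x δ (fun s => W s ω) u.toNNReal with hX
  -- `X'` is jointly measurable and `X` is adapted; almost surely they agree at all times, so each
  -- serves where it is needed.
  set X' : ℝ → Ω → E d := fun u ω => emPath b σ x δ (fun s => W' s ω) u.toNNReal with hX'
  have hXX : ∀ᵐ ω ∂P, ∀ u, X' u ω = X u ω := hW'.mono fun ω hω u => by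
    simp only [hX, hX', hω]
  have hX'm : Measurable (Function.uncurry X') :=
    measurable_uncurry_emPath hW'm hW'c hb.measurable hσ
  have hfX' : Measurable (Function.uncurry fun u ω => f u (X' u ω)) :=
    hfm.comp (measurable_fst.prodMk hX'm)
  have hkry : ∀ s t, 0 ≤ s → s ≤ t → t ≤ T → ∀ H : Ω → ℝ≥0∞, Measurable[𝓕 s.toNNReal] H →
      ∫⁻ u in Set.Ioc s t, ∫⁻ ω, H ω * ‖f u (X' u ω)‖ₑ ∂P ≤
        ENNReal.ofReal (A * (t - s) ^ (1 / γ)) * ENNReal.ofReal F * ∫⁻ ω, H ω ∂P := by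
    intro s t hs hst htT H hH
    have h := lintegral_lintegral_emPath_le (x := x) hW hd hb.measurable hbB hσ hδ0 hδ1 hp hq hpq hs
      hst htT hH (φ := fun u y => ‖f u y‖ₑ) hfm.enorm
    have e : ∀ u, ∫⁻ ω, H ω * ‖f u (X' u ω)‖ₑ ∂P = ∫⁻ ω, H ω * ‖f u (X u ω)‖ₑ ∂P := fun u =>
      lintegral_congr_ae (hXX.mono fun ω hω => by simp only [hω])
    simp only [e]
    rw [← hFe]
    exact h
  have hint : ∀ᵐ ω ∂P, IntegrableOn (fun u => f u (X' u ω)) (Set.Ioc 0 T) := by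
    have h := hkry 0 T le_rfl hT le_rfl (fun _ => 1) measurable_const
    simp only [one_mul, lintegral_const, measure_univ, mul_one] at h
    rw [← lintegral_lintegral_swap (f := fun ω u => ‖f u (X' u ω)‖ₑ)
      (hfX'.comp measurable_swap).enorm.aemeasurable] at h
    have h2 := ae_lt_top (hfX'.comp measurable_swap).enorm.lintegral_prod_right'
      (h.trans_lt (ENNReal.mul_lt_top ENNReal.ofReal_lt_top ENNReal.ofReal_lt_top)).ne
    filter_upwards [h2] with ω hω
    exact ⟨(hfX'.comp measurable_prodMk_right).aestronglyMeasurable, hω⟩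
  set Y : ℝ → Ω → ℝ := fun u ω => lam * ‖f u (X' u ω)‖ with hY
  have hYm : Measurable (Function.uncurry Y) := hfX'.norm.const_mul lam
  have hY0 : ∀ u ω, 0 ≤ Y u ω := fun u ω => by positivity
  have hA0 : 0 ≤ A := alpha0_nonneg hd hT hB0 hσ.L_pos.le hσ.lo_pos (hσ.lo_le_hi hd) hp hq hpq
  set c := 2 * lam * A * F with hc
  have hc0 : 0 ≤ c := by positivity
  set Q := c ^ γ with hQ
  have hQ0 : 0 ≤ Q := by positivity
  -- With `η = T / N` this choice gives `η Q ≤ 1`, that is `c η ^ (1/γ) ≤ 1`, and the 2 in `c` makes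
  -- the Krylov bound at most `1/2`. The added one also keeps `N` positive and is the `1` in the
  -- final exponent.
  set N := ⌊T * Q⌋₊ + 1 with hN
  have hNpos : (0 : ℝ) < N := by rw [hN]; positivity
  have hNQ : T * Q ≤ N := by
    rw [hN]; push_cast; exact (Nat.lt_floor_add_one _).le
  have hηQ : T / N * Q ≤ 1 := by
    rw [div_mul_eq_mul_div, div_le_one hNpos]; exact hNQ
  have hkhas := lintegral_exp_le_two_pow_of_integrable (P := P) (𝓕 := 𝓕) (Y := Y) (η := T / N) hT
    hYm hY0 (hint.mono fun ω hω => hω.norm.const_mul lam) (fun u hu => ?_)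
    (fun s t hs hst htT hη H hH => ?_) (N := N) (by rw [mul_div_cancel₀ _ hNpos.ne'])
  rotate_left
  · refine ⟨fun ω => lam * ‖f u (X u ω)‖, ?_, hXX.mono fun ω hω => by simp only [hY, hω]⟩
    have h1 := measurable_emPath (x := x) hW.adapted hb.measurable hσ hδ0 u.toNNReal
    have h2 : Measurable fun y => lam * ‖f u y‖ :=
      (hfm.comp measurable_prodMk_left).norm.const_mul lam
    exact h2.comp h1
  · have e : ∀ u ω, H ω * ENNReal.ofReal (Y u ω) =
        ENNReal.ofReal lam * (H ω * ‖f u (X' u ω)‖ₑ) := fun u ω => by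
      simp only [hY]
      rw [ENNReal.ofReal_mul hlam.le, ofReal_norm, mul_left_comm]
    simp only [e, lintegral_const_mul' _ _ ENNReal.ofReal_ne_top]
    refine (mul_le_mul_right (hkry s t hs hst htT H hH) _).trans ?_
    have hts : 0 ≤ t - s := sub_nonneg.2 hst
    have hr : 0 ≤ (t - s) ^ (1 / γ) := Real.rpow_nonneg hts _
    rw [← mul_assoc, ← mul_assoc, ← ENNReal.ofReal_mul hlam.le,
      ← ENNReal.ofReal_mul (by positivity)]
    refine mul_le_mul_left (ENNReal.ofReal_le_ofReal ?_) _
    have h1 : c * (t - s) ^ (1 / γ) ≤ 1 := by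
      have h2 : c = Q ^ (1 / γ) := by
        rw [hQ, ← Real.rpow_mul hc0, mul_one_div_cancel hγ.ne', Real.rpow_one]
      rw [h2, ← Real.mul_rpow hQ0 hts]
      refine Real.rpow_le_one (by positivity) ?_ (by positivity)
      calc Q * (t - s) ≤ Q * (T / N) := mul_le_mul_of_nonneg_left hη hQ0
        _ ≤ 1 := by rw [mul_comm]; exact hηQ
    rw [hc] at h1
    linarith
  have hexp : ∀ᵐ ω ∂P, Real.exp (∫ v in Set.Ioc 0 T, Y v ω) =
      Real.exp (lam * ∫ t in Set.Icc 0 T, ‖f t (X t ω)‖) := hXX.mono fun ω hω => by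
    simp only [hY, hω]
    rw [integral_const_mul, integral_Icc_eq_integral_Ioc]
  have hmeas : Measurable fun ω => Real.exp (∫ v in Set.Ioc 0 T, Y v ω) :=
    Real.measurable_exp.comp ((measurable_tail_integral hYm T).comp
      (measurable_const.prodMk measurable_id))
  have hI : Integrable (fun ω => Real.exp (∫ v in Set.Ioc 0 T, Y v ω)) P := by
    refine ⟨hmeas.aestronglyMeasurable, ?_⟩
    rw [hasFiniteIntegral_iff_ofReal (ae_of_all _ fun ω => (Real.exp_pos _).le)]
    exact hkhas.trans_lt ENNReal.ofReal_lt_top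
  refine ⟨?_, hI.congr hexp, ?_⟩
  · filter_upwards [hint, hXX] with ω h1 h2
    rw [integrableOn_Icc_iff_integrableOn_Ioc]
    simp only [h2] at h1
    exact h1.norm
  · rw [← integral_congr_ae hexp, integral_eq_lintegral_of_nonneg_ae
      (ae_of_all _ fun ω => (Real.exp_pos _).le) hmeas.aestronglyMeasurable]
    refine (ENNReal.toReal_le_of_le_ofReal (by positivity) hkhas).trans ?_
    rw [← Real.rpow_natCast]
    refine Real.rpow_le_rpow_of_exponent_le one_le_two ?_
    have h1 := Nat.floor_le (mul_nonneg hT hQ0)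
    rw [hN]
    push_cast
    linarith
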